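/- **Setting.** Let $\mathbf{Ising}$ be the unitary modular category with simple objects $1,\sigma,\psi$, fusion $\sigma\otimes\sigma=1\oplus\psi$, $\sigma\otimes\psi=\sigma$, $\psi\otimes\psi=1$, and standard skeletal data $F^{\sigma\sigma\sigma}_\sigma=\frac1{\sqrt2}\begin{pmatrix}1&1\\1&-1\end{pmatrix}$, $F^{\psi\sigma\psi}_\sigma=F^{\sigma\psi\sigma}_\psi=-1$, $R^{\sigma\sigma}_1=e^{-\pi i/8}$, $R^{\sigma\sigma}_\psi=e^{3\pi i/8}$, $R^{\sigma\psi}_\sigma=R^{\psi\sigma}_\sigma=-i$, $R^{\psi\psi}_1=-1$ (all other admissible symbols are $1$), so that the twists are $\theta_1=1$, $\theta_\sigma=e^{2\pi i/16}$, $\theta_\psi=-1$ and $$S=\frac12\begin{pmatrix}1&\sqrt2&1\\ \sqrt2&0&-\sqrt2\\ 1&-\sqrt2&1\end{pmatrix}.$$ A unitary $\mathbb Z_2$-crossed braided extension of $\mathbf{Ising}\boxtimes\mathbf{Ising}$ by layer exchange means: a unitary solution $\{N,F,R,U,\eta\}$, in the standard vacuum normalization, of the $G$-crossed consistency equations (pentagon,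 the two heptagons, compatibility of the action with the associator, with its composition and with the crossing, and the cocycle equation for $\eta$) for $G=\mathbb Z_2$, with nine simple objects $ab:=a\boxtimes b$ ("anyons") in the trivial sector, where the data are those of $\mathbf{Ising}\boxtimes\mathbf{Ising}$, and three simple objects $X_1,X_\sigma,X_\psi$ ("defects") in the nontrivial sector; the generator of $\mathbb Z_2$ acts by $ab\mapsto ba$, $X_a\mapsto X_a$, and the fusion multiplicities are $N_{ab,X_c}^{X_d}=N_{X_c,ab}^{X_d}=\dim\mathrm{Hom}(d,a\otimes b\otimes c)$ and $N_{X_a,X_b}^{cd}=\dim\mathrm{Hom}(b,a\otimes c\otimes d)$. State spaces are the spaces $\mathrm{Hom}(11,x_1\otimes\cdots\otimes x_m)$ with the left-associated fusion trees as orthonormal basis. A *protocol* is a finite sequence of elementary operations on neighbouring strands: an exchange of two neighbouring strands (in either direction) by the $G$-crossed braiding, or the orthogonal projection of two neighbouring strands onto a fixed total charge (projective measurement with that outcome). The logical qubit is the span of the trees $|1\rangle,|\psi\rangle$ in $\mathrm{Hom}(11,(\sigma1)^{\otimes4}\otimes X_1^{\otimes4})$ with successive charges $\sigma1,\,x1,\,\sigma1,\,11,\,X_1,\,11,\,X_1,\,11$,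 where $x=1$, respectively $x=\psi$. The logical space of $n$ qubits is spanned by the concatenations of $n$ such trees, for $n$ blocks $(\sigma1)^{\otimes4}\otimes X_1^{\otimes4}$ side by side; it is identified with $(\mathbb C^2)^{\otimes n}$. A unitary $W$ on $(\mathbb C^2)^{\otimes n}$ is *realized* by a protocol if the protocol returns to the original sequence of objects, preserves the logical space, and acts on it as a nonzero scalar times $W$. Number the strands of a block $1,\dots,8$. Let $b_i$ be the exchange of strands $i,i+1$ in which the strand that comes from the left passes over, and $\bar b_i$ the one in which the strand that comes from the right passes over. The protocol $T$ consists, in chronological order, of $\bar b_4,\bar b_5,\bar b_6,\bar b_6,\bar b_5,b_4$ (the fourth anyon goes around the middle two defects, passing behind the first one, and returns), the projection of strands $3,4$ onto charge $11$, the full exchange $b_6,b_6$ of the middle two defects, and $\bar b_4,b_5,b_6,b_6,b_5,b_4$ (the inverse of the first braid). **Statement.** Let a unitary $\mathbb Z_2$-crossed braided extension of $\mathbf{Ising}\boxtimes\mathbf{Ising}$ by layer exchange be given with $$R^{X_1X_1}_{aa}=\theta_a\quad(a\in\{1,\sigma,\psi\})\qquad\text{and}\qquad \bigl[F^{X_1X_1X_1}_{X_1}\bigr]_{aa,bb}=S_{ab}.$$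 (Its existence is the content of the conjecture that this corollary presupposes.) Then: 1. $T$ returns to the original sequence of objects, and on the logical qubit its matrix is a $T$-gate up to normalization: $\langle\psi|T|1\rangle=\langle1|T|\psi\rangle=0$, $\langle1|T|1\rangle\neq0$, and $\langle\psi|T|\psi\rangle=e^{\pi i/4}\langle1|T|1\rangle$. 2. Braiding and projective measurement of bilayer Ising anyons together with the $\mathbb Z_2$ defects is universal for quantum computation. That is, there is a constant $K$ such that for every $n\ge 0$ there is a set $\mathcal S$ of at most $Kn$ unitaries on $(\mathbb C^2)^{\otimes n}$, each realized by a protocol of at most $K$ elementary operations, with the following property: there are constants $C,p$ (depending on $n$) such that for every unitary $V$ on $(\mathbb C^2)^{\otimes n}$ and every $0<\varepsilon\le\frac12$ some product of at most $C(\log\frac1\varepsilon)^p$ elements of $\mathcal S$ is within $\varepsilon$ of $V$ in operator norm, up to a global phase. -/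

import Mathlib

/-! ## Unitary `G`-crossed braided fusion categories in skeletal form -/

/-- The symbols `{N, F, R, U, η}` of a skeletal `G`-crossed braided fusion category with set of
simple objects `L`.

For each triple with `N a b c ≠ 0` an orthonormal basis `|a,b;c,μ⟩`, `μ < N a b c`, of
`V^{ab}_c = Hom(c, a ⊗ b)` is fixed, and
* `F a b c d (e,α,β) (f,μ,ν)` is the coefficient in
  `|a,b;e,α⟩|e,c;d,β⟩ = ∑ F^{abc}_d |b,c;f,μ⟩|a,f;d,ν⟩`;
* `R a b c μ ν`: with `h = deg b`, the crossing `b ⊗ ʰ⁻¹a → a ⊗ b` (strand `b` on top) sends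
  `|b,ʰ⁻¹a;c,μ⟩` to `∑_ν R^{ab}_c |a,b;c,ν⟩`;
* `U k a b c μ ν`: sliding a `k`-strand over the vertex `|ᵏ⁻¹a,ᵏ⁻¹b;ᵏ⁻¹c,μ⟩` turns it into
  `∑_ν U_k(a,b;c) |a,b;c,ν⟩`;
* `η x g h`: the factor `η_x(g,h)` for sliding the strand `x` under a vertex `c → a ⊗ b` with
  `deg a = g`, `deg b = h`. -/
structure CrossedSymbols (G L : Type) where
  N : L → L → L → ℕ
  one : L
  deg : L → G
  act : G → L → L
  F : L → L → L → L → L × ℕ × ℕ → L × ℕ × ℕ → ℂ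
  R : L → L → L → ℕ → ℕ → ℂ
  U : G → L → L → L → ℕ → ℕ → ℂ
  η : L → G → G → ℂ

namespace CrossedSymbols

open Finset

variable {G L : Type} [Group G] [Fintype L] [DecidableEq L]

/-- Fusion rules: unit, associativity, duals. -/
structure FusionAxioms (D : CrossedSymbols G L) : Prop where
  unit_left : ∀ a b, D.N D.one a b = if a = b then 1 else 0
  unit_right : ∀ a b, D.N a D.one b = if a = b then 1 else 0
  assoc : ∀ a b c d, ∑ e, D.N a b e * D.N e c d = ∑ f, D.N b c f * D.N a f d
  dual : ∀ a, ∃ b, (∀ c, D.N a c D.one = if c = b then 1 else 0) ∧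
    (∀ c, D.N c a D.one = if c = b then 1 else 0) ∧
    D.F a b a a (D.one, 0, 0) (D.one, 0, 0) ≠ 0

/-- The `G`-grading and the `G`-action on simple objects, compatible with fusion. -/
structure GradingAxioms (D : CrossedSymbols G L) : Prop where
  deg_one : D.deg D.one = 1
  deg_mul : ∀ a b c, D.N a b c ≠ 0 → D.deg c = D.deg a * D.deg b
  act_one : ∀ a, D.act 1 a = a
  act_mul : ∀ g h a, D.act (g * h) a = D.act g (D.act h a)
  act_unit : ∀ g, D.act g D.one = D.one
  deg_act : ∀ g a, D.deg (D.act g a) = g * D.deg a * g⁻¹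
  N_act : ∀ g a b c, D.N (D.act g a) (D.act g b) (D.act g c) = D.N a b c
  N_cross : ∀ a b c, D.N (D.act (D.deg a) b) a c = D.N a b c

/-- Unitarity of the `F`-, `R`-, `U`- and `η`-symbols. -/
structure UnitarityAxioms (D : CrossedSymbols G L) : Prop where
  F_row : ∀ a b c d e α β e' α' β',
    α < D.N a b e → β < D.N e c d → α' < D.N a b e' → β' < D.N e' c d →
    ∑ f, ∑ μ ∈ range (D.N b c f), ∑ ν ∈ range (D.N a f d),
        D.F a b c d (e, α, β) (f, μ, ν) * star (D.F a b c d (e', α', β') (f, μ, ν)) =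
      if (e, α, β) = (e', α', β') then 1 else 0
  F_col : ∀ a b c d f μ ν f' μ' ν',
    μ < D.N b c f → ν < D.N a f d → μ' < D.N b c f' → ν' < D.N a f' d →
    ∑ e, ∑ α ∈ range (D.N a b e), ∑ β ∈ range (D.N e c d),
        star (D.F a b c d (e, α, β) (f, μ, ν)) * D.F a b c d (e, α, β) (f', μ', ν') =
      if (f, μ, ν) = (f', μ', ν') then 1 else 0
  R_row : ∀ a b c μ μ', μ < D.N a b c → μ' < D.N a b c →
    ∑ ν ∈ range (D.N a b c), D.R a b c μ ν * star (D.R a b c μ' ν) = if μ = μ' then 1 else 0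
  R_col : ∀ a b c ν ν', ν < D.N a b c → ν' < D.N a b c →
    ∑ μ ∈ range (D.N a b c), star (D.R a b c μ ν) * D.R a b c μ ν' = if ν = ν' then 1 else 0
  U_row : ∀ k a b c μ μ', μ < D.N a b c → μ' < D.N a b c →
    ∑ ν ∈ range (D.N a b c), D.U k a b c μ ν * star (D.U k a b c μ' ν) = if μ = μ' then 1 else 0
  U_col : ∀ k a b c ν ν', ν < D.N a b c → ν' < D.N a b c →
    ∑ μ ∈ range (D.N a b c), star (D.U k a b c μ ν) * D.U k a b c μ ν' = if ν = ν' then 1 else 0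
  η_norm : ∀ x g h, ‖D.η x g h‖ = 1

/-- The standard normalization of symbols that involve the vacuum or the group identity. -/
structure NormalizationAxioms (D : CrossedSymbols G L) : Prop where
  F_one_left : ∀ b c d β μ, β < D.N b c d → μ < D.N b c d →
    D.F D.one b c d (b, 0, β) (d, μ, 0) = if β = μ then 1 else 0
  F_one_mid : ∀ a c d β ν, β < D.N a c d → ν < D.N a c d →
    D.F a D.one c d (a, 0, β) (c, 0, ν) = if β = ν then 1 else 0
  F_one_right : ∀ a b d α ν, α < D.N a b d → ν < D.N a b d →
    D.F a b D.one d (d, α, 0) (b, 0, ν) = if α = ν then 1 else 0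
  R_one_left : ∀ b, D.R D.one b b 0 0 = 1
  R_one_right : ∀ a, D.R a D.one a 0 0 = 1
  U_one : ∀ a b c μ ν, μ < D.N a b c → ν < D.N a b c →
    D.U 1 a b c μ ν = if μ = ν then 1 else 0
  U_one_left : ∀ k b, D.U k D.one b b 0 0 = 1
  U_one_right : ∀ k a, D.U k a D.one a 0 0 = 1
  η_vacuum : ∀ g h, D.η D.one g h = 1
  η_one_left : ∀ x h, D.η x 1 h = 1
  η_one_right : ∀ x g, D.η x g 1 = 1

/-- The `G`-crossed consistency equations. -/
structure ConsistencyAxioms (D : CrossedSymbols G L) : Prop where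
  pentagon : ∀ a b c d e f g k l α β γ μ ν τ,
    α < D.N a b f → β < D.N f c g → γ < D.N g d e →
    ν < D.N c d l → μ < D.N b l k → τ < D.N a k e →
    ∑ δ ∈ range (D.N f l e),
        D.F f c d e (g, β, γ) (l, ν, δ) * D.F a b l e (f, α, δ) (k, μ, τ) =
      ∑ h, ∑ ψ ∈ range (D.N b c h), ∑ σ ∈ range (D.N a h g), ∑ ρ ∈ range (D.N h d k),
        D.F a b c g (f, α, β) (h, ψ, σ) * D.F a h d e (g, σ, γ) (k, ρ, τ) *
          D.F b c d k (h, ψ, ρ) (l, ν, μ)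
  /-- `z` passes over `ᵏ⁻¹a ⊗ ᵏ⁻¹b`, where `k = deg z`. -/
  heptagon_over : ∀ z a b d e g a' b' α β γ δ,
    a' = D.act (D.deg z)⁻¹ a → b' = D.act (D.deg z)⁻¹ b →
    α < D.N z a' e → β < D.N e b' d → γ < D.N b z g → δ < D.N a g d →
    ∑ α' ∈ range (D.N a z e), ∑ γ' ∈ range (D.N z b' g),
        D.R a z e α α' * D.F a z b' d (e, α', β) (g, γ', δ) * D.R b z g γ' γ =
      ∑ f, ∑ μ ∈ range (D.N a b f), ∑ μ' ∈ range (D.N a b f),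
        ∑ ν ∈ range (D.N f z d), ∑ ν' ∈ range (D.N f z d),
          D.F z a' b' d (e, α, β) (D.act (D.deg z)⁻¹ f, μ, ν) * D.U (D.deg z) a b f μ μ' *
            D.R f z d ν ν' * D.F a b z d (f, μ', ν') (g, γ, δ)
  /-- `z` passes under `a ⊗ b`; the inverses of the unitary matrices `R` are their adjoints. -/
  heptagon_under : ∀ z a b d e g z' z'' α β γ δ,
    z' = D.act (D.deg a)⁻¹ z → z'' = D.act (D.deg a * D.deg b)⁻¹ z →
    α < D.N z a e → β < D.N e b d → γ < D.N b z'' g → δ < D.N a g d →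
    ∑ α' ∈ range (D.N a z' e), ∑ γ' ∈ range (D.N z' b g),
        star (D.R z a e α' α) * D.F a z' b d (e, α', β) (g, γ', δ) * star (D.R z' b g γ γ') =
      D.η z (D.deg a) (D.deg b) *
        ∑ f, ∑ μ ∈ range (D.N a b f), ∑ ν ∈ range (D.N z f d), ∑ ν' ∈ range (D.N f z'' d),
          D.F z a b d (e, α, β) (f, μ, ν) * star (D.R z f d ν' ν) *
            D.F a b z'' d (f, μ, ν') (g, γ, δ)
  /-- The action is compatible with the associator. -/
  F_U : ∀ k a b c d e f α β μ ν,
    α < D.N a b e → β < D.N e c d → μ < D.N b c f → ν < D.N a f d →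
    ∑ α' ∈ range (D.N a b e), ∑ β' ∈ range (D.N e c d),
        D.U k a b e α α' * D.U k e c d β β' * D.F a b c d (e, α', β') (f, μ, ν) =
      ∑ μ' ∈ range (D.N b c f), ∑ ν' ∈ range (D.N a f d),
        D.F (D.act k⁻¹ a) (D.act k⁻¹ b) (D.act k⁻¹ c) (D.act k⁻¹ d)
            (D.act k⁻¹ e, α, β) (D.act k⁻¹ f, μ', ν') *
          D.U k b c f μ' μ * D.U k a f d ν' ν
  /-- The isomorphisms between the actions of `k` after `l` and of `k * l` are monoidal. -/
  U_η : ∀ k l a b c μ ν, μ < D.N a b c → ν < D.N a b c →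
    D.η a k l * D.η b k l *
        ∑ κ ∈ range (D.N a b c),
          D.U l (D.act k⁻¹ a) (D.act k⁻¹ b) (D.act k⁻¹ c) μ κ * D.U k a b c κ ν =
      D.η c k l * D.U (k * l) a b c μ ν
  η_cocycle : ∀ x g h k,
    D.η x g h * D.η x (g * h) k = D.η (D.act g⁻¹ x) h k * D.η x g (h * k)
  /-- The action is compatible with the crossing. -/
  R_U : ∀ k a b c μ ν, μ < D.N a b c → ν < D.N a b c →
    D.η a k (k⁻¹ * D.deg b * k) *
        ∑ κ ∈ range (D.N a b c),
          D.R (D.act k⁻¹ a) (D.act k⁻¹ b) (D.act k⁻¹ c) μ κ * D.U k a b c κ ν =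
      D.η a (D.deg b) k *
        ∑ κ ∈ range (D.N a b c),
          D.U k b (D.act (D.deg b)⁻¹ a) c μ κ * D.R a b c κ ν

/-- `D` is a (skeletal) unitary `G`-crossed braided fusion category. -/
structure IsUnitaryCrossed (D : CrossedSymbols G L) : Prop where
  fusion : D.FusionAxioms
  grading : D.GradingAxioms
  unitarity : D.UnitarityAxioms
  normalization : D.NormalizationAxioms
  consistency : D.ConsistencyAxioms

end CrossedSymbols

/-! ## Braiding and projective measurement on fusion spaces -/

/-- Elementary operations on two neighbouring strands: exchange with the strand coming from the
left on top, exchange with the strand coming from the right on top, and projective measurement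
of the total charge of the two strands with outcome `c`. -/
inductive Move (L : Type) where
  | braid : Move L
  | braidInv : Move L
  | measure (c : L) : Move L

/-- The sequence of elementary operations of a protocol, in chronological order; `(i, m)` applies
`m` to the strands number `i` and `i + 1`, counted from `0`. -/
abbrev Protocol (L : Type) := List (ℕ × Move L)

/-- Vectors in fusion spaces. The fusion tree of the word `x₁ ⋯ xₘ` in which the first `j` strands
fuse to `eⱼ`, through the vertex `|eⱼ₋₁,xⱼ;eⱼ,μⱼ⟩` with `e₀` the vacuum, is the list
`[(e₁,μ₁), …, (eₘ,μₘ)]`. The fusion trees are orthonormal. -/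
abbrev Ket (L : Type) := List (L × ℕ) →₀ ℂ

namespace CrossedSymbols

open Finset

variable {G L : Type} [Group G] [Fintype L] [DecidableEq L]

/-- The labels of the two strands after the move. -/
def target (D : CrossedSymbols G L) : Move L → L → L → L × L
  | .braid, b, a => (D.act (D.deg b) a, b)
  | .braidInv, a, b => (b, D.act (D.deg b)⁻¹ a)
  | .measure _, x, y => (x, y)

/-- The matrix of a move from `V^{xy}_k` (index `μ`) to `V^{x'y'}_k` (index `μ'`). The inverse of
the unitary matrix `R^{ab}_k` is its adjoint. -/
noncomputable def amp (D : CrossedSymbols G L) : Move L → L → L → L → ℕ → ℕ → ℂ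
  | .braid, b, a, k, μ, μ' => D.R (D.act (D.deg b) a) b k μ μ'
  | .braidInv, a, b, k, μ, μ' => star (D.R a b k μ' μ)
  | .measure c, _, _, k, μ, μ' => if k = c ∧ μ = μ' then 1 else 0

/-- The matrix entry of a move on neighbouring strands `x`, `y` between left-associated trees:
an `F`-move, then the move on the fusion vertex of `x` and `y`, then an inverse `F`-move. -/
noncomputable def localAmp (D : CrossedSymbols G L) (m : Move L) (e x y d : L)
    (s s' : L × ℕ × ℕ) : ℂ :=
  ∑ k, ∑ μ ∈ range (D.N x y k),
    ∑ μ' ∈ range (D.N (D.target m x y).1 (D.target m x y).2 k), ∑ ν ∈ range (D.N e k d),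
      D.F e x y d s (k, μ, ν) * D.amp m x y k μ μ' *
        star (D.F e (D.target m x y).1 (D.target m x y).2 d s' (k, μ', ν))

/-- The word after a move at position `i`. -/
def moveWord (D : CrossedSymbols G L) (m : Move L) : ℕ → List L → List L
  | 0, x :: y :: w => (D.target m x y).1 :: (D.target m x y).2 :: w
  | i + 1, x :: w => x :: moveWord D m i w
  | _, w => w

/-- The image of a fusion tree under a move at position `i`, where `e` is the charge to the left
of the given strands. A move at a position that does not exist gives `0`. -/
noncomputable def moveTree (D : CrossedSymbols G L) (m : Move L) :
    ℕ → L → List L → List (L × ℕ) → Ket L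
  | 0, e, x :: y :: _, (f, α) :: (d, β) :: t =>
      ∑ f', ∑ α' ∈ range (D.N e (D.target m x y).1 f'),
        ∑ β' ∈ range (D.N f' (D.target m x y).2 d),
          Finsupp.single ((f', α') :: (d, β') :: t)
            (D.localAmp m e x y d (f, α, β) (f', α', β'))
  | i + 1, _, _ :: w, (f, α) :: t => (moveTree D m i f w t).mapDomain (List.cons (f, α))
  | _, _, _, _ => 0

/-- The word after a protocol. -/
def runWord (D : CrossedSymbols G L) : List L → Protocol L → List L
  | w, [] => w
  | w, (i, m) :: P => runWord D (D.moveWord m i w) P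

/-- The linear map of a protocol on the fusion space of the word `w` with total charge kept
fixed. -/
noncomputable def run (D : CrossedSymbols G L) : List L → Protocol L → Ket L →ₗ[ℂ] Ket L
  | _, [] => LinearMap.id
  | w, (i, m) :: P =>
      (run D (D.moveWord m i w) P).comp (Finsupp.linearCombination ℂ (D.moveTree m i D.one w))

end CrossedSymbols

/-! ## Ising and bilayer Ising -/

/-- The anyon types `1`, `σ`, `ψ` of the Ising category. -/
inductive Ising where
  | one | sig | psi
  deriving DecidableEq

instance : Fintype Ising :=
  ⟨{Ising.one, Ising.sig, Ising.psi}, fun x => by cases x <;> decide⟩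

namespace Ising

/-- Fusion rules. -/
def N : Ising → Ising → Ising → ℕ
  | one, b, c => if c = b then 1 else 0
  | a, one, c => if c = a then 1 else 0
  | psi, psi, c => if c = one then 1 else 0
  | psi, sig, c => if c = sig then 1 else 0
  | sig, psi, c => if c = sig then 1 else 0
  | sig, sig, c => if c = sig then 0 else 1

/-- Dimension of `Hom(d, a ⊗ b ⊗ c)`. -/
def N₃ (a b c d : Ising) : ℕ := ∑ e, N a b e * N e c d

/-- `F`-symbols. -/
noncomputable def F (a b c d e f : Ising) : ℂ :=
  if N a b e * N e c d * N b c f * N a f d = 0 then 0 else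
    match a, b, c, d with
    | sig, sig, sig, sig =>
        ((1 / Real.sqrt 2 : ℝ) : ℂ) * if e = psi ∧ f = psi then -1 else 1
    | psi, sig, psi, sig => -1
    | sig, psi, sig, psi => -1
    | _, _, _, _ => 1

/-- `R`-symbols. -/
noncomputable def R (a b c : Ising) : ℂ :=
  if N a b c = 0 then 0 else
    match a, b with
    | sig, sig =>
        if c = one then Complex.exp (-(Real.pi * Complex.I / 8))
        else Complex.exp (3 * Real.pi * Complex.I / 8)
    | sig, psi => -Complex.I
    | psi, sig => -Complex.I
    | psi, psi => -1
    | _, _ => 1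

/-- Topological twists. -/
noncomputable def twist : Ising → ℂ
  | one => 1
  | sig => Complex.exp (2 * Real.pi * Complex.I / 16)
  | psi => -1

/-- The `S`-matrix. -/
noncomputable def S (a b : Ising) : ℂ :=
  (1 / 2 : ℂ) * match a, b with
    | one, sig => ((Real.sqrt 2 : ℝ) : ℂ)
    | sig, one => ((Real.sqrt 2 : ℝ) : ℂ)
    | sig, sig => 0
    | sig, psi => -((Real.sqrt 2 : ℝ) : ℂ)
    | psi, sig => -((Real.sqrt 2 : ℝ) : ℂ)
    | _, _ => 1

end Ising

/-- The group of order two. -/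
abbrev Z₂ := Multiplicative (ZMod 2)

/-- The layer-exchange symmetry. -/
def layerSwap : Z₂ := Multiplicative.ofAdd 1

/-- Simple objects of the `ℤ/2`-crossed extension of `Ising ⊠ Ising`: the anyons `a ⊠ b` and the
defects `X_a`. -/
inductive BilayerLabel where
  | anyon (a b : Ising) : BilayerLabel
  | defect (a : Ising) : BilayerLabel
  deriving DecidableEq, Fintype

namespace BilayerLabel

/-- Fusion rules of the extension. -/
def N : BilayerLabel → BilayerLabel → BilayerLabel → ℕ
  | anyon a a', anyon b b', anyon c c' => Ising.N a b c * Ising.N a' b' c'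
  | anyon a a', defect b, defect c => Ising.N₃ a a' b c
  | defect b, anyon a a', defect c => Ising.N₃ b a a' c
  | defect a, defect b, anyon c c' => Ising.N₃ a c c' b
  | _, _, _ => 0

/-- The vacuum `1 ⊠ 1`. -/
abbrev vac : BilayerLabel := anyon .one .one

/-- The monolayer Ising anyon `σ ⊠ 1`. -/
abbrev sigma : BilayerLabel := anyon .sig .one

/-- The bare defect `X₁`. -/
abbrev X : BilayerLabel := defect .one

end BilayerLabel

open BilayerLabel in
/-- `D` has the objects, the grading, the layer-exchange action and the fusion rules of
`(Ising ⊠ Ising)^×_{ℤ/2}`, and its trivial sector is `Ising ⊠ Ising`. -/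
structure CrossedSymbols.ExtendsBilayerIsing (D : CrossedSymbols Z₂ BilayerLabel) : Prop where
  one_eq : D.one = vac
  N_eq : D.N = BilayerLabel.N
  deg_anyon : ∀ a b, D.deg (anyon a b) = 1
  deg_defect : ∀ a, D.deg (defect a) = layerSwap
  act_anyon : ∀ a b, D.act layerSwap (anyon a b) = anyon b a
  act_defect : ∀ a, D.act layerSwap (defect a) = defect a
  F_anyon : ∀ a a' b b' c c' d d' e e' f f' : Ising,
    D.F (anyon a a') (anyon b b') (anyon c c') (anyon d d')
        (anyon e e', 0, 0) (anyon f f', 0, 0) =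
      Ising.F a b c d e f * Ising.F a' b' c' d' e' f'
  R_anyon : ∀ a a' b b' c c' : Ising,
    D.R (anyon a a') (anyon b b') (anyon c c') 0 0 = Ising.R a b c * Ising.R a' b' c'

/-! ## The logical qubits and the `T`-gate protocol -/

open BilayerLabel

/-- The physical system of one qubit: four anyons `σ1` followed by four defects `X₁`. -/
def qubitWord : List BilayerLabel := [sigma, sigma, sigma, sigma, X, X, X, X]

/-- The logical basis: `false` is `|1⟩ = |11,11⟩` and `true` is `|ψ⟩ = |ψ1,11⟩`. -/
def qubitTree (x : Bool) : List (BilayerLabel × ℕ) :=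
  [(sigma, 0), (if x then anyon .psi .one else vac, 0), (sigma, 0), (vac, 0),
    (X, 0), (vac, 0), (X, 0), (vac, 0)]

/-- `n` copies of the physical system of one qubit, side by side. -/
def registerWord (n : ℕ) : List BilayerLabel := (List.replicate n qubitWord).flatten

/-- The logical computational basis of `n` qubits. -/
def registerTree {n : ℕ} (x : Fin n → Bool) : List (BilayerLabel × ℕ) :=
  (List.ofFn fun j => qubitTree (x j)).flatten

/-- The `T`-gate protocol: the fourth anyon is braided around the middle two defects (behind the
first defect) and returns; the third and fourth anyon are projected onto trivial total charge;
the middle two defects are fully exchanged; the fourth anyon is braided around the middle two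
defects in the opposite direction. -/
def tProtocol : Protocol BilayerLabel :=
  [(3, .braidInv), (4, .braidInv), (5, .braidInv), (5, .braidInv), (4, .braidInv), (3, .braid),
    (2, .measure vac),
    (5, .braid), (5, .braid),
    (3, .braidInv), (4, .braid), (5, .braid), (5, .braid), (4, .braid), (3, .braid)]

namespace CrossedSymbols

/-- The matrix entry `⟨y|T|x⟩` of the `T`-gate protocol on the logical qubit. -/
noncomputable def tEntry (D : CrossedSymbols Z₂ BilayerLabel) (y x : Bool) : ℂ :=
  D.run qubitWord tProtocol (Finsupp.single (qubitTree x) 1) (qubitTree y)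

/-- The protocol `P` maps the logical space of `n` qubits to itself and acts on it as the
matrix `W`, up to a nonzero scalar. -/
def Realizes (D : CrossedSymbols Z₂ BilayerLabel) {n : ℕ} (P : Protocol BilayerLabel)
    (W : Matrix (Fin n → Bool) (Fin n → Bool) ℂ) : Prop :=
  D.runWord (registerWord n) P = registerWord n ∧
    ∃ c : ℂ, c ≠ 0 ∧ ∀ x : Fin n → Bool,
      D.run (registerWord n) P (Finsupp.single (registerTree x) 1) =
        c • ∑ y : Fin n → Bool, Finsupp.single (registerTree y) (W y x)

/-- Universality for quantum computation: for each number `n` of qubits there is a small set `S`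
of unitary gates, each realized by a short protocol of braidings and projective measurements, such
that each unitary on `n` qubits is approximated in operator norm, up to a global phase, to
accuracy `ε` by a product of polynomially many (in `log (1/ε)`) gates of `S`. -/
def IsUniversal (D : CrossedSymbols Z₂ BilayerLabel) : Prop :=
  ∃ K : ℕ, ∀ n : ℕ, ∃ S : Finset (Matrix.unitaryGroup (Fin n → Bool) ℂ),
    S.card ≤ K * n ∧
    (∀ W ∈ S, ∃ P : Protocol BilayerLabel,
      P.length ≤ K ∧ D.Realizes P (W : Matrix (Fin n → Bool) (Fin n → Bool) ℂ)) ∧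
    ∃ (C : ℝ) (p : ℕ), ∀ V : Matrix.unitaryGroup (Fin n → Bool) ℂ, ∀ ε : ℝ, 0 < ε → ε ≤ 1 / 2 →
      ∃ l : List (Matrix.unitaryGroup (Fin n → Bool) ℂ),
        (∀ W ∈ l, W ∈ S) ∧ (l.length : ℝ) ≤ C * Real.log (1 / ε) ^ p ∧
        ∃ z : ℂ, ‖z‖ = 1 ∧
          ‖Matrix.toEuclideanCLM (n := Fin n → Bool) (𝕜 := ℂ)
            (z • (l.prod : Matrix (Fin n → Bool) (Fin n → Bool) ℂ) - V)‖ ≤ ε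

end CrossedSymbols

/-! ## One-parameter subgroups of a closed group of unitaries -/

section TangentSpace

open NormedSpace Filter Topology

variable {A : Type*} [CStarAlgebra A]

/-! The argument has two halves: the evaluation of protocols in an arbitrary extension that
satisfies the hypotheses, and an efficient density theorem for the gates so obtained.

Evaluation. The hypotheses prescribe only a few symbols, so most exchanges are known at best up to a
phase. The protocols are built so that nearly all of them act in one-dimensional fusion spaces,
where unitarity makes them phases; the way back contributes the conjugate phase and the unknowns
cancel (`phasePath_of_pathOK`). The fusion rules needed for this are checked by finite computation.
Two ingredients are not of this kind. The exchange of the middle two defects, with charge `X₁` to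
the left, has the matrix S·diag(θ)·S† on the charges 11, σσ, ψψ (`moveMap_braid_X`). When the
travelling anyon recrosses the second defect, its state splits into the charges `X₁` and `X_ψ` with
amplitudes of modulus 1/√2; this follows from the pentagon, a heptagon and unitarity
(`norm_localAmp_split`). In the T-protocol the loop of the fourth anyon therefore creates a
superposition over the total charge y of the four anyons, correlated with the charge `X₁` (y = 1) or
`X_ψ` (y = ψ) to the left of the middle defects. The projection forces y = x. On the intermediate
charge σσ the full exchange is then 1 for `X₁` and θ_σ² = exp(πi/4) for `X_ψ`. Undoing the loop
gives the factor 1/2 and a leaked component in which the first two defects fuse to ψψ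
(`maps_tProtocol`); one more projection removes the leakage. Besides T, the exchange of the second
and third anyon gives a square root of Pauli X (`maps_vGate`), and a cycle of three double exchanges
and projections on two linked blocks gives diag(1,-1,-1,-1) (`maps_pairProtocol`).

Density. The closure of all words in the gates, with phases, is a closed monoid, and the generators
of its one-parameter subgroups form a real Lie algebra (`tangentSpace`). On one qubit, TV is a
rotation by an angle incommensurable with π, so the closure contains a whole one-parameter group,
and conjugation yields all Pauli directions (`span_tangentSpace_singleQubit`). Conjugating one-qubit
generators with the pair gate gives interactions of neighbours, which generate the full matrix
algebra (`eq_top_of_siteHom_mem`). Every unitary is a phase times an exponential, so the words are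
dense (`unitary_subset_of_span_tangentSpace`). The Solovay–Kitaev recursion turns density into
polylogarithmic word length: a unitary within δ² of 1 is, up to a phase and an error of order δ³, a
product of boundedly many group commutators of unitaries at distance of order δ from 1
(`exists_groupCommutator_factorization`), and such commutators tolerate errors δ² in their
arguments. -/

theorem norm_le_one_of_mem_unitary {u : A} (hu : u ∈ unitary A) : ‖u‖ ≤ 1 := by
  rcases subsingleton_or_nontrivial A with _ | _
  · simp [Subsingleton.elim u 0]
  · exact (CStarRing.norm_of_mem_unitary hu).le

theorem norm_pow_sub_pow_le {x y : A} (hx : ‖x‖ ≤ 1) (hy : ‖y‖ ≤ 1) (m : ℕ) :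
    ‖x ^ m - y ^ m‖ ≤ m * ‖x - y‖ := by
  rcases subsingleton_or_nontrivial A with _ | _
  · simp [Subsingleton.elim x y]
  induction m with
  | zero => simp
  | succ m ih =>
    have h : x ^ (m + 1) - y ^ (m + 1) = (x ^ m - y ^ m) * x + y ^ m * (x - y) := by
      rw [pow_succ, pow_succ]; noncomm_ring
    rw [h]
    calc _ ≤ ‖x ^ m - y ^ m‖ * ‖x‖ + ‖y ^ m‖ * ‖x - y‖ :=
          (norm_add_le _ _).trans (add_le_add (norm_mul_le _ _) (norm_mul_le _ _))
      _ ≤ (m * ‖x - y‖) * 1 + 1 * ‖x - y‖ := by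
          gcongr
          exact (norm_pow_le y m).trans (pow_le_one₀ (norm_nonneg _) hy)
      _ = _ := by push_cast; ring

theorem exp_smul_mem_unitary {a : A} (ha : star a = -a) (t : ℝ) : exp (t • a) ∈ unitary A := by
  let : NormedAlgebra ℚ A := .restrictScalars ℚ ℂ A
  apply exp_mem_unitary_of_mem_skewAdjoint
  rw [skewAdjoint.mem_iff, star_smul, ha]
  simp

theorem hasDerivAt_exp_smul (a : A) (t : ℝ) :
    HasDerivAt (fun s : ℝ => exp (s • a)) (exp (t • a) * a) t :=
  hasDerivAt_exp_smul_const a t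

/-- The Lie product formula. -/
theorem tendsto_exp_mul_exp_pow {a b : A} (ha : star a = -a) (hb : star b = -b) :
    Tendsto (fun m : ℕ => (exp ((m : ℝ)⁻¹ • a) * exp ((m : ℝ)⁻¹ • b)) ^ m) atTop
      (𝓝 (exp (a + b))) := by
  let : NormedAlgebra ℚ A := .restrictScalars ℚ ℂ A
  have hab : star (a + b) = -(a + b) := by rw [star_add, ha, hb]; abel
  set f : ℝ → A := fun s => exp (s • a) * exp (s • b) - exp (s • (a + b)) with hf
  -- Both sides agree to first order at 0, so m • f(1/m) tends to 0; taking m-th powers of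
  -- contractions multiplies the error by at most m.
  have hd : HasDerivAt f 0 0 := by
    have := ((hasDerivAt_exp_smul a 0).mul (hasDerivAt_exp_smul b 0)).sub
      (hasDerivAt_exp_smul (a + b) 0)
    refine this.congr_deriv ?_
    simp
  have hs : Tendsto (fun m : ℕ => (m : ℝ) • f ((m : ℝ)⁻¹)) atTop (𝓝 0) := by
    have h1 := hd.tendsto_slope_zero
    have h0 : f 0 = 0 := by simp [hf]
    simp only [zero_add, h0, sub_zero] at h1
    have h2 : Tendsto (fun m : ℕ => ((m : ℝ)⁻¹)) atTop (𝓝[≠] 0) := by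
      refine tendsto_nhdsWithin_iff.2 ⟨tendsto_inv_atTop_nhds_zero_nat, ?_⟩
      filter_upwards [eventually_gt_atTop 0] with m hm
      simp [hm.ne']
    refine (h1.comp h2).congr fun m => ?_
    simp
  rw [tendsto_iff_norm_sub_tendsto_zero]
  refine squeeze_zero' (Eventually.of_forall fun _ => norm_nonneg _) ?_ (tendsto_zero_iff_norm_tendsto_zero.1 hs)
  filter_upwards [eventually_gt_atTop 0] with m hm
  have hm' : (m : ℝ) ≠ 0 := by positivity
  have he : exp (a + b) = exp ((m : ℝ)⁻¹ • (a + b)) ^ m := by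
    rw [← exp_nsmul, ← Nat.cast_smul_eq_nsmul ℝ, smul_smul, mul_inv_cancel₀ hm', one_smul]
  rw [he, norm_smul, Real.norm_natCast]
  refine norm_pow_sub_pow_le (norm_le_one_of_mem_unitary ?_)
    (norm_le_one_of_mem_unitary (exp_smul_mem_unitary hab _)) m
  exact mul_mem (exp_smul_mem_unitary ha _) (exp_smul_mem_unitary hb _)

/-- The generators of the one-parameter groups of unitaries in a closed monoid. -/
def tangentSpace (K : Submonoid A) (hK : IsClosed (K : Set A)) : Submodule ℝ A where
  carrier := {a | star a = -a ∧ ∀ t : ℝ, exp (t • a) ∈ K}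
  zero_mem' := by simp [K.one_mem]
  add_mem' := by
    rintro a b ⟨ha, hak⟩ ⟨hb, hbk⟩
    refine ⟨by rw [star_add, ha, hb]; abel, fun t => ?_⟩
    have hta : ∀ {c : A}, star c = -c → star (t • c) = -(t • c) := fun h => by
      rw [star_smul, h]; simp
    rw [smul_add]
    refine hK.mem_of_tendsto (tendsto_exp_mul_exp_pow (hta ha) (hta hb))
      (Eventually.of_forall fun m => K.pow_mem (K.mul_mem ?_ ?_) _)
    · rw [smul_smul]; exact hak _
    · rw [smul_smul]; exact hbk _
  smul_mem' := by
    rintro c a ⟨ha, hak⟩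
    refine ⟨by rw [star_smul, ha]; simp, fun t => ?_⟩
    rw [smul_smul]; exact hak _

theorem mem_tangentSpace {K : Submonoid A} {hK : IsClosed (K : Set A)} {a : A} :
    a ∈ tangentSpace K hK ↔ star a = -a ∧ ∀ t : ℝ, exp (t • a) ∈ K := Iff.rfl

theorem exp_mem_of_mem_tangentSpace {K : Submonoid A} {hK : IsClosed (K : Set A)} {a : A}
    (ha : a ∈ tangentSpace K hK) : exp a ∈ K := by simpa using ha.2 1

theorem conj_mem_tangentSpace {K : Submonoid A} {hK : IsClosed (K : Set A)} {a u : A}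
    (ha : a ∈ tangentSpace K hK) (hu : u ∈ unitary A) (huK : u ∈ K) (huK' : star u ∈ K) :
    u * a * star u ∈ tangentSpace K hK := by
  let : NormedAlgebra ℚ A := .restrictScalars ℚ ℂ A
  refine ⟨by simp [ha.1, mul_assoc], fun t => ?_⟩
  have h := exp_units_conj (Unitary.toUnits ⟨u, hu⟩) (t • a)
  have h1 : ((Unitary.toUnits ⟨u, hu⟩ : Aˣ) : A) = u := rfl
  have h2 : ((Unitary.toUnits ⟨u, hu⟩ : Aˣ)⁻¹ : Aˣ) = (star u : A) := rfl
  rw [h1, h2, mul_smul_comm, smul_mul_assoc] at h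
  rw [h]
  exact K.mul_mem (K.mul_mem huK (ha.2 t)) huK'

theorem isClosed_tangentSpace (K : Submonoid A) (hK : IsClosed (K : Set A)) :
    IsClosed (tangentSpace K hK : Set A) := by
  let : NormedAlgebra ℚ A := .restrictScalars ℚ ℂ A
  have : (tangentSpace K hK : Set A) = {a | star a = -a} ∩ ⋂ t : ℝ, {a | exp (t • a) ∈ K} := by
    ext a; simp [mem_tangentSpace]
  rw [this]
  refine (isClosed_eq continuous_star continuous_neg).inter (isClosed_iInter fun t => ?_)
  exact hK.preimage (exp_continuous.comp (continuous_const_smul t))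

/-- The commutator is the derivative at 0 of the conjugates exp(sa) b exp(-sa). These stay in the
tangent space, which is a closed linear subspace, so the limit of difference quotients stays there
too. -/
theorem commutator_mem_tangentSpace {K : Submonoid A} {hK : IsClosed (K : Set A)} {a b : A}
    (ha : a ∈ tangentSpace K hK) (hb : b ∈ tangentSpace K hK) :
    a * b - b * a ∈ tangentSpace K hK := by
  let : NormedAlgebra ℚ A := .restrictScalars ℚ ℂ A
  set f : ℝ → A := fun s => exp (s • a) * b * exp (s • (-a)) with hf
  have hfm : ∀ s, f s ∈ tangentSpace K hK := fun s => by
    have hs : star (exp (s • a)) = exp (s • (-a)) := by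
      rw [star_exp, star_smul, ha.1]; simp
    have := conj_mem_tangentSpace hb (exp_smul_mem_unitary ha.1 s) (ha.2 s)
      (by rw [hs, smul_neg, ← neg_smul]; exact ha.2 _)
    rwa [hs] at this
  have hd : HasDerivAt f (a * b - b * a) 0 := by
    refine (((hasDerivAt_exp_smul a 0).mul_const b).mul
      (hasDerivAt_exp_smul (-a) 0)).congr_deriv ?_
    simp [sub_eq_add_neg]
  refine (isClosed_tangentSpace K hK).mem_of_tendsto hd.tendsto_slope_zero
    (Eventually.of_forall fun t => ?_)
  exact (tangentSpace K hK).smul_mem _ ((tangentSpace K hK).sub_mem (hfm _) (hfm _))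

end TangentSpace

/-! ## The Solovay–Kitaev theorem -/

section SolovayKitaev

open NormedSpace

variable {A : Type*} [CStarAlgebra A]

/-- The derivative of the one-parameter group is a unitary times q, hence bounded by the norm of q
for all times; the mean value inequality does the rest. -/
theorem norm_exp_smul_sub_one_le {q : A} (hq : star q = -q) (t : ℝ) :
    ‖exp (t • q) - 1‖ ≤ ‖q‖ * |t| := by
  have h := Convex.norm_image_sub_le_of_norm_hasDerivWithin_le (𝕜 := ℝ) (C := ‖q‖)
    (f := fun s : ℝ => exp (s • q)) (f' := fun s => exp (s • q) * q) (s := Set.univ) (x := 0)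
    (y := t) (fun s _ => (hasDerivAt_exp_smul q s).hasDerivWithinAt)
    (fun s _ => (norm_mul_le _ _).trans (mul_le_of_le_one_left (norm_nonneg _)
      (norm_le_one_of_mem_unitary (exp_smul_mem_unitary hq s)))) convex_univ trivial trivial
  simpa using h

theorem norm_exp_smul_sub_one_sub_le {q : A} (hq : star q = -q) (t : ℝ) :
    ‖exp (t • q) - 1 - t • q‖ ≤ ‖q‖ ^ 2 * t ^ 2 := by
  have h := Convex.norm_image_sub_le_of_norm_hasDerivWithin_le (𝕜 := ℝ) (C := ‖q‖ * |t| * ‖q‖)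
    (f := fun s : ℝ => exp (s • q) - s • q) (f' := fun s => exp (s • q) * q - (1 : ℝ) • q)
    (s := Set.Icc (-|t|) |t|) (x := 0)
    (y := t) (fun s _ => ((hasDerivAt_exp_smul q s).sub
      ((hasDerivAt_id s).smul_const q)).hasDerivWithinAt)
    (fun s hs => by
      have : exp (s • q) * q - (1 : ℝ) • q = (exp (s • q) - 1) * q := by
        rw [one_smul, sub_mul, one_mul]
      rw [this]
      refine (norm_mul_le _ _).trans ?_
      gcongr
      refine (norm_exp_smul_sub_one_le hq s).trans ?_
      exact mul_le_mul_of_nonneg_left (abs_le.2 hs) (norm_nonneg _)) (convex_Icc _ _) (by simp) ⟨neg_abs_le t, le_abs_self t⟩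
  have e : exp (t • q) - t • q - (exp ((0 : ℝ) • q) - (0 : ℝ) • q) = exp (t • q) - 1 - t • q := by
    simp; abel
  rw [e] at h
  refine h.trans (le_of_eq ?_)
  rw [sub_zero, Real.norm_eq_abs, ← sq_abs t]; ring

/-- The group commutator of two unitaries. -/
def groupCommutator (v w : A) : A := v * w * star v * star w

theorem groupCommutator_mem {v w : A} (hv : v ∈ unitary A) (hw : w ∈ unitary A) :
    groupCommutator v w ∈ unitary A :=
  mul_mem (mul_mem (mul_mem hv hw) (Unitary.star_mem hv)) (Unitary.star_mem hw)

/-- This form makes the quadratic smallness visible: the distance of a group commutator from 1 is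
governed by the ordinary commutator of v - 1 and w - 1. -/
theorem groupCommutator_sub_one {v w : A} (hv : v ∈ unitary A) (hw : w ∈ unitary A) :
    groupCommutator v w - 1 =
      ((v - 1) * (w - 1) - (w - 1) * (v - 1)) * (star v * star w) := by
  have h1 : (v - 1) * (w - 1) - (w - 1) * (v - 1) = v * w - w * v := by noncomm_ring
  rw [h1, sub_mul]
  have h2 : w * v * (star v * star w) = 1 := by
    rw [mul_assoc, ← mul_assoc v, Unitary.mul_star_self_of_mem hv, one_mul,
      Unitary.mul_star_self_of_mem hw]
  rw [h2, groupCommutator]; simp only [mul_assoc]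

theorem norm_commutator_le (x y : A) : ‖x * y - y * x‖ ≤ 2 * (‖x‖ * ‖y‖) := by
  refine (norm_sub_le _ _).trans ?_
  have h1 := norm_mul_le x y
  have h2 := norm_mul_le y x
  linarith [mul_comm ‖x‖ ‖y‖]

theorem norm_mul_star_mul_star_sub_one_le {v w : A} (hv : v ∈ unitary A) :
    ‖star v * star w - 1‖ ≤ ‖v - 1‖ + ‖w - 1‖ := by
  have h : star v * star w - 1 = star v * star (w - 1) + star (v - 1) := by
    rw [star_sub, star_sub, star_one]; noncomm_ring
  rw [h]
  refine (norm_add_le _ _).trans ?_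
  rw [norm_star (v - 1), add_comm]
  gcongr
  refine (norm_mul_le _ _).trans ?_
  rw [norm_star, norm_star]
  exact mul_le_of_le_one_left (norm_nonneg _) (norm_le_one_of_mem_unitary hv)

/-- Perturbing the arguments of a group commutator of unitaries near `1`. -/
theorem norm_groupCommutator_sub_le {v w v' w' : A} {c δ : ℝ} (hv : v ∈ unitary A)
    (hw : w ∈ unitary A) (hv' : v' ∈ unitary A) (hw' : w' ∈ unitary A) (hc : 0 ≤ c) (hδ : 0 ≤ δ)
    (hδ1 : δ ≤ 1) (hv1 : ‖v - 1‖ ≤ c * δ) (hw1 : ‖w - 1‖ ≤ c * δ) (hvv : ‖v - v'‖ ≤ δ ^ 2)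
    (hww : ‖w - w'‖ ≤ δ ^ 2) :
    ‖groupCommutator v w - groupCommutator v' w'‖ ≤ (8 * (c + 1) ^ 2) * δ ^ 3 := by
  have hδ2 : δ ^ 2 ≤ δ := by nlinarith
  have hv1' : ‖v' - 1‖ ≤ (c + 1) * δ := by
    have : v' - 1 = (v - 1) - (v - v') := by abel
    rw [this]; refine (norm_sub_le _ _).trans ?_; linarith
  have hw1' : ‖w' - 1‖ ≤ (c + 1) * δ := by
    have : w' - 1 = (w - 1) - (w - w') := by abel
    rw [this]; refine (norm_sub_le _ _).trans ?_; linarith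
  set X := (v - 1) * (w - 1) - (w - 1) * (v - 1)
  set X' := (v' - 1) * (w' - 1) - (w' - 1) * (v' - 1)
  -- In the first summand a difference of size δ² meets a factor of size δ; in the second, X' has
  -- size δ² and the remaining difference again δ², so nothing worse than δ³ appears.
  have e : groupCommutator v w - groupCommutator v' w' =
      (X - X') * (star v * star w) + X' * (star v * star w - star v' * star w') := by
    have h := congrArg₂ (· - ·) (groupCommutator_sub_one hv hw) (groupCommutator_sub_one hv' hw')
    simp only [sub_sub_sub_cancel_right] at h
    rw [h]
    change X * _ - X' * _ = _
    noncomm_ring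
  have hX' : ‖X'‖ ≤ 2 * (((c + 1) * δ) * ((c + 1) * δ)) :=
    (norm_commutator_le _ _).trans (by gcongr)
  have hXX : ‖X - X'‖ ≤ 2 * (δ ^ 2 * (c * δ)) + 2 * (((c + 1) * δ) * δ ^ 2) := by
    have : X - X' = ((v - v') * (w - 1) - (w - 1) * (v - v')) +
        ((v' - 1) * (w - w') - (w - w') * (v' - 1)) := by
      simp only [X, X']; noncomm_ring
    rw [this]
    refine (norm_add_le _ _).trans (add_le_add ((norm_commutator_le _ _).trans ?_)
      ((norm_commutator_le _ _).trans ?_)) <;> gcongr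
  have hs : ‖star v * star w - star v' * star w'‖ ≤ 2 * δ ^ 2 := by
    have : star v * star w - star v' * star w' =
        star (v - v') * star w + star v' * star (w - w') := by
      rw [star_sub, star_sub]; noncomm_ring
    rw [this]
    refine (norm_add_le _ _).trans ?_
    have h1 : ‖star (v - v') * star w‖ ≤ δ ^ 2 * 1 :=
      (norm_mul_le _ _).trans (by
        rw [norm_star, norm_star]
        exact mul_le_mul hvv (norm_le_one_of_mem_unitary hw) (norm_nonneg _) (by positivity))
    have h2 : ‖star v' * star (w - w')‖ ≤ 1 * δ ^ 2 :=
      (norm_mul_le _ _).trans (by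
        rw [norm_star, norm_star]
        exact mul_le_mul (norm_le_one_of_mem_unitary hv') hww (norm_nonneg _) zero_le_one)
    linarith
  have hu : ‖star v * star w‖ ≤ 1 :=
    norm_le_one_of_mem_unitary (mul_mem (Unitary.star_mem hv) (Unitary.star_mem hw))
  rw [e]
  calc _ ≤ ‖X - X'‖ * ‖star v * star w‖ + ‖X'‖ * ‖star v * star w - star v' * star w'‖ :=
        (norm_add_le _ _).trans (add_le_add (norm_mul_le _ _) (norm_mul_le _ _))
    _ ≤ (2 * (δ ^ 2 * (c * δ)) + 2 * (((c + 1) * δ) * δ ^ 2)) * 1 +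
          (2 * (((c + 1) * δ) * ((c + 1) * δ))) * (2 * δ ^ 2) := by gcongr
    _ = (4 * c + 2) * δ ^ 3 + (4 * (c + 1) ^ 2) * (δ ^ 3 * δ) := by ring
    _ ≤ (4 * c + 2) * δ ^ 3 + (4 * (c + 1) ^ 2) * (δ ^ 3 * 1) := by gcongr
    _ ≤ _ := by
      have : 0 ≤ δ ^ 3 := by positivity
      nlinarith [mul_nonneg (by positivity : (0:ℝ) ≤ 4 * c ^ 2 + 4 * c + 2) this]

/-- The group commutator of two one-parameter groups, to second order. -/
theorem norm_groupCommutator_exp_sub_le {q r : A} (hq : star q = -q) (hr : star r = -r)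
    {s t δ c : ℝ} (hc : 0 ≤ c) (hδ : 0 ≤ δ) (hs : |s| ≤ c * δ)
    (ht : |t| ≤ c * δ) :
    ‖groupCommutator (exp (s • q)) (exp (t • r)) - 1 - (s * t) • (q * r - r * q)‖ ≤
      (8 * (‖q‖ + ‖r‖ + 1) ^ 3 * (c + 1) ^ 3) * δ ^ 3 := by
  set v := exp (s • q)
  set w := exp (t • r)
  have hv : v ∈ unitary A := exp_smul_mem_unitary hq s
  have hw : w ∈ unitary A := exp_smul_mem_unitary hr t
  set m := ‖q‖ + ‖r‖ + 1
  have hqm : ‖q‖ ≤ m := by simp only [m]; linarith [norm_nonneg r]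
  have hrm : ‖r‖ ≤ m := by simp only [m]; linarith [norm_nonneg q]
  have hm1 : 1 ≤ m := by simp only [m]; linarith [norm_nonneg q, norm_nonneg r]
  have hv1 : ‖v - 1‖ ≤ m * (c * δ) :=
    (norm_exp_smul_sub_one_le hq s).trans (by gcongr)
  have hw1 : ‖w - 1‖ ≤ m * (c * δ) :=
    (norm_exp_smul_sub_one_le hr t).trans (by gcongr)
  have hv2 : ‖v - 1 - s • q‖ ≤ m ^ 2 * (c * δ) ^ 2 :=
    (norm_exp_smul_sub_one_sub_le hq s).trans (by rw [← sq_abs s]; gcongr)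
  have hw2 : ‖w - 1 - t • r‖ ≤ m ^ 2 * (c * δ) ^ 2 :=
    (norm_exp_smul_sub_one_sub_le hr t).trans (by rw [← sq_abs t]; gcongr)
  have htr : ‖t • r‖ ≤ m * (c * δ) := by
    rw [norm_smul, Real.norm_eq_abs, mul_comm]; gcongr
  set X := (v - 1) * (w - 1) - (w - 1) * (v - 1)
  -- Replace v - 1 and w - 1 by s • q and t • r one at a time. Each replacement costs a second-order
  -- remainder times a first-order factor, and the trailing unitary is itself first-order close to
  -- 1.
  have e : groupCommutator v w - 1 - (s * t) • (q * r - r * q) =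
      X * (star v * star w - 1) + (((v - 1) * (w - 1 - t • r) - (w - 1 - t • r) * (v - 1)) +
        ((v - 1 - s • q) * (t • r) - (t • r) * (v - 1 - s • q))) := by
    rw [groupCommutator_sub_one hv hw]
    have : (s * t) • (q * r - r * q) = (s • q) * (t • r) - (t • r) * (s • q) := by
      rw [smul_mul_smul_comm, smul_mul_smul_comm, mul_comm t s, smul_sub]
    rw [this]
    generalize s • q = a
    generalize t • r = b
    simp only [X]; noncomm_ring
  have hX : ‖X‖ ≤ 2 * ((m * (c * δ)) * (m * (c * δ))) :=
    (norm_commutator_le _ _).trans (by gcongr)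
  have hvw : ‖star v * star w - 1‖ ≤ m * (c * δ) + m * (c * δ) :=
    (norm_mul_star_mul_star_sub_one_le hv).trans (add_le_add hv1 hw1)
  rw [e]
  calc _ ≤ ‖X‖ * ‖star v * star w - 1‖ + (2 * (‖v - 1‖ * ‖w - 1 - t • r‖) +
        2 * (‖v - 1 - s • q‖ * ‖t • r‖)) :=
        (norm_add_le _ _).trans (add_le_add (norm_mul_le _ _) ((norm_add_le _ _).trans
          (add_le_add (norm_commutator_le _ _) (norm_commutator_le _ _))))
    _ ≤ (2 * ((m * (c * δ)) * (m * (c * δ)))) * (m * (c * δ) + m * (c * δ)) +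
        (2 * ((m * (c * δ)) * (m ^ 2 * (c * δ) ^ 2)) +
          2 * ((m ^ 2 * (c * δ) ^ 2) * (m * (c * δ)))) := by gcongr
    _ = (8 * m ^ 3 * c ^ 3) * δ ^ 3 := by ring
    _ ≤ _ := by gcongr; linarith

/-- A product of unitaries near `1`, to first order. -/
theorem exists_norm_prod_sub_le (c : ℝ) (hc : 0 ≤ c) (m : ℕ) :
    ∃ C : ℝ, 0 ≤ C ∧ ∀ δ : ℝ, 0 ≤ δ → δ ≤ 1 → ∀ g x : Fin m → A,
      (∀ i, g i ∈ unitary A) → (∀ i, ‖g i - 1 - x i‖ ≤ c * δ ^ 3) →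
      (∀ i, ‖x i‖ ≤ c * δ ^ 2) →
      ‖(List.ofFn g).prod - 1 - ∑ i, x i‖ ≤ C * δ ^ 3 := by
  induction m with
  | zero => exact ⟨0, le_rfl, fun δ _ _ g x _ _ _ => by simp⟩
  | succ m ih =>
    obtain ⟨C, hC, h⟩ := ih
    refine ⟨c + C + 2 * c * (m * c), by positivity, fun δ hδ hδ1 g x hg hgx hx => ?_⟩
    have hp := h δ hδ hδ1 (fun i => g i.succ) (fun i => x i.succ) (fun i => hg _)
      (fun i => hgx _) (fun i => hx _)
    set P := (List.ofFn fun i : Fin m => g i.succ).prod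
    set Y := ∑ i : Fin m, x i.succ
    have hY : ‖Y‖ ≤ m * c * δ ^ 2 := by
      refine (norm_sum_le _ _).trans ((Finset.sum_le_sum fun i _ => hx i.succ).trans ?_)
      simp [mul_assoc]
    rw [List.ofFn_succ, List.prod_cons, Fin.sum_univ_succ]
    -- The cross term (g 0 - 1) * Y is a product of two terms of size δ², so it is even of order δ⁴.
    have e : g 0 * P - 1 - (x 0 + Y) = g 0 * (P - 1 - Y) + (g 0 - 1 - x 0) + (g 0 - 1) * Y := by
      noncomm_ring
    have hg1 : ‖g 0 - 1‖ ≤ 2 * c * δ ^ 2 := by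
      have : g 0 - 1 = (g 0 - 1 - x 0) + x 0 := by abel
      rw [this]
      refine (norm_add_le _ _).trans ((add_le_add (hgx 0) (hx 0)).trans ?_)
      have : δ ^ 3 ≤ δ ^ 2 := pow_le_pow_of_le_one hδ hδ1 (by norm_num)
      nlinarith
    change ‖g 0 * P - 1 - (x 0 + Y)‖ ≤ _
    rw [e]
    calc _ ≤ ‖g 0‖ * ‖P - 1 - Y‖ + ‖g 0 - 1 - x 0‖ + ‖g 0 - 1‖ * ‖Y‖ :=
          (norm_add₃_le).trans (by gcongr <;> exact norm_mul_le _ _)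
      _ ≤ 1 * (C * δ ^ 3) + c * δ ^ 3 + (2 * c * δ ^ 2) * (m * c * δ ^ 2) := by
          gcongr
          · exact norm_le_one_of_mem_unitary (hg 0)
          · exact hgx 0
      _ = C * δ ^ 3 + c * δ ^ 3 + 2 * c * (m * c) * (δ ^ 3 * δ) := by ring
      _ ≤ C * δ ^ 3 + c * δ ^ 3 + 2 * c * (m * c) * (δ ^ 3 * 1) := by gcongr
      _ = _ := by ring

end SolovayKitaev

/-! ### Unitaries near 1 as products of group commutators -/

section SolovayKitaev

open NormedSpace

variable {A : Type*} [CStarAlgebra A]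

/-- Commutators of skew-adjoint elements. -/
def skewCommutators (A : Type*) [CStarAlgebra A] : Set A :=
  {x | ∃ q r : A, star q = -q ∧ star r = -r ∧ x = q * r - r * q}

theorem star_eq_neg_of_mem_span_skewCommutators {x : A}
    (hx : x ∈ Submodule.span ℝ (skewCommutators A)) : star x = -x := by
  induction hx using Submodule.span_induction with
  | mem x hx =>
    obtain ⟨q, r, hq, hr, rfl⟩ := hx
    simp [hq, hr]
  | zero => simp
  | add x y _ _ hx hy => rw [star_add, hx, hy]; abel
  | smul c x _ hx => rw [star_smul, hx]; simp

theorem exists_skew_add_I_smul_skew (a : A) :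
    ∃ a₁ a₂ : A, star a₁ = -a₁ ∧ star a₂ = -a₂ ∧ a = a₁ + Complex.I • a₂ := by
  refine ⟨(1 / 2 : ℂ) • (a - star a), -(1 / 2 * Complex.I : ℂ) • (a + star a), ?_, ?_, ?_⟩
  · rw [star_smul, star_sub, star_star, ← smul_neg, neg_sub]; simp
  · rw [star_smul, star_add, star_star]; simp [add_comm]
  · rw [smul_smul]
    have : Complex.I * -(1 / 2 * Complex.I) = 1 / 2 := by
      linear_combination (-1 / 2) * Complex.I_mul_I
    rw [this, ← smul_add, sub_add_add_cancel, ← two_smul ℂ, smul_smul]; norm_num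

/-- Splitting each factor into skew-adjoint parts turns complex combinations of commutators into
real combinations of skew commutators plus i times such combinations. -/
theorem exists_eq_of_mem_span_commutators {x : A}
    (hx : x ∈ Submodule.span ℂ (insert 1 {x | ∃ a b : A, x = a * b - b * a})) :
    ∃ z : ℂ, ∃ v ∈ Submodule.span ℝ (skewCommutators A),
      ∃ w ∈ Submodule.span ℝ (skewCommutators A), x = z • 1 + v + Complex.I • w := by
  induction hx using Submodule.span_induction with
  | mem x hx =>
    rcases hx with rfl | ⟨a, b, rfl⟩
    · exact ⟨1, 0, zero_mem _, 0, zero_mem _, by simp⟩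
    · obtain ⟨a₁, a₂, h₁, h₂, rfl⟩ := exists_skew_add_I_smul_skew a
      obtain ⟨b₁, b₂, k₁, k₂, rfl⟩ := exists_skew_add_I_smul_skew b
      refine ⟨0, (a₁ * b₁ - b₁ * a₁) - (a₂ * b₂ - b₂ * a₂),
        sub_mem (Submodule.subset_span ⟨_, _, h₁, k₁, rfl⟩)
          (Submodule.subset_span ⟨_, _, h₂, k₂, rfl⟩),
        (a₁ * b₂ - b₂ * a₁) + (a₂ * b₁ - b₁ * a₂),
        add_mem (Submodule.subset_span ⟨_, _, h₁, k₂, rfl⟩)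
          (Submodule.subset_span ⟨_, _, h₂, k₁, rfl⟩), ?_⟩
      have hI : ∀ x : A, Complex.I • Complex.I • x = -x := fun x => by
        rw [smul_smul, Complex.I_mul_I]; simp
      simp only [mul_add, add_mul, smul_mul_assoc, mul_smul_comm, hI, smul_add, smul_sub,
        zero_smul]
      abel
  | zero => exact ⟨0, 0, zero_mem _, 0, zero_mem _, by simp⟩
  | add x y _ _ hx hy =>
    obtain ⟨z, v, hv, w, hw, rfl⟩ := hx
    obtain ⟨z', v', hv', w', hw', rfl⟩ := hy
    exact ⟨z + z', v + v', add_mem hv hv', w + w', add_mem hw hw', by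
      rw [add_smul, smul_add]; abel⟩
  | smul c x _ hx =>
    obtain ⟨z, v, hv, w, hw, rfl⟩ := hx
    refine ⟨c * z, c.re • v - c.im • w, sub_mem (Submodule.smul_mem _ _ hv)
      (Submodule.smul_mem _ _ hw), c.im • v + c.re • w, add_mem (Submodule.smul_mem _ _ hv)
      (Submodule.smul_mem _ _ hw), ?_⟩
    have hI : ∀ x : A, Complex.I • Complex.I • x = -x := fun x => by
      rw [smul_smul, Complex.I_mul_I]; simp
    have hc : ∀ x : A, c • x = c.re • x + c.im • Complex.I • x := fun x => by
      conv_lhs => rw [← Complex.re_add_im c]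
      rw [add_smul, mul_smul]; rfl
    have hcomm : ∀ (t : ℝ) (x : A), Complex.I • t • x = t • Complex.I • x :=
      fun t x => smul_comm _ _ _
    rw [smul_add, smul_add, smul_smul, hc v, hc (Complex.I • w), hI, smul_add, hcomm, hcomm,
      smul_neg]
    abel

/-- Average the decomposition with minus its adjoint: the part i • w is self-adjoint and drops out,
and of the scalar only the imaginary part survives. -/
theorem exists_eq_of_skew
    (hA : Submodule.span ℂ (insert 1 {x | ∃ a b : A, x = a * b - b * a}) = ⊤) {a : A}
    (ha : star a = -a) :
    ∃ h : ℝ, ∃ v ∈ Submodule.span ℝ (skewCommutators A), a = h • (Complex.I • 1) + v := by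
  obtain ⟨z, v, hv, w, hw, e⟩ := exists_eq_of_mem_span_commutators (x := a) (by rw [hA]; trivial)
  refine ⟨z.im, v, hv, ?_⟩
  have hvs := star_eq_neg_of_mem_span_skewCommutators hv
  have hws := star_eq_neg_of_mem_span_skewCommutators hw
  have h2 : a = (starRingEnd ℂ z) • (-1 : A) + v - Complex.I • w := by
    have : a = -star a := by rw [ha, neg_neg]
    rw [this, e, star_add, star_add, star_smul, star_smul, hvs, hws, star_one]
    simp only [RCLike.star_def, Complex.conj_I, smul_neg, neg_smul, neg_neg]
    abel
  have hz : z - starRingEnd ℂ z = 2 * (z.im * Complex.I) := by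
    rw [Complex.sub_conj]; push_cast; ring
  have h3 : (2 : ℂ) • a = (2 : ℂ) • (z.im • (Complex.I • (1 : A)) + v) := by
    have hc : z.im • (Complex.I • (1 : A)) = (z.im * Complex.I : ℂ) • (1 : A) := by
      rw [mul_smul]; rfl
    rw [two_smul]
    nth_rewrite 1 [e]
    rw [h2, hc, smul_add, smul_smul, ← hz, sub_smul, two_smul, smul_neg]
    abel
  exact smul_right_injective A (two_ne_zero' ℂ) h3

variable [FiniteDimensional ℂ A]

/-- Skew-adjoint elements are combinations of `I` and finitely many fixed commutators of
skew-adjoint elements, with controlled coefficients. -/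
theorem exists_commutator_coefficients
    (hA : Submodule.span ℂ (insert 1 {x | ∃ a b : A, x = a * b - b * a}) = ⊤) :
    ∃ (m : ℕ) (q r : Fin m → A) (C : ℝ), (∀ i, star (q i) = -q i) ∧ (∀ i, star (r i) = -r i) ∧
      0 ≤ C ∧ ∀ a : A, star a = -a → ∃ (h : ℝ) (c : Fin m → ℝ), |h| ≤ C * ‖a‖ ∧
        (∀ i, |c i| ≤ C * ‖a‖) ∧
        a = h • (Complex.I • 1) + ∑ i, c i • (q i * r i - r i * q i) := by
  have : FiniteDimensional ℝ A := FiniteDimensional.complexToReal A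
  -- A basis extracted from the commutators themselves makes the list of pairs finite. A linear
  -- right inverse of the resulting surjection is bounded in finite dimension, and its operator norm
  -- is the constant C.
  obtain ⟨b, hbT, hbs, hbl⟩ := exists_linearIndependent ℝ (skewCommutators A)
  have : Finite b := hbl.setFinite
  obtain ⟨m, ⟨e⟩⟩ := Finite.exists_equiv_fin b
  choose q r hq hr hqr using fun i : Fin m => hbT (e.symm i).2
  let W : Submodule ℝ A := skewAdjoint.submodule ℝ A
  have hW : ∀ a, a ∈ W ↔ star a = -a := fun a => skewAdjoint.mem_iff
  let f : (ℝ × (Fin m → ℝ)) →ₗ[ℝ] A :=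
    (LinearMap.toSpanSingleton ℝ A (Complex.I • 1)).comp (LinearMap.fst ℝ ℝ (Fin m → ℝ)) +
      (Fintype.linearCombination ℝ fun i => q i * r i - r i * q i).comp
        (LinearMap.snd ℝ ℝ (Fin m → ℝ))
  have hf : ∀ p, f p = p.1 • (Complex.I • 1) + ∑ i, p.2 i • (q i * r i - r i * q i) := fun p => by
    simp [f, Fintype.linearCombination_apply]
  have hfW : ∀ p, f p ∈ W := fun p => by
    rw [hW, hf, star_add, star_sum]
    simp [hq, hr, ← Finset.sum_neg_distrib, ← smul_neg, add_comm]
  have hsurj : Function.Surjective (f.codRestrict W hfW) := by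
    rintro ⟨a, ha⟩
    obtain ⟨h, v, hv, rfl⟩ := exists_eq_of_skew hA ((hW a).1 ha)
    rw [← hbs] at hv
    have : b = Set.range fun i : Fin m => q i * r i - r i * q i := by
      ext x
      constructor
      · intro hx
        exact ⟨e ⟨x, hx⟩, by simp only [← hqr]; simp⟩
      · rintro ⟨i, rfl⟩
        simp only [← hqr]; exact (e.symm i).2
    rw [this, ← Fintype.range_linearCombination] at hv
    obtain ⟨c, rfl⟩ := hv
    refine ⟨(h, c), Subtype.ext ?_⟩
    simp [hf, Fintype.linearCombination_apply]
  obtain ⟨g, hg⟩ := (f.codRestrict W hfW).exists_rightInverse_of_surjective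
    (LinearMap.range_eq_top.2 hsurj)
  let g' := LinearMap.toContinuousLinearMap g
  refine ⟨m, q, r, ‖g'‖, hq, hr, g'.opNorm_nonneg, fun a ha => ?_⟩
  let a' : W := ⟨a, (hW a).2 ha⟩
  have hb : ‖g a'‖ ≤ ‖g'‖ * ‖a‖ := g'.le_opNorm a'
  refine ⟨(g a').1, (g a').2, ?_, fun i => ?_, ?_⟩
  · exact (norm_fst_le (g a')).trans hb
  · exact ((norm_le_pi_norm (g a').2 i).trans (norm_snd_le (g a'))).trans hb
  · rw [← hf]
    have := congrArg Subtype.val (LinearMap.congr_fun hg a')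
    simpa using this.symm

theorem norm_cexp_sub_le (h : ℝ) :
    ‖Complex.exp (h * Complex.I) - 1 - h * Complex.I‖ ≤ h ^ 2 ∧
      ‖Complex.exp (h * Complex.I) - 1‖ ≤ |h| := by
  have hI : star Complex.I = -Complex.I := by simp
  have h1 := norm_exp_smul_sub_one_sub_le hI h
  have h2 := norm_exp_smul_sub_one_le hI h
  rw [← Complex.exp_eq_exp_ℂ] at h1 h2
  simpa using And.intro h1 h2

/-- A unitary near `1` is, up to a phase and to higher order, a product of a fixed number of group
commutators of unitaries near `1`. -/
theorem exists_groupCommutator_factorization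
    (hA : Submodule.span ℂ (insert 1 {x | ∃ a b : A, x = a * b - b * a}) = ⊤) :
    ∃ (m : ℕ) (C : ℝ), 0 ≤ C ∧ ∀ δ : ℝ, 0 ≤ δ → δ ≤ 1 → ∀ u ∈ unitary A, ‖u - 1‖ ≤ δ ^ 2 →
      ∃ v w : Fin m → A, (∀ i, v i ∈ unitary A) ∧ (∀ i, w i ∈ unitary A) ∧
        (∀ i, ‖v i - 1‖ ≤ C * δ) ∧ (∀ i, ‖w i - 1‖ ≤ C * δ) ∧
        ∃ z : ℂ, ‖z‖ = 1 ∧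
          ‖u - z • (List.ofFn fun i => groupCommutator (v i) (w i)).prod‖ ≤ C * δ ^ 3 := by
  obtain ⟨m, q, r, C, hq, hr, hC, hcoef⟩ := exists_commutator_coefficients hA
  set B : ℝ := 1 + ∑ i, (‖q i‖ + ‖r i‖)
  have hBq : ∀ i, ‖q i‖ + ‖r i‖ + 1 ≤ B := fun i => by
    have := Finset.single_le_sum (f := fun i => ‖q i‖ + ‖r i‖) (fun i _ => by positivity)
      (Finset.mem_univ i)
    simp only [B]; linarith
  have hB : 0 ≤ B := by positivity
  set c₀ := Real.sqrt C
  have hc₀ : 0 ≤ c₀ := Real.sqrt_nonneg _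
  set c₁ := 8 * B ^ 3 * (c₀ + 1) ^ 3 + C * (2 * (B * B))
  have hc₁ : 0 ≤ c₁ := by positivity
  obtain ⟨C₂, hC₂, hprod⟩ := exists_norm_prod_sub_le (A := A) c₁ hc₁ m
  refine ⟨m, B * c₀ + (1 + C₂ + C ^ 2 + C * (m * c₁)), by positivity,
    fun δ hδ hδ1 u hu hu1 => ?_⟩
  -- The skew-adjoint part of u serves as an approximate logarithm; by unitarity the self-adjoint
  -- part of u - 1 is -(1/2)(u - 1)*(u - 1), which has size δ⁴.
  set a : A := (1 / 2 : ℝ) • (u - star u) with ha_def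
  have ha : star a = -a := by
    rw [ha_def, star_smul, star_sub, star_star, ← smul_neg, neg_sub]; simp
  have hδ2 : δ ^ 2 ≤ 1 := pow_le_one₀ hδ hδ1
  have hδ43 : δ ^ 4 ≤ δ ^ 3 := pow_le_pow_of_le_one hδ hδ1 (by norm_num)
  have hna : ‖a‖ ≤ δ ^ 2 := by
    have : u - star u = (u - 1) - star (u - 1) := by simp
    rw [ha_def, norm_smul, this]
    have := norm_sub_le (u - 1) (star (u - 1))
    rw [norm_star] at this
    rw [Real.norm_of_nonneg (by norm_num)]
    linarith
  have hua : ‖u - 1 - a‖ ≤ δ ^ 3 := by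
    have : u - 1 - a = -(1 / 2 : ℝ) • (star (u - 1) * (u - 1)) := by
      have h : star (u - 1) * (u - 1) = (2 : ℝ) • 1 - star u - u := by
        rw [star_sub, star_one, sub_mul, mul_sub, Unitary.star_mul_self_of_mem hu, two_smul]
        noncomm_ring
      rw [h, ha_def]
      module
    rw [this, norm_smul]
    have h2 : ‖star (u - 1) * (u - 1)‖ ≤ δ ^ 2 * δ ^ 2 := by
      refine (norm_mul_le _ _).trans ?_
      rw [norm_star]; gcongr
    rw [norm_neg, Real.norm_of_nonneg (by norm_num)]
    have : δ ^ 2 * δ ^ 2 = δ ^ 4 := by ring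
    nlinarith [pow_nonneg hδ 4]
  obtain ⟨h, c, hh, hc, hac⟩ := hcoef a ha
  have hh' : |h| ≤ C * δ ^ 2 := hh.trans (by gcongr)
  have hc' : ∀ i, |c i| ≤ C * δ ^ 2 := fun i => (hc i).trans (by gcongr)
  have hs : ∀ i, Real.sqrt |c i| ≤ c₀ * δ := fun i => by
    have := Real.sqrt_le_sqrt (hc' i)
    rwa [Real.sqrt_mul hC, Real.sqrt_sq hδ] at this
  -- Coefficients of size δ² are distributed as s i * t i = c i with both factors of size δ, the
  -- sign being absorbed in t. This is what makes v and w only δ-close to 1 while their commutator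
  -- is δ²-close.
  set s : Fin m → ℝ := fun i => Real.sqrt |c i|
  set t : Fin m → ℝ := fun i => SignType.sign (c i) * Real.sqrt |c i|
  have hsabs : ∀ i, |s i| ≤ c₀ * δ := fun i => by
    rw [abs_of_nonneg (Real.sqrt_nonneg _)]; exact hs i
  have htabs : ∀ i, |t i| ≤ c₀ * δ := fun i => by
    simp only [t]
    rw [abs_mul, abs_of_nonneg (Real.sqrt_nonneg _)]
    refine (mul_le_of_le_one_left (Real.sqrt_nonneg _) ?_).trans (hs i)
    rcases lt_trichotomy (c i) 0 with h | h | h <;> simp [h, sign_neg, sign_pos]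
  have hst : ∀ i, s i * t i = c i := fun i => by
    simp only [s, t]
    rw [mul_left_comm, Real.mul_self_sqrt (abs_nonneg _), sign_mul_abs]
  set v : Fin m → A := fun i => exp (s i • q i)
  set w : Fin m → A := fun i => exp (t i • r i)
  have hv : ∀ i, v i ∈ unitary A := fun i => exp_smul_mem_unitary (hq i) _
  have hw : ∀ i, w i ∈ unitary A := fun i => exp_smul_mem_unitary (hr i) _
  set x : Fin m → A := fun i => c i • (q i * r i - r i * q i)
  set P := (List.ofFn fun i => groupCommutator (v i) (w i)).prod
  have hx : ∀ i, ‖x i‖ ≤ c₁ * δ ^ 2 := fun i => by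
    simp only [x]
    rw [norm_smul, Real.norm_eq_abs]
    calc _ ≤ (C * δ ^ 2) * (2 * (B * B)) := by
          gcongr
          · exact hc' i
          · refine (norm_commutator_le _ _).trans ?_
            gcongr <;> linarith [hBq i, norm_nonneg (q i), norm_nonneg (r i)]
      _ = (C * (2 * (B * B))) * δ ^ 2 := by ring
      _ ≤ _ := by
          gcongr
          simp only [c₁]
          linarith [show 0 ≤ 8 * B ^ 3 * (c₀ + 1) ^ 3 by positivity]
  have hP : ‖P - 1 - ∑ i, x i‖ ≤ C₂ * δ ^ 3 := by
    refine hprod δ hδ hδ1 _ x (fun i => groupCommutator_mem (hv i) (hw i)) (fun i => ?_) hx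
    have := norm_groupCommutator_exp_sub_le (hq i) (hr i) hc₀ hδ (hsabs i) (htabs i)
    rw [hst] at this
    refine this.trans ?_
    gcongr
    simp only [c₁]
    have h3 : 8 * (‖q i‖ + ‖r i‖ + 1) ^ 3 * (c₀ + 1) ^ 3 ≤ 8 * B ^ 3 * (c₀ + 1) ^ 3 := by
      gcongr; exact hBq i
    linarith [show 0 ≤ C * (2 * (B * B)) by positivity]
  set Y := ∑ i, x i
  have hY : ‖Y‖ ≤ m * c₁ * δ ^ 2 := by
    refine (norm_sum_le _ _).trans ((Finset.sum_le_sum fun i _ => hx i).trans ?_)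
    simp [mul_assoc]
  set z := Complex.exp (h * Complex.I)
  have hz : ‖z‖ = 1 := Complex.norm_exp_ofReal_mul_I h
  obtain ⟨hz1, hz2⟩ := norm_cexp_sub_le h
  refine ⟨v, w, hv, hw, fun i => ?_, fun i => ?_, z, hz, ?_⟩
  · refine (norm_exp_smul_sub_one_le (hq i) (s i)).trans ?_
    have h1 : ‖q i‖ * |s i| ≤ B * (c₀ * δ) := by
      gcongr
      · linarith [hBq i, norm_nonneg (r i)]
      · exact hsabs i
    nlinarith [show 0 ≤ (1 + C₂ + C ^ 2 + C * (m * c₁)) * δ by positivity]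
  · refine (norm_exp_smul_sub_one_le (hr i) (t i)).trans ?_
    have h1 : ‖r i‖ * |t i| ≤ B * (c₀ * δ) := by
      gcongr
      · linarith [hBq i, norm_nonneg (q i)]
      · exact htabs i
    nlinarith [show 0 ≤ (1 + C₂ + C ^ 2 + C * (m * c₁)) * δ by positivity]
  · have hh1 : h • (Complex.I • (1 : A)) = (h * Complex.I : ℂ) • (1 : A) := by
      rw [mul_smul]; rfl
    -- The scalar part of `a` cannot come from commutators; it is supplied by the phase z = exp(ih),
    -- and the product P supplies the rest to first order.
    have e : u - z • P = (u - 1 - a) - (z • (P - 1 - Y) + (z - 1 - h * Complex.I) • (1 : A) +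
        (z - 1) • Y) := by
      rw [hac, hh1]
      module
    rw [e]
    calc _ ≤ δ ^ 3 + (1 * (C₂ * δ ^ 3) + h ^ 2 * 1 + |h| * (m * c₁ * δ ^ 2)) := by
          refine (norm_sub_le _ _).trans (add_le_add hua (norm_add₃_le.trans ?_))
          rw [norm_smul, norm_smul, norm_smul, hz]
          have : ‖(1 : A)‖ ≤ 1 := norm_le_one_of_mem_unitary (one_mem _)
          gcongr
      _ ≤ δ ^ 3 + (1 * (C₂ * δ ^ 3) + (C * δ ^ 2) ^ 2 * 1 + (C * δ ^ 2) * (m * c₁ * δ ^ 2)) := by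
          rw [← sq_abs h]; gcongr
      _ = δ ^ 3 + C₂ * δ ^ 3 + (C ^ 2 + C * (m * c₁)) * δ ^ 4 := by ring
      _ ≤ δ ^ 3 + C₂ * δ ^ 3 + (C ^ 2 + C * (m * c₁)) * δ ^ 3 := by gcongr
      _ ≤ _ := by
          nlinarith [show 0 ≤ B * c₀ * δ ^ 3 by positivity]

end SolovayKitaev

/-! ### Words up to a phase and the Solovay–Kitaev recursion -/

section SolovayKitaev

open Filter Topology

variable {A : Type*} [CStarAlgebra A]

/-- Products of at most `ℓ` elements of `S`, up to a phase. -/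
def wordBall (S : Set A) (ℓ : ℕ) : Set A :=
  {x | ∃ l : List A, (∀ g ∈ l, g ∈ S) ∧ l.length ≤ ℓ ∧ ∃ z : ℂ, ‖z‖ = 1 ∧ x = z • l.prod}

theorem wordBall_mono (S : Set A) : Monotone (wordBall S) := by
  rintro a b hab x ⟨l, hl, hla, hz⟩
  exact ⟨l, hl, hla.trans hab, hz⟩

theorem one_mem_wordBall (S : Set A) (ℓ : ℕ) : 1 ∈ wordBall S ℓ :=
  ⟨[], by simp, by simp, 1, by simp, by simp⟩

theorem smul_mem_wordBall {S : Set A} {ℓ : ℕ} {x : A} (hx : x ∈ wordBall S ℓ) {z : ℂ}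
    (hz : ‖z‖ = 1) : z • x ∈ wordBall S ℓ := by
  obtain ⟨l, hl, hn, w, hw, rfl⟩ := hx
  exact ⟨l, hl, hn, z * w, by simp [hz, hw], by rw [smul_smul]⟩

theorem mul_mem_wordBall {S : Set A} {a b : ℕ} {x y : A} (hx : x ∈ wordBall S a)
    (hy : y ∈ wordBall S b) : x * y ∈ wordBall S (a + b) := by
  obtain ⟨l, hl, hn, w, hw, rfl⟩ := hx
  obtain ⟨l', hl', hn', w', hw', rfl⟩ := hy
  refine ⟨l ++ l', fun g hg => ?_, by simp; omega, w * w', by simp [hw, hw'], ?_⟩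
  · rcases List.mem_append.1 hg with h | h
    exacts [hl g h, hl' g h]
  · rw [List.prod_append, smul_mul_smul_comm]

theorem star_mem_wordBall {S : Set A} (hS : ∀ g ∈ S, star g ∈ S) {a : ℕ} {x : A}
    (hx : x ∈ wordBall S a) : star x ∈ wordBall S a := by
  obtain ⟨l, hl, hn, w, hw, rfl⟩ := hx
  refine ⟨(l.map star).reverse, fun g hg => ?_, by simpa using hn, star w, by simpa using hw, ?_⟩
  · obtain ⟨g', hg', rfl⟩ := List.mem_map.1 (List.mem_reverse.1 hg)
    exact hS _ (hl _ hg')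
  · rw [star_smul]
    congr 1
    clear hl hn
    induction l with
    | nil => simp
    | cons g l ih => simp [star_mul, ih]

theorem smul_mem_unitary {u : A} (hu : u ∈ unitary A) {z : ℂ} (hz : ‖z‖ = 1) :
    z • u ∈ unitary A := by
  have h : star z * z = 1 := by
    rw [RCLike.star_def, ← Complex.normSq_eq_conj_mul_self, Complex.normSq_eq_norm_sq, hz]; simp
  rw [Unitary.mem_iff, star_smul, smul_mul_smul_comm, smul_mul_smul_comm, mul_comm z, h,
    Unitary.star_mul_self_of_mem hu, Unitary.mul_star_self_of_mem hu]
  simp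

theorem mem_unitary_of_mem_wordBall {S : Set A} (hS : S ⊆ unitary A) {a : ℕ} {x : A}
    (hx : x ∈ wordBall S a) : x ∈ unitary A := by
  obtain ⟨l, hl, -, w, hw, rfl⟩ := hx
  exact smul_mem_unitary (Submonoid.list_prod_mem _ fun g hg => hS (hl g hg)) hw

theorem groupCommutator_mem_wordBall {S : Set A} (hS : ∀ g ∈ S, star g ∈ S) {a : ℕ} {x y : A}
    (hx : x ∈ wordBall S a) (hy : y ∈ wordBall S a) :
    groupCommutator x y ∈ wordBall S (4 * a) := by
  have := mul_mem_wordBall (mul_mem_wordBall (mul_mem_wordBall hx hy) (star_mem_wordBall hS hx))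
    (star_mem_wordBall hS hy)
  have e : 4 * a = a + a + a + a := by ring
  rw [e]; exact this

theorem prod_ofFn_mem_wordBall {S : Set A} {a : ℕ} (m : ℕ) (x : Fin m → A)
    (hx : ∀ i, x i ∈ wordBall S a) : (List.ofFn x).prod ∈ wordBall S (m * a) := by
  induction m with
  | zero => simpa using one_mem_wordBall S 0
  | succ m ih =>
    rw [List.ofFn_succ, List.prod_cons]
    have := mul_mem_wordBall (hx 0) (ih (fun i => x i.succ) fun i => hx _)
    convert this using 1
    congr 1; ring

theorem norm_prod_ofFn_sub_le {η : ℝ} (m : ℕ) (x y : Fin m → A) (hx : ∀ i, x i ∈ unitary A)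
    (hy : ∀ i, y i ∈ unitary A) (h : ∀ i, ‖x i - y i‖ ≤ η) :
    ‖(List.ofFn x).prod - (List.ofFn y).prod‖ ≤ m * η := by
  induction m with
  | zero => simp
  | succ m ih =>
    rw [List.ofFn_succ, List.ofFn_succ, List.prod_cons, List.prod_cons]
    have h' := ih (fun i => x i.succ) (fun i => y i.succ) (fun i => hx _) (fun i => hy _)
      fun i => h _
    have hyu : (List.ofFn fun i : Fin m => y i.succ).prod ∈ unitary A :=
      Submonoid.list_prod_mem _ fun g hg => by
        obtain ⟨i, rfl⟩ := List.mem_ofFn.1 hg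
        exact hy _
    set X := (List.ofFn fun i : Fin m => x i.succ).prod
    set Y := (List.ofFn fun i : Fin m => y i.succ).prod
    have e : x 0 * X - y 0 * Y = x 0 * (X - Y) + (x 0 - y 0) * Y := by noncomm_ring
    rw [e]
    calc _ ≤ ‖x 0‖ * ‖X - Y‖ + ‖x 0 - y 0‖ * ‖Y‖ :=
          (norm_add_le _ _).trans (add_le_add (norm_mul_le _ _) (norm_mul_le _ _))
      _ ≤ 1 * (m * η) + η * 1 := by
          gcongr
          · exact norm_le_one_of_mem_unitary (hx 0)
          · exact (norm_nonneg _).trans (h 0)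
          · exact h 0
          · exact norm_le_one_of_mem_unitary hyu
      _ = _ := by push_cast; ring

/-- Every unitary is `ε`-close to a product of at most `ℓ` elements of `S`, up to a phase. -/
def IsWordNet (S : Set A) (ε : ℝ) (ℓ : ℕ) : Prop :=
  ∀ u ∈ unitary A, ∃ x ∈ wordBall S ℓ, ‖u - x‖ ≤ ε

variable [FiniteDimensional ℂ A]

/-- Correct a δ²-approximation x₀ by approximating u x₀* instead. This lies within δ² of 1, so it
factors into m group commutators; approximating their arguments by the same net costs only δ³. Each
commutator uses four words, which with x₀ gives the length factor 4m + 1. No separate error analysis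
near 1 is needed because the net covers all unitaries. -/
theorem exists_wordNet_refinement
    (hA : Submodule.span ℂ (insert 1 {x | ∃ a b : A, x = a * b - b * a}) = ⊤) :
    ∃ (M : ℕ) (C : ℝ), 1 ≤ C ∧ ∀ S : Set A, S ⊆ unitary A → (∀ g ∈ S, star g ∈ S) →
      ∀ (δ : ℝ) (ℓ : ℕ), 0 ≤ δ → δ ≤ 1 → IsWordNet S (δ ^ 2) ℓ →
        IsWordNet S (C * δ ^ 3) (M * ℓ) := by
  obtain ⟨m, C, hC, hfac⟩ := exists_groupCommutator_factorization hA
  refine ⟨m * 4 + 1, 1 + C + m * (8 * (C + 1) ^ 2), ?_, fun S hS hSs δ ℓ hδ hδ1 hnet u hu => ?_⟩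
  · have : 0 ≤ m * (8 * (C + 1) ^ 2) := by positivity
    linarith
  obtain ⟨x₀, hx₀, hux⟩ := hnet u hu
  have hx₀u := mem_unitary_of_mem_wordBall hS hx₀
  have hΔ : u * star x₀ ∈ unitary A := mul_mem hu (Unitary.star_mem hx₀u)
  have hΔ1 : ‖u * star x₀ - 1‖ ≤ δ ^ 2 := by
    have : u * star x₀ - 1 = (u - x₀) * star x₀ := by
      rw [sub_mul, Unitary.mul_star_self_of_mem hx₀u]
    rw [this]
    refine (norm_mul_le _ _).trans ?_
    calc _ ≤ δ ^ 2 * 1 := by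
          gcongr
          exact norm_le_one_of_mem_unitary (Unitary.star_mem hx₀u)
      _ = _ := mul_one _
  obtain ⟨v, w, hv, hw, hv1, hw1, z, hz, hfin⟩ := hfac δ hδ hδ1 _ hΔ hΔ1
  choose v' hv' hvv using fun i => hnet (v i) (hv i)
  choose w' hw' hww using fun i => hnet (w i) (hw i)
  have hv'u := fun i => mem_unitary_of_mem_wordBall hS (hv' i)
  have hw'u := fun i => mem_unitary_of_mem_wordBall hS (hw' i)
  set P := (List.ofFn fun i => groupCommutator (v i) (w i)).prod
  set P' := (List.ofFn fun i => groupCommutator (v' i) (w' i)).prod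
  have hP' : P' ∈ wordBall S (m * (4 * ℓ)) :=
    prod_ofFn_mem_wordBall m _ fun i => groupCommutator_mem_wordBall hSs (hv' i) (hw' i)
  have hPP : ‖P - P'‖ ≤ m * (8 * (C + 1) ^ 2 * δ ^ 3) :=
    norm_prod_ofFn_sub_le m _ _ (fun i => groupCommutator_mem (hv i) (hw i))
      (fun i => groupCommutator_mem (hv'u i) (hw'u i)) fun i =>
      norm_groupCommutator_sub_le (hv i) (hw i) (hv'u i) (hw'u i) hC hδ hδ1 (hv1 i) (hw1 i)
        (hvv i) (hww i)
  refine ⟨z • P' * x₀, ?_, ?_⟩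
  · have := mul_mem_wordBall (smul_mem_wordBall hP' hz) hx₀
    convert this using 1
    congr 1; ring
  · have e : u - z • P' * x₀ = ((u * star x₀ - z • P) + z • (P - P')) * x₀ := by
      rw [add_mul, sub_mul, mul_assoc u, Unitary.star_mul_self_of_mem hx₀u, smul_sub, sub_mul]
      simp
    rw [e]
    calc _ ≤ ‖(u * star x₀ - z • P) + z • (P - P')‖ * ‖x₀‖ := norm_mul_le _ _
      _ ≤ (C * δ ^ 3 + m * (8 * (C + 1) ^ 2 * δ ^ 3)) * 1 := by
          gcongr
          · refine (norm_add_le _ _).trans (add_le_add hfin ?_)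
            rw [norm_smul, hz, one_mul]; exact hPP
          · exact norm_le_one_of_mem_unitary hx₀u
      _ ≤ _ := by nlinarith [pow_nonneg hδ 3]

theorem isCompact_unitary_of_finiteDimensional : IsCompact (unitary A : Set A) := by
  have : ProperSpace A := FiniteDimensional.proper ℂ A
  refine Metric.isCompact_of_isClosed_isBounded ?_ ?_
  · have : (unitary A : Set A) = {u | star u * u = 1} ∩ {u | u * star u = 1} := by
      ext u; exact Unitary.mem_iff
    rw [this]
    exact (isClosed_eq (by fun_prop) continuous_const).inter
      (isClosed_eq (by fun_prop) continuous_const)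
  · refine (Metric.isBounded_closedBall (x := (0 : A)) (r := 1)).subset fun u hu => ?_
    simpa using norm_le_one_of_mem_unitary hu

/-- Density gives a length for each unitary; compactness of the unitary group and monotonicity of
the word balls make it uniform. -/
theorem exists_isWordNet_of_dense {S : Set A}
    (hd : ∀ u ∈ unitary A, u ∈ closure (⋃ ℓ, wordBall S ℓ)) {ε : ℝ} (hε : 0 < ε) :
    ∃ ℓ, IsWordNet S ε ℓ := by
  obtain ⟨ℓ, hℓ⟩ := (isCompact_unitary_of_finiteDimensional (A := A)).elim_directed_cover
    (fun ℓ => ⋃ x ∈ wordBall S ℓ, Metric.ball x ε)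
    (fun ℓ => isOpen_biUnion fun _ _ => Metric.isOpen_ball)
    (fun u hu => by
      obtain ⟨x, hx, hux⟩ := Metric.mem_closure_iff.1 (hd u hu) ε hε
      obtain ⟨ℓ, hℓ⟩ := Set.mem_iUnion.1 hx
      exact Set.mem_iUnion.2 ⟨ℓ, Set.mem_biUnion hℓ hux⟩)
    (Monotone.directed_le fun a b hab =>
      Set.biUnion_subset_biUnion_left (wordBall_mono S hab))
  refine ⟨ℓ, fun u hu => ?_⟩
  obtain ⟨x, hx, hux⟩ := Set.mem_iUnion₂.1 (hℓ hu)
  exact ⟨x, hx, (by simpa [dist_eq_norm] using hux : ‖u - x‖ < ε).le⟩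

/-- The Solovay–Kitaev theorem: if the products of elements of `S` are dense in the unitary group
up to phases, then they approximate unitaries efficiently. -/
theorem solovay_kitaev
    (hA : Submodule.span ℂ (insert 1 {x | ∃ a b : A, x = a * b - b * a}) = ⊤) {S : Set A}
    (hS : S ⊆ unitary A) (hSs : ∀ g ∈ S, star g ∈ S)
    (hd : ∀ u ∈ unitary A, u ∈ closure (⋃ ℓ, wordBall S ℓ)) :
    ∃ (C : ℝ) (p : ℕ), ∀ u ∈ unitary A, ∀ ε : ℝ, 0 < ε → ε ≤ 1 / 2 →
      ∃ l : List A, (∀ g ∈ l, g ∈ S) ∧ (l.length : ℝ) ≤ C * Real.log (1 / ε) ^ p ∧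
        ∃ z : ℂ, ‖z‖ = 1 ∧ ‖z • l.prod - u‖ ≤ ε := by
  obtain ⟨M, C, hC, href⟩ := exists_wordNet_refinement hA
  obtain ⟨ℓ, hℓ⟩ := exists_isWordNet_of_dense hd (ε := (1 / 2 / C) ^ 2) (by positivity)
  have hC0 : 0 < C := by linarith
  have hpow : ∀ k : ℕ, 0 < (3 / 2 : ℝ) ^ k := fun k => by positivity
  -- With precision δ² the recursion is δ ↦ √C · δ^(3/2); writing δ = ρ/C gives ρ ↦ ρ^(3/2) exactly,
  -- whence the doubly exponential decay from ρ = 1/2.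
  have hnet : ∀ k : ℕ, IsWordNet S (((1 / 2 : ℝ) ^ ((3 / 2 : ℝ) ^ k) / C) ^ 2) (M ^ k * ℓ) := by
    intro k
    induction k with
    | zero => simpa using hℓ
    | succ k ih =>
      set ρ := (1 / 2 : ℝ) ^ ((3 / 2 : ℝ) ^ k) with hρ
      have hρ0 : 0 ≤ ρ := by positivity
      have hρ1 : ρ ≤ 1 := Real.rpow_le_one (by norm_num) (by norm_num) (hpow k).le
      have h := href S hS hSs (ρ / C) _ (by positivity)
        ((div_le_one hC0).2 (hρ1.trans hC)) ih
      have e : ((1 / 2 : ℝ) ^ ((3 / 2 : ℝ) ^ (k + 1)) / C) ^ 2 = C * (ρ / C) ^ 3 := by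
        have : ((1 / 2 : ℝ) ^ ((3 / 2 : ℝ) ^ (k + 1))) ^ 2 = ρ ^ 3 := by
          rw [hρ, ← Real.rpow_mul_natCast (by norm_num), ← Real.rpow_mul_natCast (by norm_num),
            pow_succ]
          congr 1; push_cast; ring
        rw [div_pow, this]; field_simp
      rw [e]
      convert h using 1
      ring
  -- The depth n needed is logarithmic to base 3/2 in log(1/ε), while the length grows like Mⁿ.
  -- Choosing (3/2)^p > M bounds the length by a multiple of the p-th power of log(1/ε).
  obtain ⟨p, hp⟩ := pow_unbounded_of_one_lt (M : ℝ) (by norm_num : (1 : ℝ) < 3 / 2)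
  have hlog2 : 0 < Real.log 2 := Real.log_pos (by norm_num)
  refine ⟨(3 / 2 / Real.log 2) ^ p * ℓ, p, fun u hu ε hε hε2 => ?_⟩
  set L := Real.log (1 / ε)
  have hL : Real.log 2 ≤ L := by
    apply Real.log_le_log (by norm_num)
    rw [le_div_iff₀ hε]; linarith
  obtain ⟨n, hn1, hn2⟩ := exists_nat_pow_near (x := L / Real.log 2) (y := (3 / 2 : ℝ))
    ((one_le_div hlog2).2 hL) (by norm_num)
  obtain ⟨x, ⟨l, hl, hlen, z, hz, rfl⟩, hx⟩ := hnet (n + 1) u hu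
  refine ⟨l, hl, ?_, z, hz, ?_⟩
  · have h1 : (l.length : ℝ) ≤ (M : ℝ) ^ (n + 1) * ℓ := by exact_mod_cast hlen
    have h2 : (M : ℝ) ^ (n + 1) ≤ (3 / 2 / Real.log 2 * L) ^ p := by
      calc (M : ℝ) ^ (n + 1) ≤ ((3 / 2 : ℝ) ^ p) ^ (n + 1) := by gcongr
        _ = (3 / 2 * (3 / 2 : ℝ) ^ n) ^ p := by rw [← pow_mul, mul_comm, pow_mul, pow_succ']
        _ ≤ (3 / 2 * (L / Real.log 2)) ^ p := by gcongr
        _ = _ := by congr 1; ring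
    calc (l.length : ℝ) ≤ (3 / 2 / Real.log 2 * L) ^ p * ℓ := h1.trans (by gcongr)
      _ = _ := by rw [mul_pow]; ring
  · rw [norm_sub_rev]
    refine hx.trans ?_
    set ρ := (1 / 2 : ℝ) ^ ((3 / 2 : ℝ) ^ (n + 1))
    have hρ0 : 0 ≤ ρ := by positivity
    have hρ1 : ρ ≤ 1 := Real.rpow_le_one (by norm_num) (by norm_num) (hpow _).le
    have h1 : ρ / C ≤ ρ := div_le_self hρ0 hC
    have h2 : (ρ / C) ^ 2 ≤ ρ := by
      have : 0 ≤ ρ / C := by positivity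
      nlinarith
    refine h2.trans ?_
    rw [← Real.log_le_log_iff (by positivity) hε, Real.log_rpow (by norm_num)]
    have h3 : Real.log (1 / 2) = -Real.log 2 := by rw [one_div, Real.log_inv]
    have h4 : Real.log ε = -L := by simp only [L]; rw [one_div, Real.log_inv, neg_neg]
    rw [h3, h4]
    rw [div_lt_iff₀ hlog2] at hn2
    linarith

end SolovayKitaev

/-! ## Closed groups of unitary matrices -/

section UnitaryMatrices

open NormedSpace
open scoped Matrix.Norms.L2Operator

section

variable {ι : Type*} [Fintype ι] [DecidableEq ι]

/-- Commutators of matrix units give all off-diagonal units and all differences of diagonal ones.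
Adding the identity recovers each diagonal unit, since the number of indices is invertible. -/
theorem Matrix.span_one_commutators :
    Submodule.span ℂ (insert 1 {x | ∃ a b : Matrix ι ι ℂ, x = a * b - b * a}) = ⊤ := by
  set V := Submodule.span ℂ (insert 1 {x | ∃ a b : Matrix ι ι ℂ, x = a * b - b * a})
  have hcomm : ∀ a b : Matrix ι ι ℂ, a * b - b * a ∈ V := fun a b =>
    Submodule.subset_span (Or.inr ⟨a, b, rfl⟩)
  have hone : (1 : Matrix ι ι ℂ) ∈ V := Submodule.subset_span (Or.inl rfl)
  have hoff : ∀ j k, j ≠ k → Matrix.single j k (1 : ℂ) ∈ V := fun j k hjk => by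
    have := hcomm (Matrix.single j j 1) (Matrix.single j k 1)
    rwa [Matrix.single_mul_single_same, Matrix.single_mul_single_of_ne _ _ _ _ hjk.symm,
      one_mul, sub_zero] at this
  have hdiff : ∀ j k, Matrix.single j j (1 : ℂ) - Matrix.single k k 1 ∈ V := fun j k => by
    have := hcomm (Matrix.single j k 1) (Matrix.single k j 1)
    rwa [Matrix.single_mul_single_same, Matrix.single_mul_single_same, one_mul] at this
  have hdiag : ∀ j, Matrix.single j j (1 : ℂ) ∈ V := fun j => by
    have h : (Fintype.card ι : ℂ) • Matrix.single j j (1 : ℂ) =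
        1 + ∑ k, (Matrix.single j j (1 : ℂ) - Matrix.single k k 1) := by
      rw [Finset.sum_sub_distrib, Matrix.sum_single_one]
      simp [Nat.cast_smul_eq_nsmul]
    have hc : (Fintype.card ι : ℂ) ≠ 0 := by
      have : Nonempty ι := ⟨j⟩
      exact_mod_cast Fintype.card_ne_zero
    rw [← inv_smul_smul₀ hc (Matrix.single j j (1 : ℂ)), h]
    exact V.smul_mem _ (V.add_mem hone (V.sum_mem fun k _ => hdiff j k))
  rw [eq_top_iff]
  rintro x -
  rw [Matrix.matrix_eq_sum_single x]
  refine V.sum_mem fun j _ => V.sum_mem fun k _ => ?_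
  have : Matrix.single j k (x j k) = x j k • Matrix.single j k 1 := by simp
  rw [this]
  refine V.smul_mem _ ?_
  by_cases h : j = k
  · subst h; exact hdiag j
  · exact hoff j k h

theorem Matrix.eq_top_of_commutators_mem {V : Submodule ℂ (Matrix ι ι ℂ)} (h1 : 1 ∈ V)
    (hV : ∀ a b, a * b - b * a ∈ V) : V = ⊤ := by
  rw [eq_top_iff, ← Matrix.span_one_commutators, Submodule.span_le]
  rintro x (rfl | ⟨a, b, rfl⟩)
  exacts [h1, hV a b]

end

section

variable {A : Type*} [CStarAlgebra A] {K : Submonoid A} {hK : IsClosed (K : Set A)}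

/-- The complex span of a real subspace V is V + iV. -/
theorem exists_add_I_smul_of_mem_span_tangentSpace {x : A}
    (hx : x ∈ Submodule.span ℂ (tangentSpace K hK : Set A)) :
    ∃ b ∈ tangentSpace K hK, ∃ c ∈ tangentSpace K hK, x = b + Complex.I • c := by
  induction hx using Submodule.span_induction with
  | mem x hx => exact ⟨x, hx, 0, zero_mem _, by simp⟩
  | zero => exact ⟨0, zero_mem _, 0, zero_mem _, by simp⟩
  | add x y _ _ hx hy =>
    obtain ⟨b, hb, c, hc, rfl⟩ := hx
    obtain ⟨b', hb', c', hc', rfl⟩ := hy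
    exact ⟨b + b', add_mem hb hb', c + c', add_mem hc hc', by rw [smul_add]; abel⟩
  | smul z x _ hx =>
    obtain ⟨v, hv, w, hw, rfl⟩ := hx
    refine ⟨z.re • v - z.im • w, sub_mem (Submodule.smul_mem _ _ hv)
      (Submodule.smul_mem _ _ hw), z.im • v + z.re • w, add_mem (Submodule.smul_mem _ _ hv)
      (Submodule.smul_mem _ _ hw), ?_⟩
    have hI : ∀ x : A, Complex.I • Complex.I • x = -x := fun x => by
      rw [smul_smul, Complex.I_mul_I]; simp
    have hc : ∀ x : A, z • x = z.re • x + z.im • Complex.I • x := fun x => by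
      conv_lhs => rw [← Complex.re_add_im z]
      rw [add_smul, mul_smul]; rfl
    have hcomm : ∀ (t : ℝ) (x : A), Complex.I • t • x = t • Complex.I • x :=
      fun t x => smul_comm _ _ _
    rw [smul_add, hc v, hc (Complex.I • w), hI, smul_add, hcomm, hcomm, smul_neg]
    abel

/-- Passing to the complex span loses nothing: in b + ic with b and c skew-adjoint, ic is
self-adjoint, so it vanishes if the sum is skew-adjoint. -/
theorem mem_tangentSpace_of_mem_span {x : A} (hxs : star x = -x)
    (hx : x ∈ Submodule.span ℂ (tangentSpace K hK : Set A)) : x ∈ tangentSpace K hK := by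
  obtain ⟨b, hb, c, hc, rfl⟩ := exists_add_I_smul_of_mem_span_tangentSpace hx
  rw [star_add, star_smul, hb.1, hc.1] at hxs
  have h : (2 * Complex.I) • c = 0 := by
    have h1 : -b + Complex.I • c = -(b + Complex.I • c) := by simpa using hxs
    have h2 : Complex.I • c + Complex.I • c = 0 := by
      have := congrArg (fun y => y + b + Complex.I • c) h1
      simpa [add_comm, add_assoc] using this
    rw [mul_smul, two_smul]; exact h2
  have hc0 : c = 0 := (smul_eq_zero.1 h).resolve_left (by simp)
  rw [hc0]; simpa using hb

theorem commutator_mem_span_tangentSpace {x y : A}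
    (hx : x ∈ Submodule.span ℂ (tangentSpace K hK : Set A))
    (hy : y ∈ Submodule.span ℂ (tangentSpace K hK : Set A)) :
    x * y - y * x ∈ Submodule.span ℂ (tangentSpace K hK : Set A) := by
  induction hx using Submodule.span_induction with
  | mem x hx =>
    induction hy using Submodule.span_induction with
    | mem y hy => exact Submodule.subset_span (commutator_mem_tangentSpace hx hy)
    | zero => simp
    | add y y' _ _ h h' =>
      have := add_mem h h'
      convert this using 1; noncomm_ring
    | smul z y _ h =>
      have := Submodule.smul_mem _ z h
      convert this using 1; rw [mul_smul_comm, smul_mul_assoc, smul_sub]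
  | zero => simp
  | add x x' _ _ h h' =>
    have := add_mem h h'
    convert this using 1; noncomm_ring
  | smul z x _ h =>
    have := Submodule.smul_mem _ z h
    convert this using 1; rw [mul_smul_comm, smul_mul_assoc, smul_sub]

end

/-- A closed monoid of unitary matrices that contains the phases and whose one-parameter groups
span the matrix algebra contains all unitary matrices. -/
theorem unitary_subset_of_span_tangentSpace {ι : Type*} [Fintype ι] [DecidableEq ι]
    {K : Submonoid (Matrix ι ι ℂ)} {hK : IsClosed (K : Set (Matrix ι ι ℂ))}
    (hphase : ∀ z : ℂ, ‖z‖ = 1 → z • (1 : Matrix ι ι ℂ) ∈ K)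
    (hspan : Submodule.span ℂ (tangentSpace K hK : Set (Matrix ι ι ℂ)) = ⊤)
    {u : Matrix ι ι ℂ} (hu : u ∈ unitary (Matrix ι ι ℂ)) : u ∈ K := by
  -- The spectrum of u is finite and the circle is not, so some phase moves the spectrum off -1,
  -- where the principal argument provides a logarithm.
  obtain ⟨z, hz, hzs⟩ : ∃ z : ℂ, ‖z‖ = 1 ∧ -z⁻¹ ∉ spectrum ℂ u := by
    have hinf : (Metric.sphere (0 : ℂ) 1).Infinite := by
      intro h
      have hr : (Set.range fun t : ℝ => Complex.exp (t * Complex.I)).Finite :=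
        h.subset (by rintro _ ⟨t, rfl⟩; simp [Complex.norm_exp_ofReal_mul_I])
      have := Set.Infinite.mono (s := (fun t : ℝ => Complex.exp (t * Complex.I)) '' Set.Icc 0 1)
        (Set.image_subset_range _ _) (Set.Infinite.image ?_ (Set.Icc_infinite zero_lt_one))
      · exact this hr
      · intro s hs t ht hst
        have h1 := congrArg Complex.re hst
        simp only [Complex.exp_ofReal_mul_I_re] at h1
        have hpi := Real.pi_gt_three
        exact Real.injOn_cos ⟨hs.1, by linarith [hs.2]⟩ ⟨ht.1, by linarith [ht.2]⟩ h1
    obtain ⟨w, hw, hws⟩ := hinf.exists_notMem_finite (Matrix.finite_spectrum u)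
    have hw1 : ‖w‖ = 1 := by simpa using hw
    refine ⟨-w⁻¹, by simp [hw1], by simpa [inv_neg] using hws⟩
  have hz0 : z ≠ 0 := by rintro rfl; simp at hz
  have hzu : z • u ∈ unitary (Matrix ι ι ℂ) := smul_mem_unitary hu hz
  have hlt : ‖z • u - 1‖ < 2 := by
    rw [Unitary.norm_sub_one_lt_two_iff hzu]
    intro h
    apply hzs
    have h2 : (-1 : ℂ) = (Units.mk0 z hz0) • (-z⁻¹ : ℂ) := by
      change -1 = z * -z⁻¹
      rw [mul_neg, mul_inv_cancel₀ hz0]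
    have h3 : z • u = (Units.mk0 z hz0) • u := rfl
    rw [h2, h3, spectrum.smul_mem_smul_iff] at h
    exact h
  have hexp := expUnitary_argSelfAdjoint (u := ⟨z • u, hzu⟩) hlt
  set x := Unitary.argSelfAdjoint ⟨z • u, hzu⟩
  have hexp' : exp (Complex.I • (x : Matrix ι ι ℂ)) = z • u := by
    have := congrArg Subtype.val hexp
    rwa [selfAdjoint.expUnitary_coe] at this
  have hxs : star (Complex.I • (x : Matrix ι ι ℂ)) = -(Complex.I • (x : Matrix ι ι ℂ)) := by
    rw [star_smul, selfAdjoint.mem_iff.1 x.2]; simp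
  have hxt : Complex.I • (x : Matrix ι ι ℂ) ∈ tangentSpace K hK :=
    mem_tangentSpace_of_mem_span hxs (by rw [hspan]; trivial)
  have hm := K.mul_mem (hphase z⁻¹ (by simp [hz])) (exp_mem_of_mem_tangentSpace hxt)
  rw [hexp', smul_mul_smul_comm, inv_mul_cancel₀ hz0, one_mul, one_smul] at hm
  exact hm

end UnitaryMatrices

/-! ### Density of the gates V and T on one qubit -/

section SingleQubit

open NormedSpace
open scoped Matrix.Norms.L2Operator

/-- An element with square -1 defines an algebra map from ℂ that sends i to it, and continuous
algebra maps commute with exponentials; this is Euler's formula transported. -/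
theorem exp_smul_eq_cos_add_sin {A : Type*} [CStarAlgebra A] {b : A} (hb : b * b = -1) (t : ℝ) :
    exp (t • b) = Real.cos t • 1 + Real.sin t • b := by
  let : NormedAlgebra ℚ A := .restrictScalars ℚ ℂ A
  let f : ℂ →ₐ[ℝ] A := Complex.liftAux b hb
  have hf : Continuous f := f.toLinearMap.continuous_of_finiteDimensional
  have h := map_exp f hf (t * Complex.I)
  rw [← Complex.exp_eq_exp_ℂ] at h
  have h1 : f (t * Complex.I) = t • b := by
    simp [f, Complex.liftAux_apply]
  rw [h1] at h
  rw [← h, Complex.liftAux_apply, Complex.exp_ofReal_mul_I_re, Complex.exp_ofReal_mul_I_im,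
    Algebra.algebraMap_eq_smul_one]

/-- A closed group that contains `cos θ + b sin θ`, where `θ` is incommensurable with `π`, contains
the one-parameter group of `b`. -/
theorem mem_tangentSpace_of_irrational {A : Type*} [CStarAlgebra A] {K : Submonoid A}
    {hK : IsClosed (K : Set A)} {b : A} (hb : b * b = -1) (hbs : star b = -b) {θ : ℝ}
    (hθ : Irrational (θ / (2 * Real.pi))) (h1 : exp (θ • b) ∈ K) (h2 : exp (-θ • b) ∈ K) :
    b ∈ tangentSpace K hK := by
  let : NormedAlgebra ℚ A := .restrictScalars ℚ ℂ A
  have hadd : ∀ s t : ℝ, exp ((s + t) • b) = exp (s • b) * exp (t • b) := fun s t => by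
    rw [add_smul]
    exact exp_add_of_commute (((Commute.refl b).smul_left s).smul_right t)
  let H : AddSubgroup ℝ :=
    { carrier := {t | exp (t • b) ∈ K ∧ exp (-t • b) ∈ K}
      zero_mem' := by simp [K.one_mem]
      add_mem' := by
        rintro s t ⟨hs, hs'⟩ ⟨ht, ht'⟩
        refine ⟨?_, ?_⟩
        · rw [hadd]; exact K.mul_mem hs ht
        · rw [neg_add, hadd]; exact K.mul_mem hs' ht'
      neg_mem' := by
        rintro s ⟨hs, hs'⟩
        exact ⟨hs', by rwa [neg_neg]⟩ }
  have hpi : ∀ t : ℝ, t = 2 * Real.pi ∨ t = -(2 * Real.pi) → exp (t • b) = 1 := by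
    rintro t (rfl | rfl) <;> rw [exp_smul_eq_cos_add_sin hb] <;> simp
  -- The times whose exponentials lie in K contain θ and also the period 2π; these generate a dense
  -- subgroup of the line, and closedness fills in the remaining times.
  have hd := (dense_addSubgroupClosure_pair_iff (a := θ) (b := 2 * Real.pi)).2 hθ
  have hle : AddSubgroup.closure {θ, 2 * Real.pi} ≤ H := by
    rw [AddSubgroup.closure_le]
    rintro t (rfl | rfl)
    · exact ⟨h1, h2⟩
    · refine ⟨?_, ?_⟩
      · rw [hpi _ (Or.inl rfl)]; exact K.one_mem
      · rw [hpi _ (Or.inr rfl)]; exact K.one_mem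
  refine ⟨hbs, fun t => ?_⟩
  have hc : IsClosed {t : ℝ | exp (t • b) ∈ K} :=
    hK.preimage (exp_continuous.comp (continuous_id.smul continuous_const))
  have : (Set.univ : Set ℝ) ⊆ {t : ℝ | exp (t • b) ∈ K} := by
    rw [← hd.closure_eq]
    exact closure_minimal (fun t ht => (hle ht).1) hc
  exact this trivial

/-- For a rational multiple θ of π, 2 cos θ is an algebraic integer. Here (2 cos θ)² = 1 + √2/2,
which would make √2/2 and then its square 1/2 algebraic integers. -/
theorem irrational_arccos_div_two_pi :
    Irrational (Real.arccos ((√2)⁻¹ * Real.cos (Real.pi / 8)) / (2 * Real.pi)) := by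
  rintro ⟨x, hx⟩
  have hpos : (0 : ℝ) < Real.pi := Real.pi_pos
  set θ := Real.arccos ((√2)⁻¹ * Real.cos (Real.pi / 8)) with hθ
  have h2 : (√2)⁻¹ ^ 2 = (1 / 2 : ℝ) := by rw [inv_pow, Real.sq_sqrt (by norm_num)]; norm_num
  have hcos : Real.cos θ = (√2)⁻¹ * Real.cos (Real.pi / 8) := by
    have h0 : 0 ≤ Real.cos (Real.pi / 8) :=
      Real.cos_nonneg_of_mem_Icc ⟨by linarith, by linarith⟩
    have h1 := Real.cos_le_one (Real.pi / 8)
    have h3 : (√2)⁻¹ ≤ (1 : ℝ) := by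
      refine inv_le_one_of_one_le₀ ?_
      rw [Real.one_le_sqrt]; norm_num
    have h4 : (0 : ℝ) ≤ (√2)⁻¹ := by positivity
    exact Real.cos_arccos (by nlinarith) (by nlinarith)
  have hint := Real.isIntegral_two_mul_cos_rat_mul_pi (2 * x)
  have hxθ : ((2 * x : ℚ) : ℝ) * Real.pi = θ := by
    push_cast; rw [hx]; field_simp
  rw [hxθ] at hint
  have hsq := hint.pow 2
  have h8 : Real.cos (Real.pi / 8) ^ 2 = 1 / 2 + √2 / 4 := by
    rw [Real.cos_sq, show 2 * (Real.pi / 8) = Real.pi / 4 by ring, Real.cos_pi_div_four]; ring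
  have e1 : (2 * Real.cos θ) ^ 2 = 1 + √2 / 2 := by
    rw [hcos, mul_pow, mul_pow, h2, h8]; ring
  rw [e1] at hsq
  have h3 : IsIntegral ℤ ((√2 / 2 : ℝ) ^ 2) := by
    have := (hsq.sub isIntegral_one).pow 2
    rwa [add_sub_cancel_left] at this
  have e2 : (√2 / 2 : ℝ) ^ 2 = algebraMap ℚ ℝ (1 / 2) := by
    rw [div_pow, Real.sq_sqrt (by norm_num)]; norm_num
  rw [e2, isIntegral_algebraMap_iff (algebraMap ℚ ℝ).injective] at h3
  obtain ⟨k, hk⟩ := IsIntegrallyClosed.isIntegral_iff.1 h3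
  have h4 : (2 * k : ℤ) = 1 := by
    have : (k : ℚ) = 1 / 2 := by simpa using hk
    have h5 : ((2 * k : ℤ) : ℚ) = 1 := by push_cast; rw [this]; norm_num
    exact_mod_cast h5
  omega

/-- The `T`-gate. -/
noncomputable def tGate : Matrix Bool Bool ℂ :=
  Matrix.diagonal fun b => if b then Complex.exp (Real.pi * Complex.I / 4) else 1

/-- The square root of the Pauli matrix `X`. -/
noncomputable def vGate : Matrix Bool Bool ℂ :=
  Matrix.of fun x y => if x = y then (1 + Complex.I) / 2 else (1 - Complex.I) / 2

/-- The Pauli matrix `Z`. -/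
def zGate : Matrix Bool Bool ℂ := Matrix.diagonal fun b => if b then -1 else 1

/-- With ζ = exp(πi/8), r = 1/√2 and q = sin(π/8), these relations reduce the later matrix
identities to polynomial algebra. -/
theorem exists_eighth_root :
    ∃ ζ r : ℂ, ∃ q : ℝ, ζ * star ζ = 1 ∧ star r = r ∧ 2 * r ^ 2 = 1 ∧ ζ ^ 2 = r * (1 + Complex.I) ∧
      Complex.exp (Real.pi * Complex.I / 4) = ζ ^ 2 ∧ q ≠ 0 ∧ ζ - star ζ = 2 * q * Complex.I ∧
      r * (ζ + star ζ) = 2 * ((√2)⁻¹ * Real.cos (Real.pi / 8) : ℝ) := by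
  have hI := Complex.I_mul_I
  have hz : ∀ t : ℝ, Complex.exp (t * Complex.I) =
      Real.cos t + Real.sin t * Complex.I := fun t => by
    rw [Complex.exp_mul_I, Complex.ofReal_cos, Complex.ofReal_sin]
  have hz8 := hz (Real.pi / 8)
  have hpos := Real.pi_pos
  have hr : ((√2 : ℝ) : ℂ) ^ 2 = 2 := by
    rw [← Complex.ofReal_pow, Real.sq_sqrt (by norm_num)]; norm_num
  have hr0 : ((√2 : ℝ) : ℂ) ≠ 0 := by
    intro h; rw [h] at hr; norm_num at hr
  have hstar : star (Complex.exp ((Real.pi / 8 : ℝ) * Complex.I)) =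
      Real.cos (Real.pi / 8) - Real.sin (Real.pi / 8) * Complex.I := by
    rw [hz8]
    simp only [RCLike.star_def, map_add, map_mul, Complex.conj_ofReal, Complex.conj_I]
    ring
  have hexp : Complex.exp (Real.pi * Complex.I / 4) =
      Complex.exp ((Real.pi / 8 : ℝ) * Complex.I) ^ 2 := by
    rw [← Complex.exp_nat_mul]; congr 1; push_cast; ring
  refine ⟨Complex.exp ((Real.pi / 8 : ℝ) * Complex.I), ((√2 : ℝ) : ℂ)⁻¹, Real.sin (Real.pi / 8),
    ?_, ?_, ?_, ?_, hexp, ?_, ?_, ?_⟩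
  · rw [hstar, hz8]
    have : (Real.cos (Real.pi / 8) : ℂ) ^ 2 + (Real.sin (Real.pi / 8) : ℂ) ^ 2 = 1 := by
      exact_mod_cast Real.cos_sq_add_sin_sq _
    linear_combination this - (Real.sin (Real.pi / 8) : ℂ) ^ 2 * hI
  · simp
  · rw [inv_pow, hr]; norm_num
  · rw [← hexp, show (Real.pi * Complex.I / 4 : ℂ) = (Real.pi / 4 : ℝ) * Complex.I by
      push_cast; ring, hz, Real.cos_pi_div_four, Real.sin_pi_div_four]
    push_cast
    field_simp
    linear_combination (1 + Complex.I) * hr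
  · exact (Real.sin_pos_of_pos_of_lt_pi (by linarith) (by linarith)).ne'
  · rw [hstar, hz8]; ring
  · rw [hstar, hz8]; push_cast; ring

theorem I_smul_one_mem_tangentSpace {A : Type*} [CStarAlgebra A] {K : Submonoid A}
    {hK : IsClosed (K : Set A)} (hphase : ∀ z : ℂ, ‖z‖ = 1 → z • (1 : A) ∈ K) :
    Complex.I • (1 : A) ∈ tangentSpace K hK := by
  refine ⟨by simp [star_smul], fun t => ?_⟩
  have h : t • Complex.I • (1 : A) = algebraMap ℂ A (t * Complex.I) := by
    rw [Algebra.algebraMap_eq_smul_one, mul_smul]; rfl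
  rw [h, ← algebraMap_exp_comm, ← Complex.exp_eq_exp_ℂ, Algebra.algebraMap_eq_smul_one]
  exact hphase _ (Complex.norm_exp_ofReal_mul_I t)

theorem one_mem_span_tangentSpace {A : Type*} [CStarAlgebra A] {K : Submonoid A}
    {hK : IsClosed (K : Set A)} (hphase : ∀ z : ℂ, ‖z‖ = 1 → z • (1 : A) ∈ K) :
    (1 : A) ∈ Submodule.span ℂ (tangentSpace K hK : Set A) := by
  have := Submodule.smul_mem _ (Complex.I)⁻¹
    (Submodule.subset_span (R := ℂ) (I_smul_one_mem_tangentSpace (hK := hK) hphase))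
  rwa [smul_smul, inv_mul_cancel₀ Complex.I_ne_zero, one_smul] at this

theorem conj_mem_span_tangentSpace {A : Type*} [CStarAlgebra A] {K : Submonoid A}
    {hK : IsClosed (K : Set A)} {a u : A}
    (ha : a ∈ Submodule.span ℂ (tangentSpace K hK : Set A)) (hu : u ∈ unitary A) (huK : u ∈ K)
    (huK' : star u ∈ K) : u * a * star u ∈ Submodule.span ℂ (tangentSpace K hK : Set A) := by
  induction ha using Submodule.span_induction with
  | mem a ha => exact Submodule.subset_span (conj_mem_tangentSpace ha hu huK huK')
  | zero => simp
  | add a b _ _ h h' => rw [mul_add, add_mul]; exact add_mem h h'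
  | smul z a _ h => rw [mul_smul_comm, smul_mul_assoc]; exact Submodule.smul_mem _ _ h

theorem star_vGate : star vGate =
    Matrix.of fun x y => if x = y then (1 - Complex.I) / 2 else (1 + Complex.I) / 2 := by
  ext x y
  cases x <;> cases y <;> simp [vGate, Matrix.star_apply, sub_eq_add_neg]

theorem vGate_mem_unitary : vGate ∈ unitary (Matrix Bool Bool ℂ) := by
  have hI := Complex.I_sq
  rw [Unitary.mem_iff, star_vGate]
  constructor <;> ext x y <;> cases x <;> cases y <;>
    simp [vGate, Matrix.mul_apply] <;> ring_nf <;> rw [hI] <;> norm_num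

theorem zGate_mem_unitary : zGate ∈ unitary (Matrix Bool Bool ℂ) := by
  rw [Unitary.mem_iff]
  constructor <;> ext x y <;> cases x <;> cases y <;>
    simp [zGate, Matrix.mul_apply, Matrix.star_apply, Matrix.diagonal_apply]

theorem eq_top_of_pauli_mem {V : Submodule ℂ (Matrix Bool Bool ℂ)} (h1 : 1 ∈ V) (hZ : zGate ∈ V)
    (hX : Matrix.of (fun x y : Bool => if x = y then (0 : ℂ) else 1) ∈ V)
    (hY : Matrix.of (fun x y : Bool => if x = y then (0 : ℂ) else if x then -1 else 1) ∈ V) :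
    V = ⊤ := by
  rw [eq_top_iff]
  rintro a -
  have : a = ((a false false + a true true) / 2) • (1 : Matrix Bool Bool ℂ) +
      ((a false false - a true true) / 2) • zGate +
      ((a false true + a true false) / 2) •
        Matrix.of (fun x y : Bool => if x = y then (0 : ℂ) else 1) +
      ((a false true - a true false) / 2) •
        Matrix.of (fun x y : Bool => if x = y then (0 : ℂ) else if x then -1 else 1) := by
    ext x y
    cases x <;> cases y <;> simp [zGate] <;> ring
  rw [this]
  exact V.add_mem (V.add_mem (V.add_mem (V.smul_mem _ h1) (V.smul_mem _ hZ)) (V.smul_mem _ hX))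
    (V.smul_mem _ hY)

/-- TV, scaled to determinant one, is cos θ + b sin θ with θ incommensurable with π, so its axis b
lies in the tangent space. From b alone, conjugation by Z = T⁴ and by V and one commutator produce
all Pauli matrices. -/
theorem span_tangentSpace_singleQubit {K : Submonoid (Matrix Bool Bool ℂ)}
    {hK : IsClosed (K : Set (Matrix Bool Bool ℂ))}
    (hphase : ∀ z : ℂ, ‖z‖ = 1 → z • (1 : Matrix Bool Bool ℂ) ∈ K)
    (hv : vGate ∈ K) (hv' : star vGate ∈ K) (ht : tGate ∈ K) (ht' : star tGate ∈ K) :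
    Submodule.span ℂ (tangentSpace K hK : Set (Matrix Bool Bool ℂ)) = ⊤ := by
  obtain ⟨ζ, r, q, h1, hr, h2, h3, hω, hq, h4, h5⟩ := exists_eighth_root
  have hI := Complex.I_mul_I
  have h3' : star ζ ^ 2 = r * (1 - Complex.I) := by
    have := congrArg star h3
    simpa [hr, sub_eq_add_neg] using this
  have hζ4' : star ζ ^ 4 = -Complex.I := by
    linear_combination (star ζ ^ 2 + r * (1 - Complex.I)) * h3' - Complex.I * h2 + r ^ 2 * hI
  have hζ4 : ζ ^ 4 = Complex.I := by
    linear_combination (ζ ^ 2 + r * (1 + Complex.I)) * h3 + Complex.I * h2 + r ^ 2 * hI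
  have hζ8 : (ζ ^ 2) ^ 4 = -1 := by
    linear_combination (ζ ^ 4 + Complex.I) * hζ4 + hI
  have h6 : 1 + Complex.I = 2 * r * ζ ^ 2 := by
    linear_combination (-2 * r) * h3 - (1 + Complex.I) * h2
  have h7 : 1 - Complex.I = 2 * r * star ζ ^ 2 := by
    linear_combination (-2 * r) * h3' - (1 - Complex.I) * h2
  set c : ℝ := (√2)⁻¹ * Real.cos (Real.pi / 8) with hc
  set θ := Real.arccos c with hθ
  have hc2 : c ^ 2 ≤ 1 / 2 := by
    rw [hc, mul_pow, inv_pow, Real.sq_sqrt (by norm_num)]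
    have := Real.cos_sq_le_one (Real.pi / 8)
    linarith
  have hcos : Real.cos θ = c := Real.cos_arccos (by nlinarith) (by nlinarith)
  have hsin : Real.sin θ ≠ 0 := by
    intro h
    have := Real.sin_sq_add_cos_sq θ
    rw [h, hcos] at this
    nlinarith
  have hsc : (Real.sin θ : ℂ) ^ 2 = 1 - (c : ℂ) ^ 2 := by
    have := Real.sin_sq_add_cos_sq θ
    rw [hcos] at this
    have h : (Real.sin θ) ^ 2 = 1 - c ^ 2 := by linarith
    exact_mod_cast h
  have hsinC : (Real.sin θ : ℂ) ≠ 0 := by exact_mod_cast hsin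
  -- the product of the two gates, normalized to determinant one
  let g : Matrix Bool Bool ℂ := Matrix.of fun x y =>
    r * (if x then ζ else star ζ) * (if x = y then 1 else -Complex.I)
  have hg : g = star ζ ^ 3 • (tGate * vGate) := by
    ext x y
    cases x <;> cases y <;>
      simp only [g, tGate, vGate, Matrix.diagonal_mul, Matrix.smul_apply, Matrix.of_apply,
        smul_eq_mul, hω, if_true, if_false, Bool.false_eq_true, reduceCtorEq]
    · linear_combination (-(star ζ ^ 3 / 2)) * h6 - r * star ζ * (ζ * star ζ + 1) * h1
    · linear_combination (-(star ζ ^ 3 / 2)) * h7 - r * star ζ * hζ4'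
    · linear_combination (-(star ζ ^ 3 * ζ ^ 2 / 2)) * h7 - r * ζ * hζ4' -
        r * ζ * star ζ ^ 4 * h1
    · linear_combination (-(star ζ ^ 3 * ζ ^ 2 / 2)) * h6 -
        r * ζ * ((ζ * star ζ) ^ 2 + ζ * star ζ + 1) * h1
  have hζn : ‖ζ‖ = 1 := by
    have h : ‖ζ‖ * ‖ζ‖ = 1 := by
      have := congrArg norm h1
      rwa [norm_mul, norm_star, norm_one] at this
    nlinarith [norm_nonneg ζ]
  have hmul : ∀ z : ℂ, ‖z‖ = 1 → ∀ a ∈ K, z • a ∈ K := fun z hz a ha => by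
    have := K.mul_mem (hphase z hz) ha
    rwa [smul_mul_assoc, one_mul] at this
  have hgK : g ∈ K := by
    rw [hg]; exact hmul _ (by simp [hζn]) _ (K.mul_mem ht hv)
  have hgK' : star g ∈ K := by
    rw [hg, star_smul, star_mul]; exact hmul _ (by simp [hζn]) _ (K.mul_mem hv' ht')
  -- For a matrix in SU(2) with trace 2c, the adjoint is the inverse 2c - g; together with
  -- Cayley–Hamilton this shows that the trace-free part squares to -sin² θ.
  have hgs : star g = (2 * c : ℂ) • (1 : Matrix Bool Bool ℂ) - g := by
    have hr' : (starRingEnd ℂ) r = r := hr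
    ext x y
    cases x <;> cases y <;>
      simp [g, Matrix.star_apply, hr', ← h5] <;> ring
  have hgg : g * g = (2 * c : ℂ) • g - 1 := by
    ext x y
    cases x <;> cases y <;>
      simp only [g, Matrix.mul_apply, Fintype.sum_bool, Matrix.sub_apply, Matrix.smul_apply,
        Matrix.of_apply, smul_eq_mul, if_true, if_false, Bool.false_eq_true, reduceCtorEq,
        Matrix.one_apply, ← h5]
    · linear_combination r ^ 2 * ζ * star ζ * hI - 2 * r ^ 2 * h1 - h2
    · ring
    · ring
    · linear_combination r ^ 2 * ζ * star ζ * hI - 2 * r ^ 2 * h1 - h2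
  let b : Matrix Bool Bool ℂ := (Real.sin θ : ℂ)⁻¹ • (g - (c : ℂ) • 1)
  have hsb : Real.sin θ • b = g - (c : ℂ) • 1 := by
    have : Real.sin θ • b = (Real.sin θ : ℂ) • b := rfl
    rw [this, smul_inv_smul₀ hsinC]
  have hb : b * b = -1 := by
    simp only [b]
    rw [smul_mul_smul_comm]
    have : (g - (c : ℂ) • 1) * (g - (c : ℂ) • 1) = (-(Real.sin θ : ℂ) ^ 2) • 1 := by
      rw [hsc, sub_mul, mul_sub, hgg]
      simp only [smul_mul_assoc, mul_smul_comm, one_mul, mul_one, mul_sub]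
      module
    rw [this, smul_smul]
    have : (Real.sin θ : ℂ)⁻¹ * (Real.sin θ : ℂ)⁻¹ * -(Real.sin θ : ℂ) ^ 2 = -1 := by
      field_simp
    rw [this, neg_one_smul]
  have hbs : star b = -b := by
    simp only [b]
    rw [star_smul, star_sub, hgs, star_smul, star_one]
    simp only [RCLike.star_def, map_inv₀, Complex.conj_ofReal]
    module
  have hbt : b ∈ tangentSpace K hK := by
    refine mem_tangentSpace_of_irrational hb hbs irrational_arccos_div_two_pi ?_ ?_
    · rw [exp_smul_eq_cos_add_sin hb, ← hc, ← hθ, hcos, hsb]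
      have : c • (1 : Matrix Bool Bool ℂ) = (c : ℂ) • 1 := rfl
      rwa [this, add_sub_cancel]
    · rw [exp_smul_eq_cos_add_sin hb, ← hc, ← hθ, Real.cos_neg, Real.sin_neg, hcos, neg_smul, hsb]
      have : c • (1 : Matrix Bool Bool ℂ) = (c : ℂ) • 1 := rfl
      rw [this]
      convert hgK' using 1
      rw [hgs]; module
  set V := Submodule.span ℂ (tangentSpace K hK : Set (Matrix Bool Bool ℂ))
  have hN : g - (c : ℂ) • 1 ∈ V := by
    rw [← hsb]; exact Submodule.subset_span (Submodule.smul_mem _ _ hbt)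
  have hzt : zGate = tGate ^ 4 := by
    rw [tGate, Matrix.diagonal_pow, zGate]
    congr 1; ext x; cases x <;> simp [hω, hζ8]
  have hzs : star zGate = zGate := by
    ext x y; cases x <;> cases y <;> simp [zGate, Matrix.star_apply]
  have hzK : zGate ∈ K := hzt ▸ K.pow_mem ht 4
  -- Averaging over conjugation by Z kills the X and Y components of the axis and leaves its Z
  -- component, which is nonzero because sin(π/8) is.
  have hZ : zGate ∈ V := by
    have h := add_mem hN (conj_mem_span_tangentSpace hN zGate_mem_unitary hzK (hzs.symm ▸ hzK))
    have e : g - (c : ℂ) • 1 + zGate * (g - (c : ℂ) • 1) * star zGate =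
        (-(2 * r * q * Complex.I)) • zGate := by
      rw [hzs]
      ext x y
      cases x <;> cases y <;>
        simp [zGate, g]
      · have hst : (starRingEnd ℂ) ζ = star ζ := rfl
        rw [hst]; linear_combination h5 - r * h4
      · linear_combination h5 + r * h4
    have hne : -(2 * r * q * Complex.I) ≠ 0 := by
      have hr0 : r ≠ 0 := by rintro rfl; norm_num at h2
      have hq0 : (q : ℂ) ≠ 0 := by exact_mod_cast hq
      simp [hr0, hq0]
    rw [e] at h
    have := V.smul_mem (-(2 * r * q * Complex.I))⁻¹ h
    rwa [inv_smul_smul₀ hne] at this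
  -- V is a quarter turn about the X axis, so it carries Z to a multiple of Y; the commutator of Z
  -- and Y then yields X.
  have hY : Matrix.of (fun x y : Bool => if x = y then (0 : ℂ) else if x then -1 else 1) ∈ V := by
    have h := V.smul_mem (-Complex.I)
      (conj_mem_span_tangentSpace hZ vGate_mem_unitary hv hv')
    rw [star_vGate] at h
    convert h using 1
    ext x y
    cases x <;> cases y <;>
      simp [vGate, zGate, Matrix.mul_apply, Matrix.diagonal_apply] <;>
      ring_nf <;> simp
  refine eq_top_of_pauli_mem (one_mem_span_tangentSpace hphase) hZ ?_ hY
  have h := V.smul_mem (1 / 2 : ℂ) (commutator_mem_span_tangentSpace hZ hY)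
  convert h using 1
  ext x y
  cases x <;> cases y <;> simp [zGate, Matrix.mul_apply, Matrix.diagonal_apply] <;> norm_num

end SingleQubit

/-! ### Lie algebras of matrices on a register of qubits -/

section Register

open NormedSpace
open scoped Matrix.Norms.L2Operator

theorem map_mem_tangentSpace {A B : Type*} [CStarAlgebra A] [CStarAlgebra B] (φ : A →⋆ₐ[ℂ] B)
    (hφ : Continuous φ) {K : Submonoid B} (hK : IsClosed (K : Set B)) {a : A}
    (ha : a ∈ tangentSpace (K.comap (φ : A →* B)) (hK.preimage hφ)) : φ a ∈ tangentSpace K hK := by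
  let : NormedAlgebra ℚ A := .restrictScalars ℚ ℂ A
  let : NormedAlgebra ℚ B := .restrictScalars ℚ ℂ B
  refine ⟨by rw [← map_star, ha.1, map_neg], fun t => ?_⟩
  have h : t • φ a = φ (t • a) := by
    have := map_smul φ (t : ℂ) a
    exact this.symm
  rw [h, ← map_exp φ hφ]
  exact ha.2 t

variable {n : ℕ}

/-- The tensor product of one-qubit matrices, acting on a register of qubits. -/
def tensorMatrix :
    MultilinearMap ℂ (fun _ : Fin n => Matrix Bool Bool ℂ) (Matrix (Fin n → Bool) (Fin n → Bool) ℂ) where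
  toFun M := Matrix.of fun x y => ∏ j, M j (x j) (y j)
  map_update_add' {d} M i a b := by
    obtain rfl : d = instDecidableEqFin n := Subsingleton.elim _ _
    ext x y
    simp only [Matrix.of_apply, Matrix.add_apply]
    have h := fun c : Matrix Bool Bool ℂ => fun j =>
      Function.apply_update (fun j (m : Matrix Bool Bool ℂ) => m (x j) (y j)) M i c j
    simp only [h, Finset.prod_update_of_mem (Finset.mem_univ i), Matrix.add_apply, add_mul]
  map_update_smul' {d} M i z a := by
    obtain rfl : d = instDecidableEqFin n := Subsingleton.elim _ _
    ext x y
    simp only [Matrix.of_apply, Matrix.smul_apply, smul_eq_mul]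
    have h := fun c : Matrix Bool Bool ℂ => fun j =>
      Function.apply_update (fun j (m : Matrix Bool Bool ℂ) => m (x j) (y j)) M i c j
    simp only [h, Finset.prod_update_of_mem (Finset.mem_univ i), Matrix.smul_apply, smul_eq_mul,
      mul_assoc]

theorem tensorMatrix_apply (M : Fin n → Matrix Bool Bool ℂ) (x y : Fin n → Bool) :
    tensorMatrix M x y = ∏ j, M j (x j) (y j) := rfl

theorem tensorMatrix_mul (M N : Fin n → Matrix Bool Bool ℂ) :
    tensorMatrix (M * N) = tensorMatrix M * tensorMatrix N := by
  ext x y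
  simp only [tensorMatrix_apply, Matrix.mul_apply, Pi.mul_apply, Finset.prod_univ_sum,
    Fintype.piFinset_univ, Finset.prod_mul_distrib]

theorem tensorMatrix_diagonal (d : Fin n → Bool → ℂ) :
    tensorMatrix (fun j => Matrix.diagonal (d j)) =
      Matrix.diagonal fun x : Fin n → Bool => ∏ j, d j (x j) := by
  ext x y
  rw [tensorMatrix_apply]
  by_cases h : x = y
  · subst h; simp
  · rw [Matrix.diagonal_apply_ne _ h]
    obtain ⟨j, hj⟩ := Function.ne_iff.1 h
    exact Finset.prod_eq_zero (Finset.mem_univ j) (Matrix.diagonal_apply_ne _ hj)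

theorem tensorMatrix_one : tensorMatrix (1 : Fin n → Matrix Bool Bool ℂ) = 1 := by
  have := tensorMatrix_diagonal (n := n) fun _ _ => 1
  simp only [Matrix.diagonal_one, Finset.prod_const_one] at this
  exact this

theorem star_tensorMatrix (M : Fin n → Matrix Bool Bool ℂ) :
    star (tensorMatrix M) = tensorMatrix (star M) := by
  ext x y
  simp [tensorMatrix_apply, Matrix.star_apply]

/-- A one-qubit matrix on the qubit `j` of a register. -/
def siteHom (j : Fin n) :
    Matrix Bool Bool ℂ →⋆ₐ[ℂ] Matrix (Fin n → Bool) (Fin n → Bool) ℂ where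
  toFun a := tensorMatrix (Function.update 1 j a)
  map_one' := by rw [show Function.update (1 : Fin n → Matrix Bool Bool ℂ) j 1 = 1 from
    Function.update_eq_self j 1, tensorMatrix_one]
  map_mul' a b := by
    rw [← tensorMatrix_mul, ← Function.update_mul, one_mul]
  map_zero' := by
    exact tensorMatrix.map_update_zero _ _
  map_add' a b := by rw [MultilinearMap.map_update_add]
  commutes' z := by
    rw [Algebra.algebraMap_eq_smul_one, Algebra.algebraMap_eq_smul_one,
      MultilinearMap.map_update_smul]
    rw [show Function.update (1 : Fin n → Matrix Bool Bool ℂ) j 1 = 1 from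
      Function.update_eq_self j 1, tensorMatrix_one]
  map_star' a := by
    rw [star_tensorMatrix]
    congr 1
    ext i : 1
    by_cases h : i = j
    · subst h; simp
    · simp [h]

theorem siteHom_apply (j : Fin n) (a : Matrix Bool Bool ℂ) :
    siteHom j a = tensorMatrix (Function.update 1 j a) := rfl

/-- The two-qubit gate `diag(1, -1, -1, -1)` on the qubits `p` and `q` of a register. -/
def pairGate (p q : Fin n) : Matrix (Fin n → Bool) (Fin n → Bool) ℂ :=
  Matrix.diagonal fun x => if x p || x q then -1 else 1

theorem star_pairGate (p q : Fin n) : star (pairGate p q) = pairGate p q := by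
  rw [pairGate, Matrix.star_eq_conjTranspose, Matrix.diagonal_conjTranspose]
  congr 1
  ext x
  simp only [Pi.star_apply]
  split_ifs <;> simp

theorem pairGate_mul_self (p q : Fin n) : pairGate p q * pairGate p q = 1 := by
  rw [pairGate, Matrix.diagonal_mul_diagonal, ← Matrix.diagonal_one]
  congr 1
  ext x
  split_ifs <;> simp

theorem pairGate_mem_unitary (p q : Fin n) :
    pairGate p q ∈ unitary (Matrix (Fin n → Bool) (Fin n → Bool) ℂ) := by
  rw [Unitary.mem_iff, star_pairGate]
  exact ⟨pairGate_mul_self p q, pairGate_mul_self p q⟩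

/-- The Pauli matrix `X`. -/
def xGate : Matrix Bool Bool ℂ := Matrix.of fun x y => if x = y then 0 else 1

/-- The real multiple of the Pauli matrix `Y`. -/
def yGate : Matrix Bool Bool ℂ :=
  Matrix.of fun x y => if x = y then 0 else if x then -1 else 1

section

variable (A : Fin n → Matrix Bool Bool ℂ) {p q : Fin n}

/-- The tensor product `A` with the factors at `p` and `q` replaced. -/
def pairTensor (p q : Fin n) (a c : Matrix Bool Bool ℂ) :
    Matrix (Fin n → Bool) (Fin n → Bool) ℂ :=
  tensorMatrix (Function.update (Function.update A p a) q c)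

theorem pairTensor_mul (hpq : p ≠ q) (a b c d : Matrix Bool Bool ℂ) :
    pairTensor A p q a c * pairTensor 1 p q b d = pairTensor A p q (a * b) (c * d) := by
  rw [pairTensor, pairTensor, pairTensor, ← tensorMatrix_mul]
  congr 1
  ext i : 1
  by_cases hq : i = q
  · subst hq; simp
  · by_cases hp : i = p
    · subst hp; simp [hpq]
    · simp [hp, hq]

theorem mul_pairTensor (hpq : p ≠ q) (a b c d : Matrix Bool Bool ℂ) :
    pairTensor 1 p q b d * pairTensor A p q a c = pairTensor A p q (b * a) (d * c) := by
  rw [pairTensor, pairTensor, pairTensor, ← tensorMatrix_mul]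
  congr 1
  ext i : 1
  by_cases hq : i = q
  · subst hq; simp
  · by_cases hp : i = p
    · subst hp; simp [hpq]
    · simp [hp, hq]

variable {A} {V : Submodule ℂ (Matrix (Fin n → Bool) (Fin n → Bool) ℂ)}

/-- The matrices `a` with `A ⊗ a ⊗ c` in a given subspace. -/
def leftSlice (A : Fin n → Matrix Bool Bool ℂ) (p q : Fin n)
    (V : Submodule ℂ (Matrix (Fin n → Bool) (Fin n → Bool) ℂ)) (c : Matrix Bool Bool ℂ) :
    Submodule ℂ (Matrix Bool Bool ℂ) :=
  V.comap (tensorMatrix.toLinearMap (Function.update A q c) p)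

theorem mem_leftSlice (hpq : p ≠ q) {a c : Matrix Bool Bool ℂ} :
    a ∈ leftSlice A p q V c ↔ pairTensor A p q a c ∈ V := by
  rw [pairTensor, Function.update_comm hpq]
  rfl

/-- The matrices `c` with `A ⊗ a ⊗ c` in a given subspace. -/
def rightSlice (A : Fin n → Matrix Bool Bool ℂ) (p q : Fin n)
    (V : Submodule ℂ (Matrix (Fin n → Bool) (Fin n → Bool) ℂ)) (a : Matrix Bool Bool ℂ) :
    Submodule ℂ (Matrix Bool Bool ℂ) :=
  V.comap (tensorMatrix.toLinearMap (Function.update A p a) q)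

theorem mem_rightSlice {a c : Matrix Bool Bool ℂ} :
    c ∈ rightSlice A p q V a ↔ pairTensor A p q a c ∈ V := Iff.rfl

theorem pairTensor_sub_left (hpq : p ≠ q) (a b c : Matrix Bool Bool ℂ) :
    pairTensor A p q (a - b) c = pairTensor A p q a c - pairTensor A p q b c := by
  rw [pairTensor, pairTensor, pairTensor, Function.update_comm hpq, Function.update_comm hpq,
    Function.update_comm hpq, MultilinearMap.map_update_sub]

theorem pairTensor_sub_right (a b c : Matrix Bool Bool ℂ) :
    pairTensor A p q c (a - b) = pairTensor A p q c a - pairTensor A p q c b := by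
  rw [pairTensor, pairTensor, pairTensor, MultilinearMap.map_update_sub]

theorem yGate_commutators :
    yGate * xGate - xGate * yGate = (2 : ℂ) • zGate ∧
    zGate * xGate - xGate * zGate = (2 : ℂ) • yGate ∧
    zGate * yGate - yGate * zGate = (2 : ℂ) • xGate := by
  refine ⟨?_, ?_, ?_⟩ <;> ext x y <;> cases x <;> cases y <;>
    simp [xGate, yGate, zGate, Matrix.mul_apply, Matrix.diagonal_apply] <;> norm_num

theorem zGate_mul_zGate : zGate * zGate = 1 := by
  ext x y
  cases x <;> cases y <;> simp [zGate]

theorem eq_top_of_xGate_mem {U : Submodule ℂ (Matrix Bool Bool ℂ)} (h1 : 1 ∈ U)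
    (hU : ∀ a b, b ∈ U → a * b - b * a ∈ U) (hX : xGate ∈ U) : U = ⊤ := by
  obtain ⟨h₁, h₂, -⟩ := yGate_commutators
  have hZ := hU yGate _ hX
  have hY := hU zGate _ hX
  rw [h₁, U.smul_mem_iff two_ne_zero] at hZ
  rw [h₂, U.smul_mem_iff two_ne_zero] at hY
  exact eq_top_of_pauli_mem h1 hZ hX hY

theorem eq_top_of_zGate_mem {U : Submodule ℂ (Matrix Bool Bool ℂ)} (h1 : 1 ∈ U)
    (hU : ∀ a b, b ∈ U → a * b - b * a ∈ U) (hZ : zGate ∈ U) : U = ⊤ := by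
  obtain ⟨-, -, h₃⟩ := yGate_commutators
  have hX := hU yGate _ hZ
  rw [← neg_sub, h₃, U.neg_mem_iff, U.smul_mem_iff two_ne_zero] at hX
  exact eq_top_of_xGate_mem h1 hU hX

/-- Bracketing with one-qubit matrices at p acts on the first factor by arbitrary commutators. The
slice through X ⊗ Z thus becomes all of a ⊗ Z; the same at q then frees the second factor. -/
theorem pairTensor_one_mem (hpq : p ≠ q) (hV : ∀ a ∈ V, ∀ b ∈ V, a * b - b * a ∈ V)
    (hp : ∀ a, siteHom p a ∈ V) (hq : ∀ a, siteHom q a ∈ V)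
    (hXZ : pairTensor 1 p q xGate zGate ∈ V) (a c : Matrix Bool Bool ℂ) :
    pairTensor 1 p q a c ∈ V := by
  have hp' : ∀ a, pairTensor 1 p q a 1 ∈ V := fun a => by
    have := hp a
    rw [siteHom_apply] at this
    rwa [pairTensor, Function.update_comm hpq, show Function.update
      (1 : Fin n → Matrix Bool Bool ℂ) q 1 = 1 from Function.update_eq_self q 1]
  have hq' : ∀ c, pairTensor 1 p q 1 c ∈ V := fun c => by
    have := hq c
    rw [siteHom_apply] at this
    rwa [pairTensor, show Function.update
      (1 : Fin n → Matrix Bool Bool ℂ) p 1 = 1 from Function.update_eq_self p 1]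
  have hleft : ∀ c, pairTensor 1 p q xGate c ∈ V → ∀ b, pairTensor 1 p q b c ∈ V := by
    intro c hc b
    have : leftSlice 1 p q V c = ⊤ := by
      refine eq_top_of_xGate_mem ((mem_leftSlice hpq).2 (hq' c)) (fun a b hb => ?_)
        ((mem_leftSlice hpq).2 hc)
      rw [mem_leftSlice hpq] at hb ⊢
      have := hV _ (hp' a) _ hb
      rwa [pairTensor_mul _ hpq, pairTensor_mul _ hpq, one_mul, mul_one,
        ← pairTensor_sub_left hpq] at this
    exact (mem_leftSlice hpq).1 (this ▸ Submodule.mem_top)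
  have hright : rightSlice 1 p q V a = ⊤ := by
    refine eq_top_of_zGate_mem (hp' a) (fun c d hd => ?_) (hleft _ hXZ a)
    rw [mem_rightSlice] at hd ⊢
    have := hV _ (hq' c) _ hd
    rwa [pairTensor_mul _ hpq, pairTensor_mul _ hpq, one_mul, mul_one,
      ← pairTensor_sub_right] at this
  exact mem_rightSlice.1 (hright ▸ Submodule.mem_top)

/-- Let A be the fixed factors on the other sites. The bracket of A ⊗ a ⊗ 1 with 1 ⊗ b ⊗ c is A ⊗
[a,b] ⊗ c, which in particular gives A ⊗ Z ⊗ c. Bracketing that with 1 ⊗ Z ⊗ d uses Z² = 1 to give A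
⊗ 1 ⊗ [c,d]. Commutators and the identity span, so both factors become arbitrary. -/
theorem pairTensor_mem (hpq : p ≠ q) (hV : ∀ a ∈ V, ∀ b ∈ V, a * b - b * a ∈ V)
    (h1 : ∀ a c, pairTensor 1 p q a c ∈ V) (hA : ∀ a, pairTensor A p q a 1 ∈ V)
    (a c : Matrix Bool Bool ℂ) : pairTensor A p q a c ∈ V := by
  have hcomm : ∀ a b c, pairTensor A p q (a * b - b * a) c ∈ V := fun a b c => by
    have := hV _ (hA a) _ (h1 b c)
    rwa [pairTensor_mul _ hpq, mul_pairTensor _ hpq, one_mul, mul_one,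
      ← pairTensor_sub_left hpq] at this
  have hz : ∀ c, pairTensor A p q zGate c ∈ V := fun c => by
    have := hcomm yGate xGate c
    rw [yGate_commutators.1, ← mem_leftSlice hpq, Submodule.smul_mem_iff _ two_ne_zero] at this
    exact (mem_leftSlice hpq).1 this
  have hone : ∀ c, pairTensor A p q 1 c ∈ V := fun c => by
    have : rightSlice A p q V 1 = ⊤ := by
      refine Matrix.eq_top_of_commutators_mem (hA 1) fun c d => ?_
      rw [mem_rightSlice]
      have := hV _ (hz c) _ (h1 zGate d)
      rwa [pairTensor_mul _ hpq, mul_pairTensor _ hpq, zGate_mul_zGate,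
        ← pairTensor_sub_right] at this
    exact mem_rightSlice.1 (this ▸ Submodule.mem_top)
  have : leftSlice A p q V c = ⊤ :=
    Matrix.eq_top_of_commutators_mem ((mem_leftSlice hpq).2 (hone c))
      fun a b => (mem_leftSlice hpq).2 (hcomm a b c)
  exact (mem_leftSlice hpq).1 (this ▸ Submodule.mem_top)

/-- A Lie algebra of matrices on a register that contains the one-qubit matrices and an
interaction of each pair of neighbours is everything. -/
theorem eq_top_of_siteHom_mem (h1 : 1 ∈ V) (hV : ∀ a ∈ V, ∀ b ∈ V, a * b - b * a ∈ V)
    (hs : ∀ j a, siteHom j a ∈ V)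
    (hXZ : ∀ p q : Fin n, (p : ℕ) + 1 = q → pairTensor 1 p q xGate zGate ∈ V) : V = ⊤ := by
  -- Induction on the number of initial sites that may carry a nontrivial factor; the last such site
  -- is attached through its left neighbour, so interactions of neighbours suffice.
  have key : ∀ m ≤ n, ∀ M : Fin n → Matrix Bool Bool ℂ, (∀ j : Fin n, m ≤ (j : ℕ) → M j = 1) →
      tensorMatrix M ∈ V := by
    intro m
    induction m with
    | zero =>
      intro _ M hM
      rw [show M = 1 from funext fun j => hM j (Nat.zero_le _), tensorMatrix_one]
      exact h1
    | succ m ih =>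
      intro hm M hM
      let q : Fin n := ⟨m, hm⟩
      obtain rfl | ⟨k, rfl⟩ : m = 0 ∨ ∃ k, m = k + 1 := by cases m <;> simp
      · have : M = Function.update (1 : Fin n → Matrix Bool Bool ℂ) q (M q) := by
          ext j : 1
          by_cases hj : j = q
          · rw [hj]; simp
          · rw [Function.update_of_ne hj]
            refine hM j ?_
            have : (j : ℕ) ≠ 0 := fun h => hj (Fin.ext h)
            omega
        rw [this]
        exact hs q _
      · let p : Fin n := ⟨k, by omega⟩
        have hpq : p ≠ q := by simp [p, q]
        have hM' : M = Function.update (Function.update (Function.update M q 1) p (M p)) q (M q) := by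
          ext j : 1
          by_cases hj : j = q
          · rw [hj]; simp
          · by_cases hj' : j = p
            · rw [hj']; simp [hpq]
            · simp [hj, hj']
        rw [hM']
        refine pairTensor_mem hpq hV
          (pairTensor_one_mem hpq hV (hs p) (hs q) (hXZ p q rfl)) (fun a => ?_) _ _
        refine ih (by omega) _ fun j hj => ?_
        by_cases hj1 : j = q
        · rw [hj1]; simp
        · have hj2 : j ≠ p := by rintro rfl; exact (Nat.lt_irrefl _ hj)
          have hj3 : (j : ℕ) ≠ k + 1 := fun h => hj1 (Fin.ext h)
          simp only [Function.update_of_ne hj1, Function.update_of_ne hj2]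
          exact hM j (by omega)
  rw [eq_top_iff]
  rintro a -
  rw [Matrix.matrix_eq_sum_single a]
  refine V.sum_mem fun x _ => V.sum_mem fun y _ => ?_
  -- Matrix units of the register are tensor products of one-qubit matrix units.
  have : Matrix.single x y (a x y) =
      a x y • tensorMatrix (fun j => Matrix.single (x j) (y j) 1) := by
    ext x' y'
    rw [Matrix.smul_apply, tensorMatrix_apply, Matrix.single_apply]
    simp only [Matrix.single_apply, funext_iff, ← forall_and]
    split_ifs with h
    · simp [h]
    · obtain ⟨j, hj⟩ := not_forall.1 h
      rw [Finset.prod_eq_zero (Finset.mem_univ j) (if_neg hj), smul_zero]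
  rw [this]
  exact V.smul_mem _ (key n le_rfl _ fun j hj => absurd j.2 (not_lt.2 hj))

end

/-- Flipping the bit p changes the sign of the diagonal entry exactly when the bit q is 0, so
conjugation multiplies X at p by -Z at q. This is the interaction that one-qubit matrices lack. -/
theorem pairGate_conj {p q : Fin n} (hpq : p ≠ q) :
    pairGate p q * siteHom p xGate * star (pairGate p q) = -pairTensor 1 p q xGate zGate := by
  have h1 : pairTensor 1 p q xGate zGate = siteHom p xGate * siteHom q zGate := by
    rw [siteHom_apply, siteHom_apply, pairTensor, ← tensorMatrix_mul]
    congr 1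
    ext i : 1
    by_cases hq : i = q
    · subst hq; simp [hpq.symm]
    · simp [hq]
  have h2 : siteHom q zGate = Matrix.diagonal fun x : Fin n → Bool => if x q then -1 else 1 := by
    have := tensorMatrix_diagonal (n := n) fun j b => if j = q then (if b then -1 else 1) else 1
    have h : ∀ x : Fin n → Bool, (∏ j, if j = q then (if x j then (-1 : ℂ) else 1) else 1) =
        if x q then -1 else 1 := fun x => by simp
    simp only [h] at this
    rw [← this, siteHom_apply]
    congr 1
    ext i : 1
    by_cases hq : i = q
    · subst hq; simp [zGate]
    · simp [hq]
  rw [h1, h2, star_pairGate, pairGate]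
  ext x y
  rw [Matrix.mul_diagonal, Matrix.diagonal_mul, Matrix.neg_apply, Matrix.mul_diagonal]
  rw [siteHom_apply, tensorMatrix_apply]
  by_cases hp : x p = y p
  · rw [Finset.prod_eq_zero (Finset.mem_univ p) (by simp [xGate, hp])]
    simp
  by_cases hq : x q = y q
  · cases h₁ : x p <;> cases h₂ : y p <;> cases h₃ : y q <;> simp_all
  · rw [Finset.prod_eq_zero (Finset.mem_univ q) (by simp [hpq.symm, Matrix.one_apply_ne hq])]
    simp

/-- Pull K back along the embedding of one qubit, apply the one-qubit result there, and push the
one-parameter groups forward. -/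
theorem siteHom_mem_span_tangentSpace {K : Submonoid (Matrix (Fin n → Bool) (Fin n → Bool) ℂ)}
    {hK : IsClosed (K : Set (Matrix (Fin n → Bool) (Fin n → Bool) ℂ))}
    (hphase : ∀ z : ℂ, ‖z‖ = 1 → z • (1 : Matrix (Fin n → Bool) (Fin n → Bool) ℂ) ∈ K)
    (j : Fin n) (hv : siteHom j vGate ∈ K) (hv' : star (siteHom j vGate) ∈ K)
    (ht : siteHom j tGate ∈ K) (ht' : star (siteHom j tGate) ∈ K) (a : Matrix Bool Bool ℂ) :
    siteHom j a ∈
      Submodule.span ℂ (tangentSpace K hK : Set (Matrix (Fin n → Bool) (Fin n → Bool) ℂ)) := by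
  have hc : Continuous (siteHom j) :=
    (siteHom j).toAlgHom.toLinearMap.continuous_of_finiteDimensional
  let K' : Submonoid (Matrix Bool Bool ℂ) :=
    K.comap (siteHom j : Matrix Bool Bool ℂ →* Matrix (Fin n → Bool) (Fin n → Bool) ℂ)
  have hK' : IsClosed (K' : Set (Matrix Bool Bool ℂ)) := hK.preimage hc
  have hphase' : ∀ z : ℂ, ‖z‖ = 1 → z • (1 : Matrix Bool Bool ℂ) ∈ K' := fun z hz => by
    change siteHom j (z • 1) ∈ K
    rw [map_smul, map_one]
    exact hphase z hz
  rw [← map_star] at hv' ht'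
  have h := span_tangentSpace_singleQubit (K := K') (hK := hK') hphase' hv hv' ht ht'
  have ha : a ∈ Submodule.span ℂ (tangentSpace K' hK' : Set (Matrix Bool Bool ℂ)) :=
    h ▸ Submodule.mem_top
  induction ha using Submodule.span_induction with
  | mem a ha => exact Submodule.subset_span (map_mem_tangentSpace (siteHom j) hc hK ha)
  | zero => rw [map_zero]; exact zero_mem _
  | add a b _ _ h h' => rw [map_add]; exact add_mem h h'
  | smul z a _ h => rw [map_smul]; exact Submodule.smul_mem _ _ h

/-- The gates `v` and `T` on all qubits and the pair gate on neighbouring qubits are universal. -/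
theorem exists_approximation_of_gates_mem {S : Set (Matrix (Fin n → Bool) (Fin n → Bool) ℂ)}
    (hS : S ⊆ unitary (Matrix (Fin n → Bool) (Fin n → Bool) ℂ)) (hSs : ∀ g ∈ S, star g ∈ S)
    (hv : ∀ j, siteHom j vGate ∈ S) (ht : ∀ j, siteHom j tGate ∈ S)
    (hp : ∀ p q : Fin n, (p : ℕ) + 1 = q → pairGate p q ∈ S) :
    ∃ (C : ℝ) (p : ℕ), ∀ u ∈ unitary (Matrix (Fin n → Bool) (Fin n → Bool) ℂ),
      ∀ ε : ℝ, 0 < ε → ε ≤ 1 / 2 →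
      ∃ l : List (Matrix (Fin n → Bool) (Fin n → Bool) ℂ), (∀ g ∈ l, g ∈ S) ∧
        (l.length : ℝ) ≤ C * Real.log (1 / ε) ^ p ∧
        ∃ z : ℂ, ‖z‖ = 1 ∧ ‖z • l.prod - u‖ ≤ ε := by
  -- Word balls include arbitrary phases, so this monoid contains all scalars of modulus one,
  -- although no protocol has to realize them.
  let K₀ : Submonoid (Matrix (Fin n → Bool) (Fin n → Bool) ℂ) :=
    { carrier := ⋃ ℓ, wordBall S ℓ
      one_mem' := Set.mem_iUnion.2 ⟨0, one_mem_wordBall S 0⟩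
      mul_mem' := fun ha hb => by
        obtain ⟨k, hk⟩ := Set.mem_iUnion.1 ha
        obtain ⟨l, hl⟩ := Set.mem_iUnion.1 hb
        exact Set.mem_iUnion.2 ⟨k + l, mul_mem_wordBall hk hl⟩ }
  let K := K₀.topologicalClosure
  have hK : IsClosed (K : Set (Matrix (Fin n → Bool) (Fin n → Bool) ℂ)) :=
    K₀.isClosed_topologicalClosure
  have hphase : ∀ z : ℂ, ‖z‖ = 1 → z • (1 : Matrix (Fin n → Bool) (Fin n → Bool) ℂ) ∈ K :=
    fun z hz => K₀.le_topologicalClosure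
      (Set.mem_iUnion.2 ⟨0, smul_mem_wordBall (one_mem_wordBall S 0) hz⟩)
  have hSK : ∀ g ∈ S, g ∈ K := fun g hg => K₀.le_topologicalClosure
    (Set.mem_iUnion.2 ⟨1, [g], by simpa using hg, by simp, 1, by simp, by simp⟩)
  have hspan : Submodule.span ℂ (tangentSpace K hK : Set (Matrix (Fin n → Bool) (Fin n → Bool) ℂ)) = ⊤ := by
    have hs : ∀ j a, siteHom j a ∈
        Submodule.span ℂ (tangentSpace K hK : Set (Matrix (Fin n → Bool) (Fin n → Bool) ℂ)) :=
      fun j a => siteHom_mem_span_tangentSpace hphase j (hSK _ (hv j)) (hSK _ (hSs _ (hv j)))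
        (hSK _ (ht j)) (hSK _ (hSs _ (ht j))) a
    refine eq_top_of_siteHom_mem (one_mem_span_tangentSpace hphase)
      (fun a ha b hb => commutator_mem_span_tangentSpace ha hb) hs fun p q hpq => ?_
    have hne : p ≠ q := by rintro rfl; omega
    have := conj_mem_span_tangentSpace (hs p xGate) (pairGate_mem_unitary p q)
      (hSK _ (hp p q hpq)) (hSK _ (hSs _ (hp p q hpq)))
    rwa [pairGate_conj hne, Submodule.neg_mem_iff] at this
  exact solovay_kitaev Matrix.span_one_commutators hS hSs fun u hu =>
    unitary_subset_of_span_tangentSpace (hK := hK) hphase hspan hu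

end Register

/-! ## Protocols on fusion spaces with a given charge to the left -/

namespace CrossedSymbols

set_option linter.unusedSectionVars false

open Finset

section

variable {G L : Type} [Group G] [Fintype L] [DecidableEq L] (D : CrossedSymbols G L)

/-- The linear map of a move at position `i`, where `e` is the charge to the left of the word. -/
noncomputable def moveMap (m : Move L) (i : ℕ) (e : L) (w : List L) : Ket L →ₗ[ℂ] Ket L :=
  Finsupp.linearCombination ℂ (D.moveTree m i e w)

/-- The linear map of a protocol, where `e` is the charge to the left of the word. -/
noncomputable def runFrom (e : L) : List L → Protocol L → Ket L →ₗ[ℂ] Ket L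
  | _, [] => LinearMap.id
  | w, (i, m) :: P => (runFrom e (D.moveWord m i w) P).comp (D.moveMap m i e w)

/-- The fusion tree with given charges, all vertices being the first basis vectors. -/
noncomputable def ket (l : List L) : Ket L := Finsupp.single (l.map fun a => (a, 0)) 1

theorem run_eq_runFrom (w : List L) (P : Protocol L) : D.run w P = D.runFrom D.one w P := by
  induction P generalizing w with
  | nil => rfl
  | cons p P ih => obtain ⟨i, m⟩ := p; simp only [run, runFrom, ih, moveMap]

theorem runWord_append (w : List L) (P Q : Protocol L) :
    D.runWord w (P ++ Q) = D.runWord (D.runWord w P) Q := by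
  induction P generalizing w with
  | nil => rfl
  | cons p P ih => obtain ⟨i, m⟩ := p; exact ih _

theorem runFrom_append (e : L) (w : List L) (P Q : Protocol L) (k : Ket L) :
    D.runFrom e w (P ++ Q) k = D.runFrom e (D.runWord w P) Q (D.runFrom e w P k) := by
  induction P generalizing w k with
  | nil => rfl
  | cons p P ih => obtain ⟨i, m⟩ := p; exact ih _ _

theorem length_moveWord (m : Move L) (i : ℕ) (w : List L) :
    (D.moveWord m i w).length = w.length := by
  induction i generalizing w with
  | zero => rcases w with _ | ⟨x, _ | ⟨y, w⟩⟩ <;> rfl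
  | succ i ih => cases w with
    | nil => rfl
    | cons x w => simp [moveWord, ih]

/-- Kets of trees with `n` vertices. -/
abbrev ketsOfLength (L : Type) (n : ℕ) : Submodule ℂ (Ket L) :=
  Finsupp.supported ℂ ℂ {t | t.length = n}

theorem moveTree_mem_ketsOfLength (m : Move L) (i : ℕ) (e : L) (w : List L) (t : List (L × ℕ)) :
    D.moveTree m i e w t ∈ ketsOfLength L t.length := by
  induction i generalizing e w t with
  | zero =>
    rcases w with _ | ⟨x, _ | ⟨y, w⟩⟩ <;> rcases t with _ | ⟨⟨f, α⟩, _ | ⟨⟨d, β⟩, t⟩⟩ <;>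
      simp only [moveTree, zero_mem]
    exact sum_mem fun f' _ => sum_mem fun α' _ => sum_mem fun β' _ =>
      Finsupp.single_mem_supported _ _ (by simp)
  | succ i ih =>
    rcases w with _ | ⟨x, w⟩ <;> rcases t with _ | ⟨⟨f, α⟩, t⟩ <;>
      simp only [moveTree, zero_mem]
    have h := ih f w t
    rw [Finsupp.mem_supported] at h ⊢
    refine (Finset.coe_subset.2 Finsupp.mapDomain_support).trans ?_
    rw [Finset.coe_image]
    rintro _ ⟨s, hs, rfl⟩
    have := h hs
    simpa using this

theorem moveMap_mem_ketsOfLength {m : Move L} {i : ℕ} {e : L} {w : List L} {n : ℕ} {k : Ket L}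
    (hk : k ∈ ketsOfLength L n) : D.moveMap m i e w k ∈ ketsOfLength L n := by
  rw [moveMap, Finsupp.linearCombination_apply]
  refine sum_mem fun t ht => Submodule.smul_mem _ _ ?_
  have : t.length = n := hk ht
  exact this ▸ D.moveTree_mem_ketsOfLength m i e w t

/-- The charge after a tree that starts with charge `e`. -/
def lastCharge (e : L) : List L → L
  | [] => e
  | f :: t => lastCharge f t

/-- Trees with `l₁` before and `l₂` after. -/
noncomputable def wrap (l₁ l₂ : List L) : Ket L →ₗ[ℂ] Ket L :=
  Finsupp.lmapDomain ℂ ℂ fun t => l₁.map (fun a => (a, 0)) ++ t ++ l₂.map (fun a => (a, 0))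

theorem wrap_ket (l₁ l₂ l : List L) : wrap l₁ l₂ (ket l) = ket (l₁ ++ l ++ l₂) := by
  simp [wrap, ket, Finsupp.mapDomain_single]

/-- A protocol on strands with larger numbers. -/
def shift (n : ℕ) (P : Protocol L) : Protocol L := P.map fun p => (p.1 + n, p.2)

theorem moveWord_append {m : Move L} {i : ℕ} (w₁ w w₂ : List L) (hi : i + 1 < w.length) :
    D.moveWord m (i + w₁.length) (w₁ ++ w ++ w₂) = w₁ ++ D.moveWord m i w ++ w₂ := by
  induction w₁ with
  | cons x w₁ ih =>
    simp only [List.length_cons, ← Nat.add_assoc, List.cons_append, moveWord, ih]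
  | nil =>
    simp only [List.length_nil, Nat.add_zero, List.nil_append]
    induction i generalizing w with
    | zero =>
      rcases w with _ | ⟨x, _ | ⟨y, w⟩⟩
      · simp at hi
      · simp at hi
      · rfl
    | succ i ih =>
      rcases w with _ | ⟨x, w⟩
      · simp at hi
      · simp only [List.cons_append, moveWord]
        rw [ih w (by simpa using hi)]

/-- A move sees the strands to its left only through their total charge and leaves the strands to
its right alone. The length conditions ensure that the tree of the part ends where its word does;
otherwise charges of the suffix would be read as charges of the part. -/
theorem moveTree_append {m : Move L} {i : ℕ} (e : L) (w₁ w w₂ l₁ l₂ : List L)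
    (hi : i + 1 < w.length) (h₁ : l₁.length = w₁.length) {t : List (L × ℕ)}
    (ht : t.length = w.length) :
    D.moveTree m (i + w₁.length) e (w₁ ++ w ++ w₂)
        (l₁.map (fun a => (a, 0)) ++ t ++ l₂.map (fun a => (a, 0))) =
      wrap l₁ l₂ (D.moveTree m i (lastCharge e l₁) w t) := by
  induction l₁ generalizing e w₁ with
  | cons f l₁ ih =>
    rcases w₁ with _ | ⟨x, w₁⟩
    · simp at h₁
    simp only [List.length_cons, ← Nat.add_assoc, List.cons_append, List.map_cons, moveTree,
      lastCharge]
    rw [ih f w₁ (by simpa using h₁)]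
    simp only [wrap, Finsupp.lmapDomain_apply]
    rw [← Finsupp.mapDomain_comp]
    rfl
  | nil =>
    obtain rfl := List.length_eq_zero_iff.1 h₁.symm
    simp only [List.length_nil, Nat.add_zero, List.nil_append, List.map_nil, lastCharge]
    clear h₁
    induction i generalizing e w t with
    | zero =>
      rcases w with _ | ⟨x, _ | ⟨y, w⟩⟩
      · simp at hi
      · simp at hi
      rcases t with _ | ⟨⟨f, α⟩, _ | ⟨⟨d, β⟩, t⟩⟩
      · simp at ht
      · simp at ht
      simp only [List.cons_append, moveTree, map_sum, wrap, Finsupp.lmapDomain_apply,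
        Finsupp.mapDomain_single, List.map_nil, List.nil_append]
    | succ i ih =>
      rcases w with _ | ⟨x, w⟩
      · simp at hi
      rcases t with _ | ⟨⟨f, α⟩, t⟩
      · simp at ht
      simp only [List.cons_append, moveTree]
      rw [ih (e := f) (w := w) (hi := by simpa using hi) (ht := by simpa using ht)]
      simp only [wrap, Finsupp.lmapDomain_apply]
      rw [← Finsupp.mapDomain_comp, ← Finsupp.mapDomain_comp]
      rfl

theorem moveMap_wrap {m : Move L} {i : ℕ} (e : L) (w₁ w w₂ l₁ l₂ : List L)
    (hi : i + 1 < w.length) (h₁ : l₁.length = w₁.length) {k : Ket L}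
    (hk : k ∈ ketsOfLength L w.length) :
    D.moveMap m (i + w₁.length) e (w₁ ++ w ++ w₂) (wrap l₁ l₂ k) =
      wrap l₁ l₂ (D.moveMap m i (lastCharge e l₁) w k) := by
  rw [wrap, Finsupp.lmapDomain_apply, moveMap, Finsupp.linearCombination_mapDomain, moveMap,
    Finsupp.linearCombination_apply, Finsupp.linearCombination_apply, Finsupp.sum, Finsupp.sum,
    map_sum]
  refine sum_congr rfl fun t ht => ?_
  rw [map_smul]
  exact congrArg (k t • ·) (D.moveTree_append e w₁ w w₂ l₁ l₂ hi h₁ (hk ht))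

/-- A protocol on a part of the strands. -/
theorem runFrom_wrap (e : L) (w₁ w w₂ l₁ l₂ : List L) (P : Protocol L)
    (hP : ∀ p ∈ P, p.1 + 1 < w.length) (h₁ : l₁.length = w₁.length) {k : Ket L}
    (hk : k ∈ ketsOfLength L w.length) :
    D.runFrom e (w₁ ++ w ++ w₂) (shift w₁.length P) (wrap l₁ l₂ k) =
      wrap l₁ l₂ (D.runFrom (lastCharge e l₁) w P k) := by
  induction P generalizing w k with
  | nil => rfl
  | cons p P ih =>
    obtain ⟨i, m⟩ := p
    have hi : i + 1 < w.length := hP _ (List.mem_cons_self)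
    have hl := D.length_moveWord m i w
    simp only [shift, List.map_cons, runFrom, LinearMap.comp_apply]
    rw [D.moveMap_wrap e w₁ w w₂ l₁ l₂ hi h₁ hk, D.moveWord_append w₁ w w₂ hi]
    refine ih _ (fun q hq => ?_) ?_
    · rw [hl]; exact hP q (List.mem_cons_of_mem _ hq)
    · rw [hl]; exact D.moveMap_mem_ketsOfLength hk

theorem runWord_wrap (w₁ w w₂ : List L) (P : Protocol L) (hP : ∀ p ∈ P, p.1 + 1 < w.length) :
    D.runWord (w₁ ++ w ++ w₂) (shift w₁.length P) = w₁ ++ D.runWord w P ++ w₂ := by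
  induction P generalizing w with
  | nil => rfl
  | cons p P ih =>
    obtain ⟨i, m⟩ := p
    have hi : i + 1 < w.length := hP _ (List.mem_cons_self)
    simp only [shift, List.map_cons, runWord]
    rw [D.moveWord_append w₁ w w₂ hi]
    refine ih _ fun q hq => ?_
    rw [D.length_moveWord m i w]; exact hP q (List.mem_cons_of_mem _ hq)

theorem ket_mem_ketsOfLength (l : List L) : ket l ∈ ketsOfLength L l.length :=
  Finsupp.single_mem_supported _ _ (by simp)

end

/-! ## Multiplicity-free fusion spaces -/

section

variable {G L : Type} [Group G] [Fintype L] [DecidableEq L] {D : CrossedSymbols G L}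

/-- A product of multiplicities equal to 1 forces both to be 1, and a zero product empties one
range, so only the first basis vectors over the listed charges contribute. -/
theorem sum_range_eq_of_mul_eq {M : Type*} [AddCommMonoid M] {m n : L → ℕ} {s : Finset L}
    (h : ∀ f, m f * n f = if f ∈ s then 1 else 0) (g : L → ℕ → ℕ → M) :
    ∑ f, ∑ μ ∈ range (m f), ∑ ν ∈ range (n f), g f μ ν = ∑ f ∈ s, g f 0 0 := by
  rw [← sum_subset (subset_univ s) fun f _ hf => ?_]
  · refine sum_congr rfl fun f hf => ?_
    have := h f
    rw [if_pos hf, mul_eq_one] at this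
    simp [this.1, this.2]
  · have := h f
    rw [if_neg hf, Nat.mul_eq_zero] at this
    rcases this with h | h <;> simp [h]

/-- The trees that fuse `e`, `x`, `y` to `d` are given by the charges in `s`. -/
def Trees (D : CrossedSymbols G L) (e x y d : L) (s : Finset L) : Prop :=
  ∀ f, D.N e x f * D.N f y d = if f ∈ s then 1 else 0

/-- The trees that fuse `x` and `y` first and the result with `e` to `d` are given by the charges
in `s`. -/
def Channels (D : CrossedSymbols G L) (e x y d : L) (s : Finset L) : Prop :=
  ∀ k, D.N x y k * D.N e k d = if k ∈ s then 1 else 0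

theorem Trees.mem {e x y d f : L} {s : Finset L} (h : Trees D e x y d s) (hf : f ∈ s) :
    D.N e x f = 1 ∧ D.N f y d = 1 := by
  have := h f
  rwa [if_pos hf, mul_eq_one] at this

theorem Channels.mem {e x y d k : L} {s : Finset L} (h : Channels D e x y d s) (hk : k ∈ s) :
    D.N x y k = 1 ∧ D.N e k d = 1 := by
  have := h k
  rwa [if_pos hk, mul_eq_one] at this

/-- Associativity of fusion equates the number of trees with the number of channels, so a single
tree leaves room for a single channel. -/
theorem Trees.exists_channels (hD : D.IsUnitaryCrossed) {e x y d f : L}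
    (h : Trees D e x y d {f}) : ∃ k, Channels D e x y d {k} := by
  have h1 := hD.fusion.assoc e x y d
  simp only [h _, mem_singleton, sum_ite_eq', mem_univ, if_true] at h1
  have : ∃ k ∈ univ, D.N x y k * D.N e k d ≠ 0 :=
    exists_ne_zero_of_sum_ne_zero (by rw [← h1]; exact one_ne_zero)
  obtain ⟨k, -, hk⟩ := this
  refine ⟨k, fun k' => ?_⟩
  rw [← add_sum_erase univ _ (mem_univ k)] at h1
  split_ifs with hkk
  · obtain rfl := mem_singleton.1 hkk; omega
  · have h0 : ∑ k ∈ univ.erase k, D.N x y k * D.N e k d = 0 := by omega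
    exact (sum_eq_zero_iff.1 h0) k' (mem_erase.2 ⟨fun h => hkk (by simp [h]), mem_univ _⟩)

theorem Channels.sum {M : Type*} [AddCommMonoid M] {e x y d : L} {s : Finset L}
    (h : Channels D e x y d s) (g : L → ℕ → ℕ → M) :
    ∑ k, ∑ μ ∈ range (D.N x y k), ∑ ν ∈ range (D.N e k d), g k μ ν = ∑ k ∈ s, g k 0 0 :=
  sum_range_eq_of_mul_eq h g

/-- Orthonormality of the rows of a multiplicity-free `F`-matrix. -/
theorem Channels.F_row (hD : D.IsUnitaryCrossed) {e x y d f f' : L} {s s' : Finset L}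
    (h : Channels D e x y d s) (h' : Trees D e x y d s') (hf : f ∈ s') (hf' : f' ∈ s') :
    ∑ k ∈ s, D.F e x y d (f, 0, 0) (k, 0, 0) * star (D.F e x y d (f', 0, 0) (k, 0, 0)) =
      if f = f' then 1 else 0 := by
  have := hD.unitarity.F_row e x y d f 0 0 f' 0 0 (by simp [(h'.mem hf).1])
    (by simp [(h'.mem hf).2]) (by simp [(h'.mem hf').1]) (by simp [(h'.mem hf').2])
  rw [h.sum fun k μ ν =>
    D.F e x y d (f, 0, 0) (k, μ, ν) * star (D.F e x y d (f', 0, 0) (k, μ, ν))] at this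
  simpa using this

theorem norm_eq_one_of_mul_star {z : ℂ} (h : z * star z = 1) : ‖z‖ = 1 := by
  have := congrArg norm h
  rw [norm_mul, norm_star, norm_one] at this
  nlinarith [norm_nonneg z]

theorem mul_star_of_norm {z : ℂ} (h : ‖z‖ = 1) : z * star z = 1 := by
  rw [RCLike.star_def, Complex.mul_conj, Complex.normSq_eq_norm_sq, h]; simp

theorem Channels.norm_F (hD : D.IsUnitaryCrossed) {e x y d f k : L}
    (h : Channels D e x y d {k}) (h' : Trees D e x y d {f}) :
    ‖D.F e x y d (f, 0, 0) (k, 0, 0)‖ = 1 := by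
  have := h.F_row hD h' (mem_singleton_self f) (mem_singleton_self f)
  rw [sum_singleton, if_pos rfl] at this
  exact norm_eq_one_of_mul_star this

theorem norm_R (hD : D.IsUnitaryCrossed) {a b c : L} (h : D.N a b c = 1) :
    ‖D.R a b c 0 0‖ = 1 := by
  have := hD.unitarity.R_row a b c 0 0 (by simp [h]) (by simp [h])
  rw [h] at this
  exact norm_eq_one_of_mul_star (by simpa using this)

theorem moveTree_zero_of_trees {m : Move L} {e x y d f : L} {s : Finset L} (w t : List L)
    (h : Trees D e (D.target m x y).1 (D.target m x y).2 d s) :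
    D.moveMap m 0 e (x :: y :: w) (ket (f :: d :: t)) =
      ∑ f' ∈ s, D.localAmp m e x y d (f, 0, 0) (f', 0, 0) • ket (f' :: d :: t) := by
  rw [moveMap, ket, Finsupp.linearCombination_single, one_smul]
  simp only [List.map_cons, moveTree]
  rw [sum_range_eq_of_mul_eq (s := s) h]
  simp [ket]

theorem N_target_braid (hD : D.IsUnitaryCrossed) (m : Move L) (x y k : L) :
    D.N (D.target m x y).1 (D.target m x y).2 k = D.N x y k := by
  cases m with
  | braid => exact hD.grading.N_cross x y k
  | braidInv =>
    have h := hD.grading.N_cross y (D.act (D.deg y)⁻¹ x) k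
    rw [← hD.grading.act_mul, mul_inv_cancel, hD.grading.act_one] at h
    exact h.symm
  | measure c => rfl

theorem localAmp_eq_sum (hD : D.IsUnitaryCrossed) {m : Move L} {e x y d : L} {s : Finset L}
    (h : Channels D e x y d s) (f f' : L) :
    D.localAmp m e x y d (f, 0, 0) (f', 0, 0) =
      ∑ k ∈ s, D.F e x y d (f, 0, 0) (k, 0, 0) * D.amp m x y k 0 0 *
        star (D.F e (D.target m x y).1 (D.target m x y).2 d (f', 0, 0) (k, 0, 0)) := by
  rw [localAmp]
  rw [← sum_subset (subset_univ s) fun k _ hk => ?_]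
  · refine sum_congr rfl fun k hk => ?_
    have := h.mem hk
    simp [N_target_braid hD, this.1, this.2]
  · have := h k
    rw [if_neg hk, Nat.mul_eq_zero] at this
    rcases this with h | h <;> simp [h]

theorem Channels.target (hD : D.IsUnitaryCrossed) {m : Move L} {e x y d : L} {s : Finset L}
    (h : Channels D e x y d s) : Channels D e (D.target m x y).1 (D.target m x y).2 d s := by
  intro k
  rw [N_target_braid hD]
  exact h k

/-- Measurement in a one-dimensional fusion space. -/
theorem localAmp_measure (hD : D.IsUnitaryCrossed) {e x y d f k c : L}
    (h : Trees D e x y d {f}) (hk : Channels D e x y d {k}) :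
    D.localAmp (.measure c) e x y d (f, 0, 0) (f, 0, 0) = if k = c then 1 else 0 := by
  rw [localAmp_eq_sum hD hk, sum_singleton]
  have := mul_star_of_norm (hk.norm_F hD h)
  simp only [CrossedSymbols.target, amp, and_true]
  split_ifs
  · rw [mul_one]; exact this
  · simp

/-- An exchange in a one-dimensional fusion space is a phase. -/
theorem norm_localAmp_braid (hD : D.IsUnitaryCrossed) {m : Move L} (hm : ∀ c, m ≠ .measure c)
    {e x y d f f' : L} (h : Trees D e x y d {f})
    (h' : Trees D e (D.target m x y).1 (D.target m x y).2 d {f'}) :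
    ‖D.localAmp m e x y d (f, 0, 0) (f', 0, 0)‖ = 1 := by
  obtain ⟨k, hk⟩ := h.exists_channels hD
  have hN := (hk.mem (mem_singleton_self k)).1
  have hN' := ((hk.target (m := m) hD).mem (mem_singleton_self k)).1
  rw [localAmp_eq_sum hD hk, sum_singleton, norm_mul, norm_mul, norm_star, hk.norm_F hD h,
    (hk.target hD).norm_F hD h']
  cases m with
  | braid =>
    have := norm_R hD hN'
    simp only [CrossedSymbols.target] at this
    rw [amp, this]; simp
  | braidInv => rw [amp, norm_star, norm_R hD hN]; simp
  | measure c => exact absurd rfl (hm c)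

/-- The exchange in the other direction is the adjoint. -/
theorem localAmp_braid_star (hD : D.IsUnitaryCrossed) (e x y d : L) (s s' : L × ℕ × ℕ) :
    D.localAmp .braid e y (D.act (D.deg y)⁻¹ x) d s' s =
      star (D.localAmp .braidInv e x y d s s') := by
  have hx : D.act (D.deg y) (D.act (D.deg y)⁻¹ x) = x := by
    rw [← hD.grading.act_mul, mul_inv_cancel, hD.grading.act_one]
  simp only [localAmp, CrossedSymbols.target, amp, hx, star_sum, star_mul', star_star]
  refine sum_congr rfl fun k _ => ?_
  rw [sum_comm]
  refine sum_congr rfl fun μ _ => sum_congr rfl fun μ' _ => sum_congr rfl fun ν _ => ?_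
  ring

end

end CrossedSymbols

/-! ## Exchanges in one-dimensional fusion spaces of bilayer Ising with defects -/

namespace BilayerLabel

/-- The label of `a` after it is crossed by `b`. -/
def pass : BilayerLabel → BilayerLabel → BilayerLabel
  | defect _, anyon a b => anyon b a
  | _, z => z

theorem pass_pass (b a : BilayerLabel) : pass b (pass b a) = a := by
  cases b <;> cases a <;> rfl

/-- The exchange of two neighbouring strands, with the left strand on top if `b` is true. -/
def exchange (b : Bool) : Move BilayerLabel := if b then .braid else .braidInv

/-- The labels of the two strands after an exchange. -/
def exchangeLabels (b : Bool) (x y : BilayerLabel) : BilayerLabel × BilayerLabel :=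
  if b then (pass x y, x) else (y, pass y x)

theorem exchangeLabels_exchangeLabels (b : Bool) (x y : BilayerLabel) :
    exchangeLabels (!b) (exchangeLabels b x y).1 (exchangeLabels b x y).2 = (x, y) := by
  cases b <;> simp [exchangeLabels, pass_pass]

/-- The word after an exchange. -/
def exchangeWord (b : Bool) : ℕ → List BilayerLabel → List BilayerLabel
  | 0, x :: y :: w => (exchangeLabels b x y).1 :: (exchangeLabels b x y).2 :: w
  | i + 1, x :: w => x :: exchangeWord b i w
  | _, w => w

/-- The exchange of the strands `i` and `i + 1` takes place in one-dimensional fusion spaces and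
its result is the tree with `i`-th charge `f'`. -/
def exchangeOK (b : Bool) (f' : BilayerLabel) :
    ℕ → BilayerLabel → List BilayerLabel → List BilayerLabel → Bool
  | 0, e, x :: y :: _, f :: d :: _ =>
      decide (∀ g, N e x g * N g y d = if g = f then 1 else 0) &&
        decide (∀ g, N e (exchangeLabels b x y).1 g * N g (exchangeLabels b x y).2 d =
          if g = f' then 1 else 0)
  | i + 1, _, _ :: w, f :: t => exchangeOK b f' i f w t
  | _, _, _, _ => false

/-- A sequence of exchanges `(i, b, f')` in one-dimensional fusion spaces leads from one word with
a tree to another one. -/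
def pathOK (e : BilayerLabel) :
    List (ℕ × Bool × BilayerLabel) → List BilayerLabel → List BilayerLabel →
      List BilayerLabel → List BilayerLabel → Bool
  | [], w, t, w', t' => decide (w = w' ∧ t = t')
  | (i, b, f) :: p, w, t, w', t' =>
      exchangeOK b f i e w t && pathOK e p (exchangeWord b i w) (t.set i f) w' t'

end BilayerLabel

namespace CrossedSymbols

open Finset

/-- The protocol `P` maps a fusion tree to a multiple of another one by a phase, and the protocol
`Q` is its inverse on these trees. -/
structure PhasePath (D : CrossedSymbols Z₂ BilayerLabel) (e : BilayerLabel)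
    (w t : List BilayerLabel) (P Q : Protocol BilayerLabel) (w' t' : List BilayerLabel) : Prop where
  word : D.runWord w P = w'
  word_inv : D.runWord w' Q = w
  phase : ∃ a : ℂ, ‖a‖ = 1 ∧ D.runFrom e w P (ket t) = a • ket t' ∧
    D.runFrom e w' Q (ket t') = star a • ket t

variable {D : CrossedSymbols Z₂ BilayerLabel}

theorem PhasePath.trans {e : BilayerLabel} {w t w' t' w'' t'' : List BilayerLabel}
    {P Q P' Q' : Protocol BilayerLabel} (h : PhasePath D e w t P Q w' t')
    (h' : PhasePath D e w' t' P' Q' w'' t'') :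
    PhasePath D e w t (P ++ P') (Q' ++ Q) w'' t'' := by
  obtain ⟨a, ha, h1, h2⟩ := h.phase
  obtain ⟨a', ha', h1', h2'⟩ := h'.phase
  refine ⟨?_, ?_, a * a', by simp [ha, ha'], ?_, ?_⟩
  · rw [runWord_append, h.word, h'.word]
  · rw [runWord_append, h'.word_inv, h.word_inv]
  · rw [runFrom_append, h.word, h1, map_smul, h1', smul_smul]
  · rw [runFrom_append, h'.word_inv, h2', map_smul, h2, smul_smul, star_mul]

theorem PhasePath.refl (e : BilayerLabel) (w t : List BilayerLabel) :
    PhasePath D e w t [] [] w t :=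
  ⟨rfl, rfl, 1, by simp, by simp [runFrom], by simp [runFrom]⟩

theorem act_deg (hI : D.ExtendsBilayerIsing) (hD : D.IsUnitaryCrossed) (b a : BilayerLabel) :
    D.act (D.deg b) a = pass b a := by
  cases b with
  | anyon b b' => rw [hI.deg_anyon, hD.grading.act_one]; rfl
  | defect b =>
    rw [hI.deg_defect]
    cases a with
    | anyon a a' => exact hI.act_anyon a a'
    | defect a => exact hI.act_defect a

theorem act_deg_inv (hI : D.ExtendsBilayerIsing) (hD : D.IsUnitaryCrossed) (b a : BilayerLabel) :
    D.act (D.deg b)⁻¹ a = pass b a := by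
  rw [← act_deg hI hD]
  congr 1
  cases b with
  | anyon b b' => rw [hI.deg_anyon, inv_one]
  | defect b => rw [hI.deg_defect]; decide

theorem target_exchange (hI : D.ExtendsBilayerIsing) (hD : D.IsUnitaryCrossed) (b : Bool)
    (x y : BilayerLabel) : D.target (exchange b) x y = exchangeLabels b x y := by
  cases b with
  | false => simp [exchange, exchangeLabels, target, act_deg_inv hI hD]
  | true => simp [exchange, exchangeLabels, target, act_deg hI hD]

theorem moveWord_exchange (hI : D.ExtendsBilayerIsing) (hD : D.IsUnitaryCrossed) (b : Bool) (i : ℕ)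
    (w : List BilayerLabel) : D.moveWord (exchange b) i w = exchangeWord b i w := by
  induction i generalizing w with
  | zero =>
    rcases w with _ | ⟨x, _ | ⟨y, w⟩⟩
    · rfl
    · rfl
    · simp [moveWord, exchangeWord, target_exchange hI hD]
  | succ i ih =>
    rcases w with _ | ⟨x, w⟩
    · rfl
    · simp [moveWord, exchangeWord, ih]

theorem exchangeWord_exchangeWord (b : Bool) (i : ℕ) (w : List BilayerLabel) :
    exchangeWord (!b) i (exchangeWord b i w) = w := by
  induction i generalizing w with
  | zero =>
    rcases w with _ | ⟨x, _ | ⟨y, w⟩⟩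
    · rfl
    · rfl
    · have := exchangeLabels_exchangeLabels b x y
      simp [exchangeWord, this]
  | succ i ih =>
    rcases w with _ | ⟨x, w⟩
    · rfl
    · simp [exchangeWord, ih]

theorem moveMap_succ {m : Move BilayerLabel} (i : ℕ) (e x f : BilayerLabel)
    (w t : List BilayerLabel) :
    D.moveMap m (i + 1) e (x :: w) (ket (f :: t)) = wrap [f] [] (D.moveMap m i f w (ket t)) := by
  simp [moveMap, ket, moveTree, wrap]

theorem localAmp_exchange_star (hI : D.ExtendsBilayerIsing) (hD : D.IsUnitaryCrossed) (b : Bool)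
    (e x y d : BilayerLabel) (s s' : BilayerLabel × ℕ × ℕ) :
    D.localAmp (exchange !b) e (exchangeLabels b x y).1 (exchangeLabels b x y).2 d s' s =
      star (D.localAmp (exchange b) e x y d s s') := by
  cases b with
  | false =>
    have := localAmp_braid_star hD e x y d s s'
    rw [act_deg_inv hI hD] at this
    simpa [exchange, exchangeLabels] using this
  | true =>
    have := localAmp_braid_star hD e (pass x y) x d s' s
    rw [act_deg_inv hI hD, pass_pass] at this
    simp [exchange, exchangeLabels, this]

theorem exchange_ne_measure (b : Bool) (c : BilayerLabel) : exchange b ≠ .measure c := by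
  cases b <;> simp [exchange]

/-- In one dimension before and after, the exchange is an F-phase, an R-phase and a conjugate
F-phase. The opposite exchange is the adjoint, hence gives the conjugate of the same unknown phase.
-/
theorem moveMap_exchange (hI : D.ExtendsBilayerIsing) (hD : D.IsUnitaryCrossed) {b : Bool} {i : ℕ}
    {e f' : BilayerLabel} {w t : List BilayerLabel} (h : exchangeOK b f' i e w t) :
    ∃ a : ℂ, ‖a‖ = 1 ∧ D.moveMap (exchange b) i e w (ket t) = a • ket (t.set i f') ∧
      D.moveMap (exchange !b) i e (exchangeWord b i w) (ket (t.set i f')) = star a • ket t := by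
  induction i generalizing e w t with
  | zero =>
    rcases w with _ | ⟨x, _ | ⟨y, w⟩⟩ <;> rcases t with _ | ⟨f, _ | ⟨d, t⟩⟩ <;>
      simp only [exchangeOK, Bool.false_eq_true] at h
    simp only [Bool.and_eq_true, decide_eq_true_eq] at h
    obtain ⟨h1, h2⟩ := h
    have h1' : Trees D e x y d {f} := fun g => by simpa [hI.N_eq] using h1 g
    have h2' : Trees D e (D.target (exchange b) x y).1 (D.target (exchange b) x y).2 d {f'} :=
      fun g => by simpa [hI.N_eq, target_exchange hI hD] using h2 g
    refine ⟨D.localAmp (exchange b) e x y d (f, 0, 0) (f', 0, 0),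
      norm_localAmp_braid hD (exchange_ne_measure b) h1' h2', ?_, ?_⟩
    · rw [moveTree_zero_of_trees w t h2', sum_singleton]; rfl
    · have h3 : Trees D e
          (D.target (exchange !b) (exchangeLabels b x y).1 (exchangeLabels b x y).2).1
          (D.target (exchange !b) (exchangeLabels b x y).1 (exchangeLabels b x y).2).2 d {f} := by
        rw [target_exchange hI hD, exchangeLabels_exchangeLabels]; exact h1'
      simp only [exchangeWord, List.set_cons_zero]
      rw [moveTree_zero_of_trees w t h3, sum_singleton, localAmp_exchange_star hI hD]
  | succ i ih =>
    rcases w with _ | ⟨x, w⟩ <;> rcases t with _ | ⟨f, t⟩ <;>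
      simp only [exchangeOK, Bool.false_eq_true] at h
    obtain ⟨a, ha, h1, h2⟩ := ih h
    refine ⟨a, ha, ?_, ?_⟩
    · rw [moveMap_succ, h1, map_smul, wrap_ket]; simp
    · simp only [exchangeWord, List.set_cons_succ]
      rw [moveMap_succ, h2, map_smul, wrap_ket]; simp

/-- Reduces a whole journey of strands, together with its reversal, to a Boolean computation with
fusion rules; the phase stays unspecified but is shared by both directions. -/
theorem phasePath_of_pathOK (hI : D.ExtendsBilayerIsing) (hD : D.IsUnitaryCrossed)
    {e : BilayerLabel} {p : List (ℕ × Bool × BilayerLabel)} {w t w' t' : List BilayerLabel}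
    (h : pathOK e p w t w' t') :
    PhasePath D e w t (p.map fun s => (s.1, exchange s.2.1))
      (p.reverse.map fun s => (s.1, exchange !s.2.1)) w' t' := by
  induction p generalizing w t with
  | nil =>
    simp only [pathOK, decide_eq_true_eq] at h
    obtain ⟨rfl, rfl⟩ := h
    exact PhasePath.refl e w t
  | cons s p ih =>
    obtain ⟨i, b, f⟩ := s
    simp only [pathOK, Bool.and_eq_true] at h
    obtain ⟨a, ha, h1, h2⟩ := moveMap_exchange hI hD h.1
    have h3 : PhasePath D e w t [(i, exchange b)] [(i, exchange !b)] (exchangeWord b i w)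
        (t.set i f) := by
      refine ⟨moveWord_exchange hI hD b i w, ?_, a, ha, h1, h2⟩
      rw [runWord, runWord, moveWord_exchange hI hD, exchangeWord_exchangeWord]
    have := h3.trans (ih h.2)
    simpa using this

end CrossedSymbols

/-! ### Projections in one-dimensional fusion spaces -/

namespace BilayerLabel

/-- The measurement of the strands `i` and `i + 1` takes place in one-dimensional fusion spaces; the
tree is kept if `keep` is true and annihilated otherwise. -/
def measureOK (c : BilayerLabel) (keep : Bool) :
    ℕ → BilayerLabel → List BilayerLabel → List BilayerLabel → Bool
  | 0, e, x :: y :: _, f :: d :: _ =>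
      decide (∀ g, N e x g * N g y d = if g = f then 1 else 0) &&
        decide (N x y c * N e c d = if keep then 1 else 0)
  | i + 1, _, _ :: w, f :: t => measureOK c keep i f w t
  | _, _, _, _ => false

end BilayerLabel

namespace CrossedSymbols

open Finset

variable {D : CrossedSymbols Z₂ BilayerLabel}

/-- The projection onto c either keeps or annihilates a one-dimensional space, according to whether
c is its unique channel; the F-phases cancel against their conjugates. -/
theorem moveMap_measure (hI : D.ExtendsBilayerIsing) (hD : D.IsUnitaryCrossed) {c : BilayerLabel}
    {keep : Bool} {i : ℕ} {e : BilayerLabel} {w t : List BilayerLabel}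
    (h : measureOK c keep i e w t) :
    D.moveMap (.measure c) i e w (ket t) = if keep then ket t else 0 := by
  induction i generalizing e w t with
  | zero =>
    rcases w with _ | ⟨x, _ | ⟨y, w⟩⟩ <;> rcases t with _ | ⟨f, _ | ⟨d, t⟩⟩ <;>
      simp only [measureOK, Bool.false_eq_true] at h
    simp only [Bool.and_eq_true, decide_eq_true_eq] at h
    obtain ⟨h1, h2⟩ := h
    have h1' : Trees D e x y d {f} := fun g => by simpa [hI.N_eq] using h1 g
    obtain ⟨k, hk⟩ := h1'.exists_channels hD
    have h3 := hk c
    rw [hI.N_eq, h2] at h3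
    rw [moveTree_zero_of_trees (s := {f}) w t h1', sum_singleton, localAmp_measure hD h1' hk]
    cases keep <;> simp_all [eq_comm]
  | succ i ih =>
    rcases w with _ | ⟨x, w⟩ <;> rcases t with _ | ⟨f, t⟩ <;>
      simp only [measureOK, Bool.false_eq_true] at h
    rw [moveMap_succ, ih h]
    cases keep <;> simp [wrap_ket]

/-! ### The full exchange of two defects -/

section FullExchange

variable (hD : D.IsUnitaryCrossed) (hI : D.ExtendsBilayerIsing)
  (hR : ∀ a : Ising, D.R X X (anyon a a) 0 0 = Ising.twist a)
  (hF : ∀ a b : Ising, D.F X X X X (anyon a a, 0, 0) (anyon b b, 0, 0) = Ising.S a b)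

/-- The anyon `aa`. -/
def diagAnyon (a : Ising) : BilayerLabel := anyon a a

include hI in
theorem trees_X : Trees D X X X X (univ.image diagAnyon) := by
  intro f
  rw [hI.N_eq]
  revert f
  decide

include hI in
theorem channels_X : Channels D X X X X (univ.image diagAnyon) := by
  intro f
  rw [hI.N_eq]
  revert f
  decide

theorem diagAnyon_injective : Function.Injective diagAnyon := fun a b h => by
  simpa [diagAnyon] using h

theorem sum_ising {M : Type*} [AddCommMonoid M] (g : Ising → M) :
    ∑ a, g a = g .one + (g .sig + g .psi) := by
  have : (univ : Finset Ising) = {.one, .sig, .psi} := rfl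
  rw [this, sum_insert (by simp), sum_insert (by simp), sum_singleton]

include hD hI hR hF in
-- Three defects `X₁` with total charge `X₁` have the intermediate charges 11, σσ, ψψ, each once.
-- The prescribed F- and R-symbols therefore determine the exchange completely.
theorem moveMap_braid_X (a : Ising) (w t : List BilayerLabel) :
    D.moveMap .braid 0 X (X :: X :: w) (ket (diagAnyon a :: X :: t)) =
      ∑ b, (∑ c, Ising.S a c * Ising.twist c * star (Ising.S b c)) •
        ket (diagAnyon b :: X :: t) := by
  have ht : D.target .braid X X = (X, X) := target_exchange hI hD true X X
  rw [moveTree_zero_of_trees (s := univ.image diagAnyon) w t (by rw [ht]; exact trees_X hI),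
    sum_image diagAnyon_injective.injOn]
  refine sum_congr rfl fun b _ => ?_
  rw [localAmp_eq_sum hD (channels_X hI), sum_image diagAnyon_injective.injOn]
  congr 1
  refine sum_congr rfl fun c _ => ?_
  rw [ht]
  have hd : D.act (D.deg X) X = X := act_deg hI hD X X
  simp only [diagAnyon, hF, amp, hd, hR]

theorem twist_sig_sq : Ising.twist .sig ^ 2 = Complex.exp (Real.pi * Complex.I / 4) := by
  rw [Ising.twist, ← Complex.exp_nat_mul]
  congr 1
  push_cast
  ring

theorem twist_sig_pow_four : Ising.twist .sig ^ 4 = Complex.I := by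
  rw [Ising.twist, ← Complex.exp_nat_mul]
  refine Eq.trans ?_ Complex.exp_pi_div_two_mul_I
  congr 1
  push_cast
  ring

theorem sqrt_two_sq : ((√2 : ℝ) : ℂ) ^ 2 = 2 := by
  rw [← Complex.ofReal_pow, Real.sq_sqrt (by norm_num)]
  norm_num

/-- The matrix of the exchange of two defects. -/
noncomputable def exchangeMatrix (a b : Ising) : ℂ :=
  ∑ c, Ising.S a c * Ising.twist c * star (Ising.S b c)

/-- The number s is 1/√2, but only its square enters later; the twists of 1 and ψ add or cancel, so
every entry is a multiple of θ_σ or free of it. -/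
theorem exchangeMatrix_eq : ∃ s : ℂ, s ^ 2 = 1 / 2 ∧
    exchangeMatrix .one .one = Ising.twist .sig / 2 ∧ exchangeMatrix .one .sig = s ∧
    exchangeMatrix .one .psi = -(Ising.twist .sig / 2) ∧ exchangeMatrix .sig .one = s ∧
    exchangeMatrix .sig .sig = 0 ∧ exchangeMatrix .sig .psi = s ∧
    exchangeMatrix .psi .one = -(Ising.twist .sig / 2) ∧ exchangeMatrix .psi .sig = s ∧
    exchangeMatrix .psi .psi = Ising.twist .sig / 2 := by
  have h2 := sqrt_two_sq
  have hc : (starRingEnd ℂ) 2 = 2 := map_ofNat _ 2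
  refine ⟨(√2 : ℝ) / 2, by rw [div_pow, h2]; norm_num, ?_, ?_, ?_, ?_, ?_, ?_, ?_, ?_, ?_⟩ <;>
    simp only [exchangeMatrix, sum_ising, Ising.S, show Ising.twist .one = 1 from rfl,
      show Ising.twist .psi = -1 from rfl, RCLike.star_def, map_mul, map_div₀, map_one, map_neg,
      map_zero, Complex.conj_ofReal, hc]
  · linear_combination Ising.twist .sig / 4 * h2
  · ring
  · linear_combination -Ising.twist .sig / 4 * h2
  · ring
  · ring
  · ring
  · linear_combination -Ising.twist .sig / 4 * h2
  · ring
  · linear_combination Ising.twist .sig / 4 * h2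

include hD hI hR hF in
theorem moveMap_braid_X_eq (a : Ising) (w t : List BilayerLabel) :
    D.moveMap .braid 0 X (X :: X :: w) (ket (diagAnyon a :: X :: t)) =
      exchangeMatrix a .one • ket (diagAnyon .one :: X :: t) +
        (exchangeMatrix a .sig • ket (diagAnyon .sig :: X :: t) +
          exchangeMatrix a .psi • ket (diagAnyon .psi :: X :: t)) := by
  rw [moveMap_braid_X hD hI hR hF, sum_ising]
  rfl

include hD hI in
theorem runFrom_braid_braid (w : List BilayerLabel) (k : Ket BilayerLabel) :
    D.runFrom X (X :: X :: w) [(0, .braid), (0, .braid)] k =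
      D.moveMap .braid 0 X (X :: X :: w) (D.moveMap .braid 0 X (X :: X :: w) k) := by
  have h : D.moveWord .braid 0 (X :: X :: w) = X :: X :: w :=
    moveWord_exchange hI hD true 0 (X :: X :: w)
  simp only [runFrom, h, LinearMap.comp_apply, LinearMap.id_apply]

include hD hI hR hF in
-- The two paths through 11 and ψψ add up for the return to σσ and cancel in the off-diagonal
-- amplitudes, so no phase is picked up.
theorem fullExchange_sigma (w t : List BilayerLabel) :
    D.runFrom X (X :: X :: w) [(0, .braid), (0, .braid)] (ket (anyon .sig .sig :: X :: t)) =
      ket (anyon .sig .sig :: X :: t) := by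
  obtain ⟨s, hs, h⟩ := exchangeMatrix_eq
  rw [runFrom_braid_braid hD hI, show anyon .sig .sig = diagAnyon .sig from rfl]
  simp only [moveMap_braid_X_eq hD hI hR hF, map_add, map_smul, h]
  rw [show ∀ (τ : ℂ) (u v w : Ket BilayerLabel), s • ((τ / 2) • u + (s • v + -(τ / 2) • w)) +
    ((0 : ℂ) • (s • u + ((0 : ℂ) • v + s • w)) + s • (-(τ / 2) • u + (s • v + (τ / 2) • w))) =
      (2 * s ^ 2) • v by intros; module, hs]
  norm_num

/-- The anyons `11` and `ψψ`. -/
def evenAnyon (g : Bool) : BilayerLabel := if g then anyon .psi .psi else vac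

include hD hI hR hF in
-- On the span of 11 and ψψ the sum of the two states is fixed and their difference is multiplied by
-- θ_σ². The double exchange squares this to θ_σ⁴ = i, which makes it a square root of the bit flip.
theorem fullExchange_even (g : Bool) (w t : List BilayerLabel) :
    D.runFrom X (X :: X :: w) [(0, .braid), (0, .braid)] (ket (evenAnyon g :: X :: t)) =
      ((1 + Ising.twist .sig ^ 2) / 2) • ket (evenAnyon g :: X :: t) +
        ((1 - Ising.twist .sig ^ 2) / 2) • ket (evenAnyon (!g) :: X :: t) := by
  obtain ⟨s, hs, h⟩ := exchangeMatrix_eq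
  have key : ∀ (τ : ℂ) (u v w : Ket BilayerLabel),
      (τ / 2) • ((τ / 2) • u + (s • v + -(τ / 2) • w)) +
        (s • (s • u + ((0 : ℂ) • v + s • w)) + -(τ / 2) • (-(τ / 2) • u + (s • v + (τ / 2) • w))) =
      ((1 + τ ^ 2) / 2) • u + ((1 - τ ^ 2) / 2) • w := fun τ u v w => by
    have : s * s = 1 / 2 := by rw [← hs]; ring
    simp only [smul_add, smul_smul, this]
    module
  have key' : ∀ (τ : ℂ) (u v w : Ket BilayerLabel),
      -(τ / 2) • ((τ / 2) • u + (s • v + -(τ / 2) • w)) +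
        (s • (s • u + ((0 : ℂ) • v + s • w)) + (τ / 2) • (-(τ / 2) • u + (s • v + (τ / 2) • w))) =
      ((1 + τ ^ 2) / 2) • w + ((1 - τ ^ 2) / 2) • u := fun τ u v w => by
    have : s * s = 1 / 2 := by rw [← hs]; ring
    simp only [smul_add, smul_smul, this]
    module
  have e1 : evenAnyon false = diagAnyon .one := rfl
  have e2 : evenAnyon true = diagAnyon .psi := rfl
  rw [runFrom_braid_braid hD hI]
  cases g
  · rw [Bool.not_false, e1, e2]
    simp only [moveMap_braid_X_eq hD hI hR hF, map_add, map_smul, h]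
    exact key _ _ _ _
  · rw [Bool.not_true, e1, e2]
    simp only [moveMap_braid_X_eq hD hI hR hF, map_add, map_smul, h]
    exact key' _ _ _ _

/-- Two full exchanges. -/
def doubleExchange : Protocol BilayerLabel :=
  [(0, .braid), (0, .braid), (0, .braid), (0, .braid)]

include hD hI hR hF in
theorem doubleExchange_even (g : Bool) (w t : List BilayerLabel) :
    D.runFrom X (X :: X :: w) doubleExchange (ket (evenAnyon g :: X :: t)) =
      ((1 + Complex.I) / 2) • ket (evenAnyon g :: X :: t) +
        ((1 - Complex.I) / 2) • ket (evenAnyon (!g) :: X :: t) := by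
  have h : D.runWord (X :: X :: w) [(0, .braid), (0, .braid)] = X :: X :: w := by
    have h : D.moveWord .braid 0 (X :: X :: w) = X :: X :: w :=
      moveWord_exchange hI hD true 0 (X :: X :: w)
    simp only [runWord, h]
  have h4 := twist_sig_pow_four
  rw [show doubleExchange = [(0, .braid), (0, .braid)] ++ [(0, .braid), (0, .braid)] from rfl,
    runFrom_append, h, fullExchange_even hD hI hR hF, map_add, map_smul, map_smul,
    fullExchange_even hD hI hR hF, fullExchange_even hD hI hR hF, Bool.not_not]
  simp only [smul_add, smul_smul]
  rw [← h4]
  module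

end FullExchange

/-! ### Splitting of an anyon between two defects -/

section Splitting

variable (hD : D.IsUnitaryCrossed) (hI : D.ExtendsBilayerIsing)

include hD hI

/-- Both 1σ and `X_σ` absorb the anyon 1ψ. Moving it from one to the other in the pentagon
interchanges the channels σ1 and σψ, while all other F-symbols involved are phases. -/
theorem norm_F_sigma_eq {E : BilayerLabel} (hE : E = X ∨ E = defect .psi) :
    ‖D.F (anyon .one .sig) (defect .sig) X (anyon .sig .sig) (E, 0, 0) (sigma, 0, 0)‖ =
      ‖D.F (anyon .one .sig) (defect .sig) X (anyon .sig .sig) (E, 0, 0)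
        (anyon .sig .psi, 0, 0)‖ := by
  set z := anyon .one .sig
  set p := anyon .one .psi
  set a : BilayerLabel := defect .sig
  set d := anyon .sig .sig
  set l := sigma
  set k := anyon .sig .psi
  have h := hD.consistency.pentagon z p a X d z E k l 0 0 0 0 0 0
  have hN : D.N z p z = 1 ∧ D.N z a E = 1 ∧ D.N E X d = 1 ∧ D.N a X l = 1 ∧ D.N p l k = 1 ∧
      D.N z k d = 1 ∧ D.N z l d = 1 := by
    rw [hI.N_eq]
    rcases hE with rfl | rfl <;> decide
  obtain ⟨h1, h2, h3, h4, h5, h6, h7⟩ := hN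
  have h' := h (by omega) (by omega) (by omega) (by omega) (by omega) (by omega)
  rw [h7, range_one, sum_singleton, sum_eq_single a] at h'
  · have hN : D.N p a a = 1 ∧ D.N a X k = 1 := by
      rw [hI.N_eq]; decide
    simp only [hN.1, hN.2, h2, range_one, sum_singleton] at h'
    have hT : ∀ {e x y d f k : BilayerLabel},
        (∀ g, BilayerLabel.N e x g * BilayerLabel.N g y d = if g = f then 1 else 0) →
        (∀ g, BilayerLabel.N x y g * BilayerLabel.N e g d = if g = k then 1 else 0) →
        ‖D.F e x y d (f, 0, 0) (k, 0, 0)‖ = 1 := by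
      intro e x y d f k hf hk
      refine Channels.norm_F hD (fun g => ?_) (fun g => ?_)
      · rw [hI.N_eq, hk]; simp
      · rw [hI.N_eq, hf]; simp
    have e1 : ‖D.F z p l d (z, 0, 0) (k, 0, 0)‖ = 1 := hT (by decide) (by decide)
    have e2 : ‖D.F z p a E (z, 0, 0) (a, 0, 0)‖ = 1 := by
      rcases hE with rfl | rfl <;> exact hT (by decide) (by decide)
    have e3 : ‖D.F p a X k (a, 0, 0) (l, 0, 0)‖ = 1 := hT (by decide) (by decide)
    have := congrArg norm h'
    simpa [norm_mul, e1, e2, e3] using this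
  · intro b _ hb
    have : D.N p a b = 0 := by
      rw [hI.N_eq]
      revert b
      decide
    simp [this]
  · simp

/-- The two entries of a unit row have equal modulus, so each has squared modulus 1/2. -/
theorem norm_sq_F_sigma {E : BilayerLabel} (hE : E = X ∨ E = defect .psi) :
    ‖D.F (anyon .one .sig) (defect .sig) X (anyon .sig .sig) (E, 0, 0) (sigma, 0, 0)‖ ^ 2 =
      1 / 2 := by
  have h := norm_F_sigma_eq hD hI hE
  have hT : Trees D (anyon .one .sig) (defect .sig) X (anyon .sig .sig) {X, defect .psi} := by
    intro f; rw [hI.N_eq]; revert f; decide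
  have hC : Channels D (anyon .one .sig) (defect .sig) X (anyon .sig .sig)
      {sigma, anyon .sig .psi} := by
    intro f; rw [hI.N_eq]; revert f; decide
  have hE' : E ∈ ({X, defect .psi} : Finset BilayerLabel) := by simpa using hE
  have := hC.F_row hD hT hE' hE'
  rw [sum_pair (by decide), if_pos rfl] at this
  simp only [RCLike.star_def, Complex.mul_conj, Complex.normSq_eq_norm_sq, ← h] at this
  have : ‖D.F (anyon .one .sig) (defect .sig) X (anyon .sig .sig) (E, 0, 0) (sigma, 0, 0)‖ ^ 2 +
    ‖D.F (anyon .one .sig) (defect .sig) X (anyon .sig .sig) (E, 0, 0) (sigma, 0, 0)‖ ^ 2 = 1 := by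
    exact_mod_cast this
  linarith

/-- The exchange runs through a channel of multiplicity two (`X_σ` twice into σσ), so it is not
evaluated entry by entry. The heptagon moves the braiding across the vertex, and orthonormality of
F-rows collapses the sum to one F-symbol of modulus 1/√2 up to phases. -/
theorem norm_localAmp_split {E : BilayerLabel} (hE : E = X ∨ E = defect .psi) :
    ‖D.localAmp .braidInv (defect .sig) X (anyon .one .sig) (anyon .sig .sig) (sigma, 0, 0)
      (E, 0, 0)‖ ^ 2 = 1 / 2 := by
  rw [← norm_sq_F_sigma hD hI hE]
  set z := anyon .one .sig with hz
  set a : BilayerLabel := defect .sig with ha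
  set d := anyon .sig .sig with hd
  have hact : ∀ x, D.act (D.deg z)⁻¹ x = x := fun x => act_deg_inv hI hD z x
  have hNE : D.N z a E = 1 ∧ D.N a z E = 1 ∧ D.N E X d = 1 := by
    rw [hI.N_eq]
    rcases hE with rfl | rfl <;> decide
  have hN : D.N X z a = 1 ∧ D.N z X a = 1 ∧ D.N a a d = 2 ∧ D.N sigma z d = 1 ∧
      D.N a X sigma = 1 := by
    rw [hI.N_eq]; decide
  have hk : ∀ k, k ≠ a → D.N X z k = 0 := by
    rw [hI.N_eq]; decide
  have hT : Trees D a X z d {sigma, anyon .sig .psi} := by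
    intro f; rw [hI.N_eq]; revert f; decide
  -- the braiding of `z` across the vertex
  have hept : ∀ ν < 2, D.R a z E 0 0 * D.F a z X d (E, 0, 0) (a, 0, ν) * D.R X z a 0 0 =
      ∑ f ∈ {sigma, anyon .sig .psi}, D.F z a X d (E, 0, 0) (f, 0, 0) * D.R f z d 0 0 *
        D.F a X z d (f, 0, 0) (a, 0, ν) := fun ν hν => by
    have h := hD.consistency.heptagon_over z a X d E a a X 0 0 0 ν (hact a).symm (hact X).symm
      (by omega) (by omega) (by omega) (by omega)
    simp only [hNE.2.1, hN.2.1, range_one, sum_singleton, hact] at h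
    rw [h, ← sum_subset (subset_univ {sigma, anyon .sig .psi}) fun f _ hf => ?_]
    · refine sum_congr rfl fun f hf => ?_
      obtain ⟨h1, h2⟩ := hT.mem hf
      have hU : D.U (D.deg z) a X f 0 0 = 1 := by
        rw [hI.deg_anyon, hD.normalization.U_one _ _ _ _ _ (by omega) (by omega), if_pos rfl]
      simp [h1, h2, hU]
    · have := hT f
      rw [if_neg hf, Nat.mul_eq_zero] at this
      rcases this with h | h <;> simp [h]
  -- The only charge in the rows of this F-matrix is `X_σ`, with two multiplicity indices; the sum
  -- over ν is thus a full inner product of rows.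
  have hrow : ∀ f ∈ ({sigma, anyon .sig .psi} : Finset BilayerLabel),
      ∑ ν ∈ range 2, D.F a X z d (sigma, 0, 0) (a, 0, ν) * star (D.F a X z d (f, 0, 0) (a, 0, ν)) =
        if f = sigma then 1 else 0 := fun f hf => by
    obtain ⟨h1, h2⟩ := hT.mem hf
    have h := hD.unitarity.F_row a X z d sigma 0 0 f 0 0 (by omega) (by omega) (by omega) (by omega)
    rw [sum_eq_single a (fun k _ hka => by simp [hk k hka]) (by simp), hN.1, hN.2.2.1, range_one,
      sum_singleton] at h
    rw [h]
    simp [eq_comm]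
  have hamp : D.localAmp .braidInv a X z d (sigma, 0, 0) (E, 0, 0) =
      ∑ ν ∈ range 2, D.F a X z d (sigma, 0, 0) (a, 0, ν) * star (D.R X z a 0 0) *
        star (D.F a z X d (E, 0, 0) (a, 0, ν)) := by
    rw [localAmp, sum_eq_single a (fun k _ hka => by simp [hk k hka]) (by simp)]
    simp [target, hact, hN.1, hN.2.1, hN.2.2.1, amp]
  -- The phase R is brought to the left so that the adjoint of the heptagon can be substituted; row
  -- orthogonality then selects the channel σ1.
  have key : star (D.R a z E 0 0) * D.localAmp .braidInv a X z d (sigma, 0, 0) (E, 0, 0) =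
      star (D.F z a X d (E, 0, 0) (sigma, 0, 0) * D.R sigma z d 0 0) := by
    calc _ = ∑ ν ∈ range 2, D.F a X z d (sigma, 0, 0) (a, 0, ν) *
          star (D.R a z E 0 0 * D.F a z X d (E, 0, 0) (a, 0, ν) * D.R X z a 0 0) := by
          rw [hamp, mul_sum]
          refine sum_congr rfl fun ν _ => ?_
          simp only [star_mul']; ring
      _ = ∑ f ∈ {sigma, anyon .sig .psi},
          star (D.F z a X d (E, 0, 0) (f, 0, 0) * D.R f z d 0 0) *
          ∑ ν ∈ range 2, D.F a X z d (sigma, 0, 0) (a, 0, ν) *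
            star (D.F a X z d (f, 0, 0) (a, 0, ν)) := by
          simp only [mul_sum]
          rw [sum_comm]
          refine sum_congr rfl fun ν hν => ?_
          rw [hept ν (mem_range.1 hν), star_sum, mul_sum]
          refine sum_congr rfl fun f _ => ?_
          simp only [star_mul']; ring
      _ = _ := by
          rw [sum_congr rfl fun f hf => by rw [hrow f hf]]
          simp
  have := congrArg norm key
  rw [norm_mul, norm_star, norm_star, norm_mul, norm_R hD hNE.2.1, norm_R hD hN.2.2.2.1, one_mul,
    mul_one] at this
  rw [this]

end Splitting

end CrossedSymbols

/-! ### Evaluation of the T-gate protocol -/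

namespace CrossedSymbols

open Finset

/-- The protocol `P` maps the vector `k` in the fusion space of `w` to the vector `k'` in the fusion
space of `w'`. -/
structure Maps (D : CrossedSymbols Z₂ BilayerLabel) (e : BilayerLabel) (P : Protocol BilayerLabel)
    (w : List BilayerLabel) (k : Ket BilayerLabel) (w' : List BilayerLabel)
    (k' : Ket BilayerLabel) : Prop where
  word : D.runWord w P = w'
  vec : D.runFrom e w P k = k'

variable {D : CrossedSymbols Z₂ BilayerLabel} {e : BilayerLabel}
  {P Q : Protocol BilayerLabel} {w w' w'' t t' : List BilayerLabel} {k k' k'' : Ket BilayerLabel}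

theorem Maps.trans (h : Maps D e P w k w' k') (h' : Maps D e Q w' k' w'' k'') :
    Maps D e (P ++ Q) w k w'' k'' :=
  ⟨by rw [runWord_append, h.word, h'.word], by rw [runFrom_append, h.word, h.vec, h'.vec]⟩

theorem Maps.add {l l' : Ket BilayerLabel} (h : Maps D e P w k w' k') (h' : Maps D e P w l w' l') :
    Maps D e P w (k + l) w' (k' + l') :=
  ⟨h.word, by rw [map_add, h.vec, h'.vec]⟩

theorem Maps.smul (h : Maps D e P w k w' k') (a : ℂ) : Maps D e P w (a • k) w' (a • k') :=
  ⟨h.word, by rw [map_smul, h.vec]⟩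

theorem Maps.congr (h : Maps D e P w k w' k') (hk : k' = k'') : Maps D e P w k w' k'' := hk ▸ h

theorem Maps.wrap (e : BilayerLabel) {w₁ l₁ : List BilayerLabel} (w₂ l₂ : List BilayerLabel)
    (h : Maps D (lastCharge e l₁) P w k w' k') (hP : ∀ p ∈ P, p.1 + 1 < w.length)
    (h₁ : l₁.length = w₁.length) (hk : k ∈ ketsOfLength BilayerLabel w.length) :
    Maps D e (shift w₁.length P) (w₁ ++ w ++ w₂) (CrossedSymbols.wrap l₁ l₂ k) (w₁ ++ w' ++ w₂)
      (CrossedSymbols.wrap l₁ l₂ k') :=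
  ⟨by rw [runWord_wrap _ _ _ _ _ hP, h.word], by rw [runFrom_wrap _ _ _ _ _ _ _ _ hP h₁ hk, h.vec]⟩

theorem maps_of_pathOK (hI : D.ExtendsBilayerIsing) (hD : D.IsUnitaryCrossed)
    (p : List (ℕ × Bool × BilayerLabel)) (h : pathOK e p w t w' t') :
    ∃ a : ℂ, ‖a‖ = 1 ∧ Maps D e (p.map fun s => (s.1, exchange s.2.1)) w (ket t) w' (a • ket t') ∧
      Maps D e (p.reverse.map fun s => (s.1, exchange !s.2.1)) w' (ket t') w (star a • ket t) := by
  have h := phasePath_of_pathOK hI hD h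
  obtain ⟨a, ha, h1, h2⟩ := h.phase
  exact ⟨a, ha, ⟨h.word, h1⟩, h.word_inv, h2⟩

theorem moveWord_measure (c : BilayerLabel) (i : ℕ) (w : List BilayerLabel) :
    D.moveWord (.measure c) i w = w := by
  induction i generalizing w with
  | zero => rcases w with _ | ⟨x, _ | ⟨y, w⟩⟩ <;> rfl
  | succ i ih =>
    rcases w with _ | ⟨x, w⟩
    · rfl
    · simp [moveWord, ih]

theorem maps_measure (hI : D.ExtendsBilayerIsing) (hD : D.IsUnitaryCrossed) (c : BilayerLabel)
    (keep : Bool) (i : ℕ) (h : measureOK c keep i e w t) :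
    Maps D e [(i, .measure c)] w (ket t) w (if keep then ket t else 0) :=
  ⟨moveWord_measure c i w, by
    simp only [runFrom, LinearMap.comp_apply, LinearMap.id_apply, moveMap_measure hI hD h]⟩

section TGate

variable (hD : D.IsUnitaryCrossed) (hI : D.ExtendsBilayerIsing)
  (hR : ∀ a : Ising, D.R X X (anyon a a) 0 0 = Ising.twist a)
  (hF : ∀ a b : Ising, D.F X X X X (anyon a a, 0, 0) (anyon b b, 0, 0) = Ising.S a b)

/-- The anyons `1` and `ψ` of the first layer. -/
def logicalAnyon (x : Bool) : BilayerLabel := if x then anyon .psi .one else vac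

/-- The charges of the logical trees, with a variable total charge of the first two defects. -/
def qubitCharges (x : Bool) (h : BilayerLabel) : List BilayerLabel :=
  [sigma, logicalAnyon x, sigma, vac, X, h, X, vac]

theorem ket_qubitCharges (x : Bool) :
    ket (qubitCharges x vac) = Finsupp.single (qubitTree x) 1 := rfl

/-- The defects `X₁` and `X_ψ`. -/
def evenDefect (x : Bool) : BilayerLabel := if x then defect .psi else X

include hD hI in
-- The only exchange of the loop that leaves one-dimensional spaces. The reverse exchange returns to
-- the initial tree with the conjugate amplitude, which is all that matters later; its other
-- component, with charge σψ, is left as an unknown γ.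
theorem maps_split (x : Bool) :
    ∃ α : Bool → ℂ, (∀ y, ‖α y‖ ^ 2 = 1 / 2) ∧
      Maps D vac [(4, .braidInv)] [sigma, sigma, sigma, X, X, anyon .one .sig, X, X]
        (ket [sigma, logicalAnyon x, sigma, defect .sig, sigma, anyon .sig .sig, X, vac])
        [sigma, sigma, sigma, X, anyon .one .sig, X, X, X]
        (∑ y, α y • ket [sigma, logicalAnyon x, sigma, defect .sig, evenDefect y, anyon .sig .sig,
          X, vac]) ∧
      ∀ y, ∃ γ : ℂ, Maps D vac [(4, .braid)] [sigma, sigma, sigma, X, anyon .one .sig, X, X, X]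
        (ket [sigma, logicalAnyon x, sigma, defect .sig, evenDefect y, anyon .sig .sig, X, vac])
        [sigma, sigma, sigma, X, X, anyon .one .sig, X, X]
        (star (α y) •
          ket [sigma, logicalAnyon x, sigma, defect .sig, sigma, anyon .sig .sig, X, vac] +
          γ • ket [sigma, logicalAnyon x, sigma, defect .sig, anyon .sig .psi, anyon .sig .sig, X,
            vac]) := by
  have hT : Trees D (defect .sig) (D.target .braidInv X (anyon .one .sig)).1
      (D.target .braidInv X (anyon .one .sig)).2 (anyon .sig .sig) {X, defect .psi} := by
    rw [show D.target .braidInv X (anyon .one .sig) = (anyon .one .sig, X) from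
      target_exchange hI hD false _ _]
    intro f; rw [hI.N_eq]; revert f; decide
  have hT' : Trees D (defect .sig) (D.target .braid (anyon .one .sig) X).1
      (D.target .braid (anyon .one .sig) X).2 (anyon .sig .sig) {sigma, anyon .sig .psi} := by
    rw [show D.target .braid (anyon .one .sig) X = (X, anyon .one .sig) from
      target_exchange hI hD true _ _]
    intro f; rw [hI.N_eq]; revert f; decide
  refine ⟨fun y => D.localAmp .braidInv (defect .sig) X (anyon .one .sig) (anyon .sig .sig)
      (sigma, 0, 0) (evenDefect y, 0, 0), fun y => norm_localAmp_split hD hI (by cases y <;> simp [evenDefect]),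
    ⟨moveWord_exchange hI hD false 4 _, ?_⟩, fun y => ⟨D.localAmp .braid (defect .sig)
      (anyon .one .sig) X (anyon .sig .sig) (evenDefect y, 0, 0) (anyon .sig .psi, 0, 0),
      moveWord_exchange hI hD true 4 _, ?_⟩⟩
  · simp only [runFrom, LinearMap.comp_apply, LinearMap.id_apply]
    rw [moveMap_succ, moveMap_succ, moveMap_succ, moveMap_succ, moveTree_zero_of_trees _ _ hT,
      sum_pair (by decide), Fintype.sum_bool]
    simp only [map_add, map_smul, wrap_ket]
    rw [add_comm]
    rfl
  · simp only [runFrom, LinearMap.comp_apply, LinearMap.id_apply]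
    rw [moveMap_succ, moveMap_succ, moveMap_succ, moveMap_succ, moveTree_zero_of_trees _ _ hT',
      sum_pair (by decide)]
    have h := localAmp_exchange_star hI hD false (defect .sig) X (anyon .one .sig)
      (anyon .sig .sig) (sigma, 0, 0) (evenDefect y, 0, 0)
    simp only [map_add, map_smul, wrap_ket]
    congr 2

include hD hI hR in
-- With `X_ψ` to the left, the two defects can only fuse to σσ, so each exchange contributes the
-- single eigenvalue θ_σ.
theorem maps_fullExchange_psi (w t : List BilayerLabel) :
    Maps D (defect .psi) [(0, .braid), (0, .braid)] (X :: X :: w)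
      (ket (anyon .sig .sig :: X :: t)) (X :: X :: w)
      (Ising.twist .sig ^ 2 • ket (anyon .sig .sig :: X :: t)) := by
  have h : D.moveWord .braid 0 (X :: X :: w) = X :: X :: w :=
    moveWord_exchange hI hD true 0 (X :: X :: w)
  have ht : D.target .braid X X = (X, X) := target_exchange hI hD true X X
  have hT : Trees D (defect .psi) X X X {anyon .sig .sig} := by
    intro f; rw [hI.N_eq]; revert f; decide
  have hC : Channels D (defect .psi) X X X {anyon .sig .sig} := by
    intro f; rw [hI.N_eq]; revert f; decide
  have hd : D.act (D.deg X) X = X := act_deg hI hD X X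
  have h1 : D.moveMap .braid 0 (defect .psi) (X :: X :: w) (ket (anyon .sig .sig :: X :: t)) =
      Ising.twist .sig • ket (anyon .sig .sig :: X :: t) := by
    rw [moveTree_zero_of_trees _ _ (by rw [ht]; exact hT), sum_singleton, localAmp_eq_sum hD hC,
      sum_singleton, ht]
    congr 1
    have := mul_star_of_norm (hC.norm_F hD hT)
    simp only [amp, hd, hR]
    rw [mul_right_comm, this, one_mul]
  refine ⟨by simp only [runWord, h], ?_⟩
  simp only [runFrom, h, LinearMap.comp_apply, LinearMap.id_apply, h1, map_smul]
  rw [smul_smul, sq]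

include hD hI hR hF in
theorem maps_fullExchange (x : Bool) (w t : List BilayerLabel) :
    Maps D (evenDefect x) [(0, .braid), (0, .braid)] (X :: X :: w)
      (ket (anyon .sig .sig :: X :: t)) (X :: X :: w)
      ((if x then Ising.twist .sig ^ 2 else 1) • ket (anyon .sig .sig :: X :: t)) := by
  cases x with
  | true => exact maps_fullExchange_psi hD hI hR w t
  | false =>
    have h : D.moveWord .braid 0 (X :: X :: w) = X :: X :: w :=
      moveWord_exchange hI hD true 0 (X :: X :: w)
    refine ⟨by simp only [runWord, h], ?_⟩
    rw [if_neg (by simp), one_smul]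
    exact fullExchange_sigma hD hI hR hF w t

include hD hI hR hF in
theorem maps_tProtocol (x : Bool) : ∃ γ : ℂ, Maps D vac tProtocol qubitWord
    (ket (qubitCharges x vac)) qubitWord
    ((1 / 2 * if x then Ising.twist .sig ^ 2 else 1 : ℂ) • ket (qubitCharges x vac) +
      γ • ket (qubitCharges x (anyon .psi .psi))) := by
  -- Outward journey of the fourth anyon past three defects and back across the third, all in
  -- one-dimensional spaces.
  obtain ⟨a, ha, h1, h1'⟩ := maps_of_pathOK hI hD (e := vac) (w := qubitWord)
    (t := qubitCharges x vac) (w' := [sigma, sigma, sigma, X, X, anyon .one .sig, X, X])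
    (t' := [sigma, logicalAnyon x, sigma, defect .sig, sigma, anyon .sig .sig, X, vac])
    [(3, false, defect .sig), (4, false, sigma), (5, false, defect .sig),
      (5, false, anyon .sig .sig)] (by cases x <;> decide)
  obtain ⟨α, hα, h2, h2'⟩ := maps_split hD hI x
  have h3 : ∀ y, ∃ b : ℂ, ‖b‖ = 1 ∧ _ ∧ _ := fun y =>
    maps_of_pathOK hI hD (e := vac) (w := [sigma, sigma, sigma, X, anyon .one .sig, X, X, X])
      (t := [sigma, logicalAnyon x, sigma, defect .sig, evenDefect y, anyon .sig .sig, X, vac])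
      (w' := qubitWord)
      (t' := [sigma, logicalAnyon x, sigma, logicalAnyon y, evenDefect y, anyon .sig .sig, X, vac])
      [(3, true, logicalAnyon y)] (by cases x <;> cases y <;> decide)
  choose b hb h3 h3' using h3
  -- The third anyon and the fourth take the charge x to y; they can have trivial total charge only
  -- if y = x. This transfers the logical value to the charge left of the middle defects.
  have h4 : ∀ y, _ := fun y => maps_measure hI hD (e := vac) (w := qubitWord)
    (t := [sigma, logicalAnyon x, sigma, logicalAnyon y, evenDefect y, anyon .sig .sig, X, vac])
    vac (x == y) 2 (by cases x <;> cases y <;> decide)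
  have h5 := (maps_fullExchange hD hI hR hF x [X] [vac]).wrap (w₁ := [sigma, sigma, sigma, sigma, X])
    (l₁ := [sigma, logicalAnyon x, sigma, logicalAnyon x, evenDefect x]) vac [] [] (by simp) rfl
    (ket_mem_ketsOfLength _)
  rw [map_smul, wrap_ket] at h5
  obtain ⟨γ, h6⟩ := h2' x
  -- The leaked component follows the same way home, where the first two defects end up with charge
  -- ψψ instead of 11.
  obtain ⟨a', -, h7, -⟩ := maps_of_pathOK hI hD (e := vac)
    (w := [sigma, sigma, sigma, X, X, anyon .one .sig, X, X])
    (t := [sigma, logicalAnyon x, sigma, defect .sig, anyon .sig .psi, anyon .sig .sig, X, vac])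
    (w' := qubitWord) (t' := qubitCharges x (anyon .psi .psi))
    [(5, true, defect .sig), (5, true, anyon .psi .psi), (4, true, X), (3, true, vac)]
    (by cases x <;> decide)
  refine ⟨a * α x * b x * (if x then Ising.twist .sig ^ 2 else 1) * star (b x) * γ * a', ?_⟩
  have m1 := h1.trans (h2.smul a)
  rw [Fintype.sum_bool] at m1
  have m2 := m1.trans (((((h3 true).smul _).add ((h3 false).smul _))).smul a)
  have m3 := m2.trans ((((((h4 true).smul _).smul _).add (((h4 false).smul _).smul _))).smul a)
  have m4 := m3.congr (k'' := (a * α x * b x) •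
    ket [sigma, logicalAnyon x, sigma, logicalAnyon x, evenDefect x, anyon .sig .sig, X, vac])
    (by cases x <;> simp [smul_smul, mul_assoc])
  have m5 := ((m4.trans (h5.smul _)).trans (((h3' x).smul _).smul _)).trans
    (((h6.smul _).smul _).smul _)
  have m6 := m5.trans (((((h1'.smul _).add (h7.smul _)).smul _).smul _).smul _)
  refine Maps.congr m6 ?_
  have e1 := mul_star_of_norm ha
  have e2 := mul_star_of_norm (hb x)
  -- The outward and return phases cancel in a·a* and b·b*; the split contributes |α|² = 1/2 for
  -- either logical value, so only the phase of the full exchange distinguishes them.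
  have e3 : α x * star (α x) = 1 / 2 := by
    rw [RCLike.star_def, Complex.mul_conj, Complex.normSq_eq_norm_sq, hα x]; simp
  simp only [smul_add, smul_smul]
  congr 2
  · generalize (if x = true then Ising.twist .sig ^ 2 else 1 : ℂ) = τ
    linear_combination τ * (a * star a) * (b x * star (b x)) * e3 +
      τ / 2 * (b x * star (b x)) * e1 + τ / 2 * e2
  · ring

end TGate

end CrossedSymbols

namespace CrossedSymbols

open Finset

variable {D : CrossedSymbols Z₂ BilayerLabel}

/-! ### Registers of qubits -/

/-- The charges of the logical trees of a register. -/
def registerCharges (l : List Bool) : List BilayerLabel :=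
  (l.map fun x => qubitCharges x vac).flatten

theorem registerCharges_append (l l' : List Bool) :
    registerCharges (l ++ l') = registerCharges l ++ registerCharges l' := by
  simp [registerCharges]

theorem length_registerCharges (l : List Bool) : (registerCharges l).length = 8 * l.length := by
  induction l with
  | nil => rfl
  | cons x l ih =>
    rw [← List.singleton_append, registerCharges_append, List.length_append, ih]
    simp [registerCharges, qubitCharges]
    omega

/-- Each logical block is neutral, which is why a protocol on one block acts independently of the
blocks to its left. -/
theorem lastCharge_registerCharges (l : List Bool) : lastCharge vac (registerCharges l) = vac := by
  induction l with
  | nil => rfl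
  | cons x l ih => exact ih

theorem registerWord_add (m n : ℕ) :
    registerWord (m + n) = registerWord m ++ registerWord n := by
  rw [registerWord, List.replicate_add, List.flatten_append]
  rfl

theorem length_registerWord (n : ℕ) : (registerWord n).length = 8 * n := by
  simp [registerWord, qubitWord, mul_comm]

theorem ket_registerCharges {n : ℕ} (x : Fin n → Bool) :
    ket (registerCharges (List.ofFn x)) = Finsupp.single (registerTree x) 1 := by
  rw [ket, registerCharges, registerTree, List.map_flatten, List.map_map, List.map_ofFn]
  rfl

/-- A protocol on a block of qubits. -/
theorem Maps.register {P : Protocol BilayerLabel} {l : List Bool} {k' : Ket BilayerLabel}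
    (l₁ l₂ : List Bool)
    (h : Maps D vac P (registerWord l.length) (ket (registerCharges l)) (registerWord l.length) k')
    (hP : ∀ p ∈ P, p.1 + 1 < 8 * l.length) {n : ℕ} (hn : l₁.length + l.length + l₂.length = n) :
    Maps D vac (shift (8 * l₁.length) P) (registerWord n) (ket (registerCharges (l₁ ++ l ++ l₂)))
      (registerWord n) (CrossedSymbols.wrap (registerCharges l₁) (registerCharges l₂) k') := by
  have h' : Maps D (lastCharge vac (registerCharges l₁)) P (registerWord l.length)
      (ket (registerCharges l)) (registerWord l.length) k' := by
    rwa [lastCharge_registerCharges]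
  have := h'.wrap (w₁ := registerWord l₁.length) vac (registerWord l₂.length) (registerCharges l₂)
    (by rwa [length_registerWord]) (by rw [length_registerWord, length_registerCharges])
    (by rw [length_registerWord, ← length_registerCharges]; exact ket_mem_ketsOfLength _)
  rwa [wrap_ket, length_registerWord, ← registerCharges_append, ← registerCharges_append,
    ← registerWord_add, ← registerWord_add, hn] at this

theorem realizes_of_maps (hI : D.ExtendsBilayerIsing) {n : ℕ} {P : Protocol BilayerLabel}
    {W : Matrix (Fin n → Bool) (Fin n → Bool) ℂ} {c : ℂ} (hc : c ≠ 0)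
    (h : ∀ x : Fin n → Bool, Maps D vac P (registerWord n) (ket (registerCharges (List.ofFn x)))
      (registerWord n) (c • ∑ y, W y x • ket (registerCharges (List.ofFn y)))) :
    D.Realizes P W := by
  refine ⟨(h fun _ => false).word, c, hc, fun x => ?_⟩
  rw [run_eq_runFrom, hI.one_eq, ← ket_registerCharges, (h x).vec]
  congr 1
  refine sum_congr rfl fun y _ => ?_
  rw [ket_registerCharges, Finsupp.smul_single, smul_eq_mul, mul_one]

theorem realizes_diagonal (hI : D.ExtendsBilayerIsing) {n : ℕ} {P : Protocol BilayerLabel}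
    {d : (Fin n → Bool) → ℂ} {c : ℂ} (hc : c ≠ 0)
    (h : ∀ x : Fin n → Bool, Maps D vac P (registerWord n) (ket (registerCharges (List.ofFn x)))
      (registerWord n) ((c * d x) • ket (registerCharges (List.ofFn x)))) :
    D.Realizes P (Matrix.diagonal d) := by
  refine realizes_of_maps hI hc fun x => (h x).congr ?_
  rw [sum_eq_single x (fun y _ hy => by rw [Matrix.diagonal_apply_ne _ hy, zero_smul]) (by simp),
    Matrix.diagonal_apply_eq, smul_smul]

theorem realizes_one (hI : D.ExtendsBilayerIsing) (n : ℕ) :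
    D.Realizes [] (1 : Matrix (Fin n → Bool) (Fin n → Bool) ℂ) := by
  rw [← Matrix.diagonal_one]
  refine realizes_diagonal hI one_ne_zero fun x => ⟨rfl, ?_⟩
  rw [mul_one, one_smul]
  rfl

theorem Realizes.mul {n : ℕ} {P Q : Protocol BilayerLabel}
    {V W : Matrix (Fin n → Bool) (Fin n → Bool) ℂ} (hV : D.Realizes P V) (hW : D.Realizes Q W) :
    D.Realizes (P ++ Q) (W * V) := by
  obtain ⟨hP, c, hc, h⟩ := hV
  obtain ⟨hQ, c', hc', h'⟩ := hW
  refine ⟨by rw [runWord_append, hP, hQ], c * c', mul_ne_zero hc hc', fun x => ?_⟩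
  rw [run_eq_runFrom, runFrom_append, hP, ← run_eq_runFrom, ← run_eq_runFrom, h, map_smul, map_sum,
    mul_smul]
  congr 1
  have e : ∀ y : Fin n → Bool, Finsupp.single (registerTree y) (V y x) =
      V y x • Finsupp.single (registerTree y) 1 := fun y => by simp
  simp only [e, map_smul, h', smul_sum, Matrix.mul_apply]
  rw [sum_comm]
  refine sum_congr rfl fun z _ => ?_
  rw [Finsupp.single_finsetSum, smul_sum]
  refine sum_congr rfl fun y _ => ?_
  simp only [Finsupp.smul_single, smul_eq_mul]
  congr 1
  ring

theorem Realizes.pow {n : ℕ} {P : Protocol BilayerLabel}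
    {V : Matrix (Fin n → Bool) (Fin n → Bool) ℂ} (hI : D.ExtendsBilayerIsing)
    (hV : D.Realizes P V) (m : ℕ) :
    ∃ Q : Protocol BilayerLabel, Q.length = m * P.length ∧ D.Realizes Q (V ^ m) := by
  induction m with
  | zero => exact ⟨[], by simp, by rw [pow_zero]; exact realizes_one hI n⟩
  | succ m ih =>
    obtain ⟨Q, hQ, h⟩ := ih
    exact ⟨P ++ Q, by simp [hQ]; ring, by rw [pow_succ]; exact hV.mul h⟩

theorem exists_ofFn_update {n : ℕ} (x : Fin n → Bool) (j : Fin n) :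
    ∃ l₁ l₂ : List Bool, l₁.length = j ∧ l₁.length + 1 + l₂.length = n ∧
      ∀ b, List.ofFn (Function.update x j b) = l₁ ++ [b] ++ l₂ := by
  refine ⟨(List.ofFn x).take j, (List.ofFn x).drop (j + 1), ?_, ?_, fun b => ?_⟩
  · simp
  · have := j.2
    simp
  · have : List.ofFn (Function.update x j b) = (List.ofFn x).set j b := by
      refine List.ext_getElem (by simp) fun i h₁ h₂ => ?_
      simp [List.getElem_set, Function.update_apply, Fin.ext_iff, eq_comm]
    rw [this, List.set_eq_take_append_cons_drop, if_pos (by simp)]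
    simp

theorem exists_ofFn_pair {n : ℕ} (x : Fin n → Bool) {p q : Fin n} (hpq : (p : ℕ) + 1 = q) :
    ∃ l₁ l₂ : List Bool, l₁.length = p ∧ l₁.length + 2 + l₂.length = n ∧
      List.ofFn x = l₁ ++ [x p, x q] ++ l₂ := by
  have hp := p.2
  have hq := q.2
  have hpq' : (p : ℕ) + 2 = q + 1 := by omega
  refine ⟨(List.ofFn x).take p, (List.ofFn x).drop (p + 2), by simp, by simp; omega, ?_⟩
  conv_lhs => rw [← List.take_append_drop p (List.ofFn x)]
  rw [List.append_assoc]
  congr 1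
  rw [List.drop_eq_getElem_cons (by simp), List.drop_eq_getElem_cons (by simp; omega)]
  simp only [List.getElem_ofFn, List.cons_append, List.nil_append, Fin.eta, hpq, hpq']

theorem siteHom_apply_update {n : ℕ} (j : Fin n) (M : Matrix Bool Bool ℂ) (x : Fin n → Bool)
    {E : Type*} [AddCommGroup E] [Module ℂ E] (f : (Fin n → Bool) → E) :
    ∑ y, siteHom j M y x • f y = ∑ b, M b (x j) • f (Function.update x j b) := by
  have hinj : Function.Injective fun b => Function.update x j b := Function.update_injective x j
  rw [← sum_subset (subset_univ (univ.image fun b => Function.update x j b)) fun y _ hy => ?_,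
    sum_image hinj.injOn]
  · refine sum_congr rfl fun b _ => ?_
    congr 1
    rw [siteHom_apply, tensorMatrix_apply, ← mul_prod_erase univ _ (mem_univ j),
      prod_eq_one fun i hi => ?_]
    · simp
    · have := ne_of_mem_erase hi
      simp [this]
  · have : ∃ i, i ≠ j ∧ y i ≠ x i := by
      by_contra! h
      refine hy (mem_image.2 ⟨y j, mem_univ _, ?_⟩)
      ext i
      by_cases hi : i = j
      · subst hi; simp
      · simp [hi, h i hi]
    obtain ⟨i, hi, hne⟩ := this
    rw [siteHom_apply, tensorMatrix_apply, prod_eq_zero (mem_univ i) (by simp [hi, hne]), zero_smul]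

/-- A protocol for a one-qubit gate realizes the gate on each qubit of a register. -/
theorem realizes_siteHom (hI : D.ExtendsBilayerIsing) {P : Protocol BilayerLabel}
    {M : Matrix Bool Bool ℂ} {c : ℂ} (hc : c ≠ 0) (hP : ∀ p ∈ P, p.1 + 1 < 8)
    (h : ∀ x, Maps D vac P qubitWord (ket (qubitCharges x vac)) qubitWord
      (c • ∑ y, M y x • ket (qubitCharges y vac))) {n : ℕ} (j : Fin n) :
    D.Realizes (shift (8 * j) P) (siteHom j M) := by
  refine realizes_of_maps hI hc fun x => ?_
  obtain ⟨l₁, l₂, h₁, hn, hu⟩ := exists_ofFn_update x j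
  have hx : List.ofFn x = l₁ ++ [x j] ++ l₂ := by rw [← hu, Function.update_eq_self]
  rw [hx, siteHom_apply_update, ← h₁]
  refine (Maps.register (l := [x j]) l₁ l₂ (h (x j)) (by simpa using hP) hn).congr ?_
  simp only [map_smul, map_sum]
  congr 1
  refine sum_congr rfl fun b _ => ?_
  rw [hu, show qubitCharges b vac = registerCharges [b] by simp [registerCharges], wrap_ket,
    registerCharges_append, registerCharges_append]

/-! ### The gates -/

section Gates

variable (hD : D.IsUnitaryCrossed) (hI : D.ExtendsBilayerIsing)
  (hR : ∀ a : Ising, D.R X X (anyon a a) 0 0 = Ising.twist a)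
  (hF : ∀ a b : Ising, D.F X X X X (anyon a a, 0, 0) (anyon b b, 0, 0) = Ising.S a b)

include hD hI hR hF in
-- Projecting the first two defects onto charge 11 removes the leaked ψψ component and makes the
-- T-protocol preserve the logical space.
theorem maps_tGate (x : Bool) : Maps D vac (tProtocol ++ [(4, .measure vac)]) qubitWord
    (ket (qubitCharges x vac)) qubitWord
    ((1 / 2 : ℂ) • ∑ y, tGate y x • ket (qubitCharges y vac)) := by
  obtain ⟨γ, h⟩ := maps_tProtocol hD hI hR hF x
  have h1 := maps_measure hI hD (e := vac) (w := qubitWord) (t := qubitCharges x vac) vac true 4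
    (by cases x <;> decide)
  have h2 := maps_measure hI hD (e := vac) (w := qubitWord)
    (t := qubitCharges x (anyon .psi .psi)) vac false 4 (by cases x <;> decide)
  refine (h.trans ((h1.smul _).add (h2.smul _))).congr ?_
  cases x <;> simp [tGate, twist_sig_sq, smul_smul]

include hD hI in
-- Exchanging the second and third σ gives the matrix F R F*, where F is the Hadamard matrix and the
-- two R-eigenvalues differ by the factor i; this is a square root of Pauli X up to a scalar. The
-- position 1 is zero-based.
theorem maps_vGate : ∃ c : ℂ, c ≠ 0 ∧ ∀ x, Maps D vac [(1, .braid)] qubitWord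
    (ket (qubitCharges x vac)) qubitWord (c • ∑ y, vGate y x • ket (qubitCharges y vac)) := by
  refine ⟨Complex.exp (-(Real.pi * Complex.I / 8)), Complex.exp_ne_zero _, fun x =>
    ⟨moveWord_exchange hI hD true 1 _, ?_⟩⟩
  have ht : D.target .braid sigma sigma = (sigma, sigma) := target_exchange hI hD true _ _
  have hT : Trees D sigma sigma sigma sigma (univ.image logicalAnyon) := by
    intro f; rw [hI.N_eq]; revert f; decide
  have hC : Channels D sigma sigma sigma sigma (univ.image logicalAnyon) := by
    intro f; rw [hI.N_eq]; revert f; decide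
  have hinj : Function.Injective logicalAnyon := by decide
  have hd : D.act (D.deg sigma) sigma = sigma := act_deg hI hD _ _
  have hr : Complex.exp (3 * Real.pi * Complex.I / 8) =
      Complex.exp (-(Real.pi * Complex.I / 8)) * Complex.I := by
    refine Eq.trans ?_ (congrArg (_ * ·) Complex.exp_pi_div_two_mul_I)
    rw [← Complex.exp_add]
    congr 1
    ring
  have h2 : ((√2 : ℝ) : ℂ)⁻¹ * ((√2 : ℝ) : ℂ)⁻¹ = 1 / 2 := by
    rw [← mul_inv, ← sq, sqrt_two_sq]; norm_num
  have hF : ∀ f k, D.F sigma sigma sigma sigma (logicalAnyon f, 0, 0) (logicalAnyon k, 0, 0) =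
      ((√2 : ℝ) : ℂ)⁻¹ * if f && k then -1 else 1 := fun f k => by
    have h : ∀ f k : Ising, D.F sigma sigma sigma sigma (anyon f .one, 0, 0) (anyon k .one, 0, 0) =
        Ising.F .sig .sig .sig .sig f k * Ising.F .one .one .one .one .one .one := fun f k =>
      hI.F_anyon _ _ _ _ _ _ _ _ _ _ _ _
    cases f <;> cases k <;> exact (h _ _).trans (by simp [Ising.F, Ising.N])
  have hR : ∀ k, D.R sigma sigma (logicalAnyon k) 0 0 =
      Complex.exp (-(Real.pi * Complex.I / 8)) * if k then Complex.I else 1 := fun k => by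
    have h : ∀ k : Ising, D.R sigma sigma (anyon k .one) 0 0 =
        Ising.R .sig .sig k * Ising.R .one .one .one := fun k => hI.R_anyon _ _ _ _ _ _
    cases k
    · exact (h _).trans (by simp [Ising.R, Ising.N])
    · exact (h _).trans (by simp [Ising.R, Ising.N, hr])
  have hA : ∀ f f', D.localAmp .braid sigma sigma sigma sigma (logicalAnyon f, 0, 0)
      (logicalAnyon f', 0, 0) = Complex.exp (-(Real.pi * Complex.I / 8)) * vGate f' f := by
    intro f f'
    rw [localAmp_eq_sum hD hC, sum_image hinj.injOn, ht, Fintype.sum_bool]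
    simp only [amp, hd, hF, hR]
    generalize Complex.exp (-(Real.pi * Complex.I / 8)) = ρ
    cases f <;> cases f' <;> simp [vGate] <;>
      first
      | linear_combination (ρ * (1 + Complex.I)) * h2
      | linear_combination (ρ * (1 - Complex.I)) * h2
  simp only [runFrom, LinearMap.comp_apply, LinearMap.id_apply]
  rw [qubitWord, qubitCharges, moveMap_succ, moveTree_zero_of_trees _ _ (by rw [ht]; exact hT),
    sum_image hinj.injOn, map_sum, smul_sum]
  refine sum_congr rfl fun y _ => ?_
  rw [map_smul, wrap_ket, hA, mul_smul]
  rfl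

/-- The charges of two neighbouring qubits, with a variable charge of the third and second last
defect of the first one. -/
def pairCharges (x y h : Bool) : List BilayerLabel :=
  qubitCharges x (evenAnyon h) ++ qubitCharges y vac

/-- The anyons `1σ` and `ψσ`. -/
def oddAnyon (x : Bool) : BilayerLabel := if x then anyon .psi .sig else anyon .one .sig

/-- The charges after two anyons of each of two neighbouring qubits have encircled a defect. -/
def linkedCharges (x y h : Bool) : List BilayerLabel :=
  [sigma, logicalAnyon x, oddAnyon x, evenAnyon x, X, evenAnyon h, X, evenAnyon y, oddAnyon y,
    logicalAnyon y, sigma, vac, X, vac, X, vac]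

/-- The word after two anyons of each of two neighbouring qubits have encircled a defect. -/
def linkedWord : List BilayerLabel :=
  [sigma, sigma, anyon .one .sig, anyon .one .sig, X, X, X, X, anyon .one .sig, anyon .one .sig,
    sigma, sigma, X, X, X, X]

/-- Two anyons of each of two neighbouring qubits encircle a defect. -/
def linkProtocol : Protocol BilayerLabel :=
  [(3, .braidInv), (2, .braidInv), (2, .braidInv), (3, .braidInv),
    (7, .braid), (8, .braid), (8, .braid), (7, .braid)]

/-- The inverse of `linkProtocol`. -/
def unlinkProtocol : Protocol BilayerLabel :=
  [(7, .braidInv), (8, .braidInv), (8, .braidInv), (7, .braidInv),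
    (3, .braid), (2, .braid), (2, .braid), (3, .braid)]

/-- The protocol of the two-qubit gate. -/
def pairProtocol : Protocol BilayerLabel :=
  linkProtocol ++ shift 5 doubleExchange ++ [(6, .measure vac)] ++ shift 5 doubleExchange ++
    [(4, .measure vac)] ++ shift 5 doubleExchange ++ unlinkProtocol ++ [(4, .measure vac)]

include hD hI hR hF in
-- In linked position the double exchange acts on the charge h of the first two defects as in
-- `doubleExchange_even`, regardless of x and y, since the charge left of the exchanged pair is `X₁`
-- in all cases.
theorem maps_doubleExchange (x y h : Bool) : Maps D vac (shift 5 doubleExchange) linkedWord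
    (ket (linkedCharges x y h)) linkedWord
    (((1 + Complex.I) / 2) • ket (linkedCharges x y h) +
      ((1 - Complex.I) / 2) • ket (linkedCharges x y (!h))) := by
  have hw : ∀ w, D.runWord (X :: X :: w) doubleExchange = X :: X :: w := fun w => by
    have h : D.moveWord .braid 0 (X :: X :: w) = X :: X :: w :=
      moveWord_exchange hI hD true 0 (X :: X :: w)
    simp only [doubleExchange, runWord, h]
  have := Maps.wrap (D := D) (w₁ := [sigma, sigma, anyon .one .sig, anyon .one .sig, X])
    (l₁ := [sigma, logicalAnyon x, oddAnyon x, evenAnyon x, X]) vac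
    [X, anyon .one .sig, anyon .one .sig, sigma, sigma, X, X, X, X]
    [evenAnyon y, oddAnyon y, logicalAnyon y, sigma, vac, X, vac, X, vac]
    ⟨hw [], doubleExchange_even hD hI hR hF h [] []⟩ (by simp [doubleExchange]) rfl
    (ket_mem_ketsOfLength _)
  simp only [map_add, map_smul, wrap_ket] at this
  exact this

include hD hI hR hF in
-- Linking turns the neighbouring charges into xx and yy, so trivial charge of the first (last) two
-- defects now means h = x (h = y). The three rounds drive h along the cycle 11 → y → x → 11, the
-- last projection coming after unlinking. A step contributes (1+i)/2 if h is kept and (1-i)/2 if it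
-- changes. A cycle has zero changes if x and y are both trivial and exactly two otherwise, and
-- ((1-i)/2)² = -((1+i)/2)².
theorem maps_pairProtocol (x y : Bool) : Maps D vac pairProtocol (registerWord 2)
    (ket (registerCharges [x, y])) (registerWord 2)
    (((1 + Complex.I) / 2 * (Complex.I / 2) * if x || y then -1 else 1) •
      ket (registerCharges [x, y])) := by
  have h1 : ∀ h, ∃ b : ℂ, ‖b‖ = 1 ∧ _ ∧ _ := fun h =>
    maps_of_pathOK hI hD (e := vac) (w := registerWord 2) (t := pairCharges x y h)
      (w' := linkedWord) (t' := linkedCharges x y h)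
      [(3, false, defect .sig), (2, false, evenDefect x), (2, false, oddAnyon x),
        (3, false, evenAnyon x), (7, true, defect .sig), (8, true, evenDefect y),
        (8, true, oddAnyon y), (7, true, evenAnyon y)]
      (by cases x <;> cases y <;> cases h <;> decide)
  choose b hb h1 h1' using h1
  have h2 := maps_doubleExchange hD hI hR hF x y
  have h3 : ∀ h, _ := fun h => maps_measure hI hD (e := vac) (w := linkedWord)
    (t := linkedCharges x y h) vac (h == y) 6 (by cases x <;> cases y <;> cases h <;> decide)
  have h4 : ∀ h, _ := fun h => maps_measure hI hD (e := vac) (w := linkedWord)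
    (t := linkedCharges x y h) vac (h == x) 4 (by cases x <;> cases y <;> cases h <;> decide)
  have h5 : ∀ h, _ := fun h => maps_measure hI hD (e := vac) (w := registerWord 2)
    (t := pairCharges x y h) vac (!h) 4 (by cases x <;> cases y <;> cases h <;> decide)
  have e : registerCharges [x, y] = pairCharges x y false := by
    simp [registerCharges, pairCharges, evenAnyon]
  rw [e]
  -- the amplitudes of the double exchange
  let M : Bool → Bool → ℂ := fun g h => if g = h then (1 + Complex.I) / 2 else (1 - Complex.I) / 2
  have s1 : ∀ g, Maps D vac (shift 5 doubleExchange ++ [(6, .measure vac)]) linkedWord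
      (ket (linkedCharges x y g)) linkedWord (M g y • ket (linkedCharges x y y)) := fun g =>
    ((h2 g).trans (((h3 g).smul _).add ((h3 !g).smul _))).congr (by
      cases g <;> cases y <;> simp [M])
  have s2 : ∀ g, Maps D vac (shift 5 doubleExchange ++ [(4, .measure vac)]) linkedWord
      (ket (linkedCharges x y g)) linkedWord (M g x • ket (linkedCharges x y x)) := fun g =>
    ((h2 g).trans (((h4 g).smul _).add ((h4 !g).smul _))).congr (by
      cases g <;> cases x <;> simp [M])
  have s3 : ∀ g, Maps D vac (shift 5 doubleExchange ++ unlinkProtocol ++ [(4, .measure vac)])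
      linkedWord (ket (linkedCharges x y g)) (registerWord 2)
      ((M g false * star (b false)) • ket (pairCharges x y false)) := fun g =>
    (((h2 g).trans (((h1' g).smul _).add ((h1' !g).smul _))).trans
      ((((h5 g).smul _).smul _).add (((h5 !g).smul _).smul _))).congr (by
        cases g <;> simp [M, smul_smul])
  -- Linking is done with h trivial, and the final projection restores h trivial, so the linking
  -- phase `b false` meets its own conjugate.
  have m := (((h1 false).trans ((s1 false).smul _)).trans (((s2 y).smul _).smul _)).trans
    ((((s3 x).smul _).smul _).smul _)
  refine Maps.congr (P := pairProtocol) m ?_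
  have e1 := mul_star_of_norm (hb false)
  have hI2 := Complex.I_sq
  simp only [smul_smul]
  congr 1
  calc _ = M false y * M y x * M x false * (b false * star (b false)) := by ring
    _ = _ := by
      rw [e1]
      cases x <;> cases y <;> simp [M] <;> ring_nf <;> rw [show Complex.I ^ 3 = -Complex.I by
        rw [pow_succ, Complex.I_sq]; ring, Complex.I_sq] <;> ring

end Gates

end CrossedSymbols

/-! ### Assembly of the gate set and the universality statement -/

namespace CrossedSymbols

open Finset

variable {D : CrossedSymbols Z₂ BilayerLabel}

section Universality

variable (hD : D.IsUnitaryCrossed) (hI : D.ExtendsBilayerIsing)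
  (hR : ∀ a : Ising, D.R X X (anyon a a) 0 0 = Ising.twist a)
  (hF : ∀ a b : Ising, D.F X X X X (anyon a a, 0, 0) (anyon b b, 0, 0) = Ising.S a b)

include hD hI hR hF in
theorem realizes_pairGate {n : ℕ} {p q : Fin n} (hpq : (p : ℕ) + 1 = q) :
    D.Realizes (shift (8 * p) pairProtocol) (pairGate p q) := by
  refine realizes_diagonal hI (c := (1 + Complex.I) / 2 * (Complex.I / 2)) ?_ fun x => ?_
  · have h : (1 + Complex.I) ≠ 0 := fun h => by simpa using congrArg Complex.re h
    simp [h]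
  · obtain ⟨l₁, l₂, h₁, hn, hx⟩ := exists_ofFn_pair x hpq
    rw [hx, ← h₁]
    refine (Maps.register (l := [x p, x q]) l₁ l₂ (maps_pairProtocol hD hI hR hF (x p) (x q))
      ?_ hn).congr ?_
    · change ∀ s ∈ pairProtocol, s.1 + 1 < 16
      decide
    · rw [map_smul, wrap_ket, registerCharges_append, registerCharges_append]

theorem tGate_mem_unitary : tGate ∈ unitary (Matrix Bool Bool ℂ) := by
  have h : ‖Complex.exp (Real.pi * Complex.I / 4)‖ = 1 := by
    rw [← twist_sig_sq, Ising.twist, norm_pow,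
      show 2 * (Real.pi : ℂ) * Complex.I / 16 = (2 * Real.pi / 16 : ℝ) * Complex.I by
        push_cast; ring, Complex.norm_exp_ofReal_mul_I, one_pow]
  have h1 := mul_star_of_norm h
  rw [Unitary.mem_iff, tGate, Matrix.star_eq_conjTranspose, Matrix.diagonal_conjTranspose,
    Matrix.diagonal_mul_diagonal, Matrix.diagonal_mul_diagonal, ← Matrix.diagonal_one]
  constructor <;> congr 1 <;> ext x <;> cases x <;> simp only [Pi.star_apply, if_true, if_false,
    Bool.false_eq_true, star_one, mul_one, h1]
  rw [mul_comm, h1]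

theorem tGate_pow_eight : tGate ^ 8 = 1 := by
  rw [tGate, Matrix.diagonal_pow, ← Matrix.diagonal_one]
  congr 1
  ext x
  have h : Complex.exp (Real.pi * Complex.I / 4) ^ 8 = 1 := by
    rw [← Complex.exp_nat_mul]
    refine Eq.trans ?_ Complex.exp_two_pi_mul_I
    congr 1
    push_cast
    ring
  cases x <;> simp [h]

theorem vGate_pow_four : vGate ^ 4 = 1 := by
  have h : vGate ^ 2 = xGate := by
    have hI := Complex.I_sq
    ext x y
    cases x <;> cases y <;> simp [sq, vGate, xGate, Matrix.mul_apply] <;> ring_nf <;>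
      rw [hI] <;> norm_num
  rw [show 4 = 2 * 2 from rfl, pow_mul, h]
  ext x y
  cases x <;> cases y <;> simp [sq, xGate, Matrix.mul_apply]

theorem star_eq_pow_of_mem_unitary {A : Type*} [Monoid A] [StarMul A] {u : A} (hu : u ∈ unitary A)
    {m : ℕ} (h : u ^ (m + 1) = 1) : star u = u ^ m := by
  calc star u = u ^ (m + 1) * star u := by rw [h, one_mul]
    _ = u ^ m := by rw [pow_succ, mul_assoc, Unitary.mul_star_self_of_mem hu, mul_one]

/-- The gates on the qubit `j`, and on `j` and the next qubit, with their inverses. -/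
def gatesAt {n : ℕ} (j : Fin n) : Set (Matrix (Fin n → Bool) (Fin n → Bool) ℂ) :=
  {siteHom j vGate, star (siteHom j vGate), siteHom j tGate, star (siteHom j tGate),
    if h : (j : ℕ) + 1 < n then pairGate j ⟨j + 1, h⟩ else 1}

theorem gatesAt_subset_unitary {n : ℕ} (j : Fin n) :
    gatesAt j ⊆ (unitary (Matrix (Fin n → Bool) (Fin n → Bool) ℂ) : Set _) := by
  have hv : siteHom j vGate ∈ unitary (Matrix (Fin n → Bool) (Fin n → Bool) ℂ) :=
    Unitary.map_mem (siteHom j) vGate_mem_unitary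
  have ht : siteHom j tGate ∈ unitary (Matrix (Fin n → Bool) (Fin n → Bool) ℂ) :=
    Unitary.map_mem (siteHom j) tGate_mem_unitary
  rintro g (rfl | rfl | rfl | rfl | rfl)
  · exact hv
  · exact Unitary.star_mem hv
  · exact ht
  · exact Unitary.star_mem ht
  · split_ifs
    · exact pairGate_mem_unitary _ _
    · exact one_mem _

theorem star_mem_gatesAt {n : ℕ} (j : Fin n) {g : Matrix (Fin n → Bool) (Fin n → Bool) ℂ}
    (hg : g ∈ gatesAt j) : star g ∈ gatesAt j := by
  rcases hg with rfl | rfl | rfl | rfl | rfl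
  · exact Or.inr (Or.inl rfl)
  · exact Or.inl (star_star _)
  · exact Or.inr (Or.inr (Or.inr (Or.inl rfl)))
  · exact Or.inr (Or.inr (Or.inl (star_star _)))
  · refine Or.inr (Or.inr (Or.inr (Or.inr ?_)))
    split_ifs
    · exact star_pairGate _ _
    · exact star_one _

include hD hI hR hF in
-- Protocols with projections cannot be reversed, so inverses are realized as powers, using V⁴ = 1
-- and T⁸ = 1. The longest protocol is the inverse of T, with 7 · 16 = 112 operations.
theorem exists_protocol_of_mem_gatesAt {n : ℕ} (j : Fin n)
    {g : Matrix (Fin n → Bool) (Fin n → Bool) ℂ} (hg : g ∈ gatesAt j) :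
    ∃ P : Protocol BilayerLabel, P.length ≤ 112 ∧ D.Realizes P g := by
  obtain ⟨c, hc, hv⟩ := maps_vGate hD hI
  have hv' := realizes_siteHom hI hc (by decide) hv j
  have ht' := realizes_siteHom hI (by norm_num) (by decide) (maps_tGate hD hI hR hF) j
  have hlv : (shift (8 * (j : ℕ)) [((1 : ℕ), (Move.braid : Move BilayerLabel))]).length = 1 := rfl
  have hlt : (shift (8 * (j : ℕ)) (tProtocol ++ [(4, .measure vac)])).length = 16 := rfl
  rcases hg with rfl | rfl | rfl | rfl | rfl
  · exact ⟨_, by rw [hlv]; norm_num, hv'⟩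
  · obtain ⟨Q, hQ, h⟩ := hv'.pow hI 3
    refine ⟨Q, by rw [hQ, hlv]; norm_num, ?_⟩
    rwa [← map_star, star_eq_pow_of_mem_unitary vGate_mem_unitary (m := 3) vGate_pow_four, map_pow]
  · exact ⟨_, by rw [hlt]; norm_num, ht'⟩
  · obtain ⟨Q, hQ, h⟩ := ht'.pow hI 7
    refine ⟨Q, by rw [hQ, hlt], ?_⟩
    rwa [← map_star, star_eq_pow_of_mem_unitary tGate_mem_unitary (m := 7) tGate_pow_eight, map_pow]
  · split_ifs with h
    · refine ⟨_, ?_, realizes_pairGate hD hI hR hF (p := j) (q := ⟨j + 1, h⟩) rfl⟩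
      change 31 ≤ 112
      norm_num
    · exact ⟨[], by simp, realizes_one hI n⟩

/-- The gate set on a register of qubits. -/
noncomputable def gateSet (n : ℕ) : Finset (Matrix.unitaryGroup (Fin n → Bool) ℂ) := by
  classical
  exact univ.biUnion fun j : Fin n =>
    ({siteHom j vGate, star (siteHom j vGate), siteHom j tGate, star (siteHom j tGate),
      if h : (j : ℕ) + 1 < n then pairGate j ⟨j + 1, h⟩ else 1} :
        Finset (Matrix (Fin n → Bool) (Fin n → Bool) ℂ)).attach.image fun g =>
      ⟨g.1, gatesAt_subset_unitary j (by
        have h := g.2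
        simp only [mem_insert, mem_singleton] at h
        exact h)⟩

theorem mem_gateSet {n : ℕ} {g : Matrix.unitaryGroup (Fin n → Bool) ℂ} :
    g ∈ gateSet n ↔ ∃ j, (g : Matrix (Fin n → Bool) (Fin n → Bool) ℂ) ∈ gatesAt j := by
  simp only [gateSet, mem_biUnion, mem_univ, true_and, mem_image, mem_attach, Subtype.exists]
  refine exists_congr fun j => ⟨?_, fun h => ⟨g, by simpa [gatesAt] using h, rfl⟩⟩
  rintro ⟨a, ha, rfl⟩
  simpa [gatesAt] using ha

theorem card_gateSet_le (n : ℕ) : (gateSet n).card ≤ 5 * n := by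
  refine card_biUnion_le.trans ?_
  refine (sum_le_card_nsmul univ _ 5 fun j _ => ?_).trans (by simp [mul_comm])
  refine card_image_le.trans ?_
  rw [card_attach]
  exact card_le_five

include hD hI hR hF in
theorem isUniversal : D.IsUniversal := by
  refine ⟨112, fun n => ⟨gateSet n, (card_gateSet_le n).trans (by omega), fun W hW => ?_, ?_⟩⟩
  · obtain ⟨j, hj⟩ := mem_gateSet.1 hW
    exact exists_protocol_of_mem_gatesAt hD hI hR hF j hj
  obtain ⟨C, p, h⟩ := exists_approximation_of_gates_mem (n := n) (S := ⋃ j, gatesAt j)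
    (Set.iUnion_subset gatesAt_subset_unitary)
    (fun g hg => by
      obtain ⟨j, hj⟩ := Set.mem_iUnion.1 hg
      exact Set.mem_iUnion.2 ⟨j, star_mem_gatesAt j hj⟩)
    (fun j => Set.mem_iUnion.2 ⟨j, Or.inl rfl⟩)
    (fun j => Set.mem_iUnion.2 ⟨j, Or.inr (Or.inr (Or.inl rfl))⟩)
    (fun p q hpq => Set.mem_iUnion.2 ⟨p, Or.inr (Or.inr (Or.inr (Or.inr (by
      have : (p : ℕ) + 1 < n := hpq ▸ q.2
      rw [Set.mem_singleton_iff, dif_pos this]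
      congr 1
      exact Fin.ext hpq.symm))))⟩)
  refine ⟨C, p, fun V ε hε hε' => ?_⟩
  obtain ⟨l, hl, hlen, z, hz, hle⟩ := h V V.2 ε hε hε'
  have hlu : ∀ g ∈ l, g ∈ Matrix.unitaryGroup (Fin n → Bool) ℂ := fun g hg => by
    obtain ⟨j, hj⟩ := Set.mem_iUnion.1 (hl g hg)
    exact gatesAt_subset_unitary j hj
  lift l to List (Matrix.unitaryGroup (Fin n → Bool) ℂ) using hlu
  refine ⟨l, fun W hW => ?_, by simpa using hlen, z, hz, ?_⟩
  · obtain ⟨j, hj⟩ := Set.mem_iUnion.1 (hl W (List.mem_map.2 ⟨W, hW, rfl⟩))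
    exact mem_gateSet.2 ⟨j, hj⟩
  · have hprod : ((l.prod : Matrix.unitaryGroup (Fin n → Bool) ℂ) :
        Matrix (Fin n → Bool) (Fin n → Bool) ℂ) = (l.map (↑)).prod := by
      simp
    rw [hprod]
    exact hle

include hD hI hR hF in
theorem tEntry_eq (y x : Bool) : D.tEntry y x =
    if y = x then 1 / 2 * (if x then Complex.exp (Real.pi * Complex.I / 4) else 1) else 0 := by
  obtain ⟨γ, h⟩ := maps_tProtocol hD hI hR hF x
  have h1 : ∀ x' : Bool, ket (qubitCharges x vac) (qubitTree x') = if x' = x then 1 else 0 :=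
    fun x' => by
      rw [ket_qubitCharges, Finsupp.single_apply]
      have : qubitTree x = qubitTree x' ↔ x' = x := by
        clear h
        revert x x'
        decide
      simp [this]
  -- The leaked component lies on a tree orthogonal to both logical ones, so it is invisible in the
  -- matrix entries.
  have h2 : ket (qubitCharges x (anyon .psi .psi)) (qubitTree y) = 0 := by
    rw [ket, Finsupp.single_apply, if_neg]
    clear h1 h
    revert x y
    decide
  rw [tEntry, run_eq_runFrom, hI.one_eq, ← ket_qubitCharges, h.vec, Finsupp.add_apply,
    Finsupp.smul_apply, Finsupp.smul_apply, h1, h2, twist_sig_sq]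
  split_ifs <;> simp

end Universality

end CrossedSymbols

theorem mainTheorem1 (D : CrossedSymbols Z₂ BilayerLabel)
    (hD : D.IsUnitaryCrossed) (hIsing : D.ExtendsBilayerIsing)
    (hR : ∀ a : Ising, D.R X X (anyon a a) 0 0 = Ising.twist a)
    (hF : ∀ a b : Ising, D.F X X X X (anyon a a, 0, 0) (anyon b b, 0, 0) = Ising.S a b) :
    (D.runWord qubitWord tProtocol = qubitWord ∧
      D.tEntry true false = 0 ∧ D.tEntry false true = 0 ∧ D.tEntry false false ≠ 0 ∧
      D.tEntry true true = Complex.exp (Real.pi * Complex.I / 4) * D.tEntry false false) ∧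
    D.IsUniversal := by
  have h := CrossedSymbols.tEntry_eq hD hIsing hR hF
  obtain ⟨γ, hw⟩ := CrossedSymbols.maps_tProtocol hD hIsing hR hF false
  refine ⟨⟨hw.word, ?_, ?_, ?_, ?_⟩, CrossedSymbols.isUniversal hD hIsing hR hF⟩
  · simp [h]
  · simp [h]
  · simp [h]
  · simp [h, mul_comm]
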